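/- **Setting.** Let $n\ge 3$ and consider $2n$ points on a circle, labeled clockwise $1,2,\dots,2n$ (labels modulo $2n$). The odd points are the vertices of the *hollow* polygon, the even points those of the *solid* polygon. A diagonal of a polygon is a segment joining two distinct vertices; it is external if it is a boundary edge and internal otherwise. A dissection is a set of pairwise non-crossing internal diagonals; $\overline D$ denotes the dissection $D$ together with all boundary edges of the polygon. Fix a hollow dissection $D_\circ$ (possibly empty). A solid diagonal $\delta_\bullet$ (internal or external) is a *$D_\circ$-accordion diagonal* if the set of diagonals of $\overline D_\circ$ that it crosses is connected. A *$D_\circ$-accordion dissection* is a set of pairwise non-crossing internal $D_\circ$-accordion diagonals; these sets form the *$D_\circ$-accordion complex*. The *height* $h(D_\circ|\gamma_\bullet)$ is the number of $D_\circ$-accordion diagonals that cross $\gamma_\bullet$. Let $D$ be a dissection, $\delta\in D$, and let $\varepsilon$ be a diagonal of the other color that crosses $\delta$. Let $\mu,\nu$ be the diagonals of $\overline D$ other than $\delta$ that $\varepsilon$ crosses in the two cells of $D$ containing $\delta$. If $\mu\delta\nu$ is a path $x-u-v-y$ with $\delta=uv$, it is a $\mathsf Z$ if $x,u,y,v$ appear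 in this order clockwise, and an $\mathsf S$ if $x,v,y,u$ appear in this order clockwise. Put $s(D,\delta|\varepsilon)=1$ for a $\mathsf Z$, $-1$ for an $\mathsf S$, and $0$ in all other cases (including when $\varepsilon$ and $\delta$ do not cross). With $(e_{\delta_\circ})_{\delta_\circ\in D_\circ}$ the canonical basis of $\mathbb R^{D_\circ}$, define - the $g$-vector of a $D_\circ$-accordion diagonal $\delta_\bullet$: $\;g(D_\circ|\delta_\bullet)=\sum_{\delta_\circ\in D_\circ}s(D_\circ,\delta_\circ|\delta_\bullet)\,e_{\delta_\circ}$; - for a maximal $D_\circ$-accordion dissection $D_\bullet$ and $\delta_\bullet\in D_\bullet$, the $c$-vector $\;c(D_\circ|\delta_\bullet\in D_\bullet)=-\sum_{\delta_\circ\in D_\circ}s(D_\bullet,\delta_\bullet|\delta_\circ)\,e_{\delta_\circ}$; - for a maximal $D_\circ$-accordion dissection $D_\bullet$, the point $\;p(D_\circ|D_\bullet)=\sum_{\delta_\bullet\in D_\bullet}h(D_\circ|\delta_\bullet)\,c(D_\circ|\delta_\bullet\in D_\bullet)$. The *$g$-vector fan* is the collection of the cones $\mathbb R_{\ge0}\{g(D_\circ|\delta_\bullet):\delta_\bullet\in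 D_\bullet\}$, for all $D_\circ$-accordion dissections $D_\bullet$. **Theorem.** Let $\mathrm{Acco}(D_\circ)\subset\mathbb R^{D_\circ}$ be the convex hull of the points $p(D_\circ|D_\bullet)$ for all maximal $D_\circ$-accordion dissections $D_\bullet$ (the *$D_\circ$-accordiohedron*). Then: 1. $\mathrm{Acco}(D_\circ)$ is equal to the intersection of the half-spaces $\{x\in\mathbb R^{D_\circ}:\langle g(D_\circ|\gamma_\bullet),x\rangle\le h(D_\circ|\gamma_\bullet)\}$ for all $D_\circ$-accordion diagonals $\gamma_\bullet$. 2. The $g$-vector fan is the normal fan of $\mathrm{Acco}(D_\circ)$, that is, the collection of the outer normal cones of its non-empty faces. 3. The origin lies in the interior of $\mathrm{Acco}(D_\circ)$, and the polar dual $\{y:\langle y,x\rangle\le1\text{ for all }x\in\mathrm{Acco}(D_\circ)\}$ is a polytope that realizes the $D_\circ$-accordion complex: there is an assignment of points $\delta_\bullet\mapsto f(\delta_\bullet)$ such that, for every $D_\circ$-accordion dissection $D_\bullet$, the points $f(\delta_\bullet)$, $\delta_\bullet\in D_\bullet$, are affinely independent, and $D_\bullet\mapsto\operatorname{conv}\{f(\delta_\bullet):\delta_\bullet\in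 D_\bullet\}$ is a bijection from the $D_\circ$-accordion dissections (including the empty one) to the proper faces of the polar dual (including the empty face). -/

import Mathlib

noncomputable section

namespace Accordion

/-! ## Points on the circle, diagonals, dissections and cells

The `2n` points on the circle are the elements of `Fin (2 * n)`, labelled clockwise (the label `2n`
is written `0`), with Mathlib's circular order: `sbtw a b c` says that `a`, `b`, `c` are pairwise
distinct and met in this order when turning clockwise. A convex polygon inscribed in the circle is
the finset `P` of its vertices, and a segment is the unordered pair of its endpoints. -/

/-- The `2n` points on the circle. -/
abbrev Vertex (n : ℕ) : Type := Fin (2 * n)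

/-- Segments between points on the circle. -/
abbrev Segment (n : ℕ) : Type := Sym2 (Vertex n)

variable {n : ℕ}

/-- The vertices of the hollow polygon: the points with an odd label. -/
def hollowPolygon (n : ℕ) : Finset (Vertex n) := Finset.univ.filter fun v => v.val % 2 = 1

/-- The vertices of the solid polygon: the points with an even label. -/
def solidPolygon (n : ℕ) : Finset (Vertex n) := Finset.univ.filter fun v => v.val % 2 = 0

/-- Two segments cross if their relative interiors meet in one point, that is, if their endpoints
strictly alternate along the circle. -/
def Cross (e f : Segment n) : Prop :=
  ∃ a b c d : Vertex n, e = s(a, b) ∧ f = s(c, d) ∧ sbtw a c b ∧ sbtw b d a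

/-- The diagonals of `P`, internal or external: the segments between two distinct vertices. -/
def IsDiagonal (P : Finset (Vertex n)) (e : Segment n) : Prop :=
  ¬ e.IsDiag ∧ ∀ v ∈ e, v ∈ P

/-- The external diagonals (boundary edges) of `P`: all of `P` lies on one side of them. -/
def IsBoundaryEdge (P : Finset (Vertex n)) (e : Segment n) : Prop :=
  IsDiagonal P e ∧ ∀ v ∈ P, ∀ w ∈ P, ¬ Cross e s(v, w)

/-- The internal diagonals of `P`. -/
def IsInternalDiagonal (P : Finset (Vertex n)) (e : Segment n) : Prop :=
  IsDiagonal P e ∧ ¬ IsBoundaryEdge P e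

/-- A dissection of `P`: a set of pairwise non-crossing internal diagonals. -/
def IsDissection (P : Finset (Vertex n)) (D : Finset (Segment n)) : Prop :=
  (∀ e ∈ D, IsInternalDiagonal P e) ∧ ∀ e ∈ D, ∀ f ∈ D, ¬ Cross e f

/-- The dissection `D` of `P` together with all boundary edges of `P`. -/
def withBoundary (P : Finset (Vertex n)) (D : Finset (Segment n)) : Set (Segment n) :=
  {e | e ∈ D ∨ IsBoundaryEdge P e}

/-- The cells of the dissection `D` of `P`, each given by its set of vertices: the maximal sets of
vertices of `P` no two of which are strictly separated by a diagonal of `D`. -/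
def IsCell (P : Finset (Vertex n)) (D : Finset (Segment n)) (C : Finset (Vertex n)) : Prop :=
  Maximal (fun C : Finset (Vertex n) =>
    C ⊆ P ∧ ∀ v ∈ C, ∀ w ∈ C, ∀ d ∈ D, ¬ Cross d s(v, w)) C

/-! ## Accordion diagonals and the accordion complex -/

/-- The diagonals of the dissection `D` and the boundary edges of `P` that are crossed by `ε`. When
`ε` joins two points of the circle that are separated by vertices of `P`, this is the cut of `D` by
the line that supports `ε`. -/
def crossedBy (P : Finset (Vertex n)) (D : Finset (Segment n)) (ε : Segment n) :
    Set (Segment n) :=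
  {e | e ∈ withBoundary P D ∧ Cross e ε}

/-- A set of segments is connected if one passes from any of its members to any other one through
members of the set that successively share an endpoint. -/
def IsConnectedSet (A : Set (Segment n)) : Prop :=
  ∀ e ∈ A, ∀ f ∈ A,
    Relation.ReflTransGen (fun e f => e ∈ A ∧ f ∈ A ∧ ∃ v, v ∈ e ∧ v ∈ f) e f

/-- The accordion diagonals of the hollow dissection `D`: the solid diagonals, internal or external,
such that the set of diagonals of `D` and hollow boundary edges that they cross is connected. -/
def IsAccordionDiagonal (D : Finset (Segment n)) (δ : Segment n) : Prop :=
  IsDiagonal (solidPolygon n) δ ∧ IsConnectedSet (crossedBy (hollowPolygon n) D δ)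

/-- A `D`-accordion dissection: a set of pairwise non-crossing internal `D`-accordion diagonals. -/
def IsAccordionDissection (D E : Finset (Segment n)) : Prop :=
  IsDissection (solidPolygon n) E ∧ ∀ δ ∈ E, IsAccordionDiagonal D δ

/-- The `D`-accordion complex, as the set of its faces (including the empty face). -/
def accordionComplex (D : Finset (Segment n)) : Set (Finset (Segment n)) :=
  {E | IsAccordionDissection D E}

/-- The maximal `D`-accordion dissections. -/
def IsMaximalAccordionDissection (D E : Finset (Segment n)) : Prop :=
  Maximal (IsAccordionDissection D) E

/-- The `D`-height of `γ`: the number of `D`-accordion diagonals that cross `γ`. -/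
def height (D : Finset (Segment n)) (γ : Segment n) : ℕ :=
  Set.ncard {δ : Segment n | IsAccordionDiagonal D δ ∧ Cross δ γ}

/-! ## `g`-vectors and `c`-vectors -/

/-- The segments `μ δ ν` form a path `x - u - v - y`, with `δ` joining `u` and `v`, in the shape of a
`Z`: turning clockwise, one meets `x`, `u`, `y`, `v` in this order. -/
def FormsZ (μ δ ν : Segment n) : Prop :=
  ∃ x u v y : Vertex n, μ = s(x, u) ∧ δ = s(u, v) ∧ ν = s(v, y) ∧ sbtw x u y ∧ sbtw y v x

/-- The segments `μ δ ν` form a path `x - u - v - y`, with `δ` joining `u` and `v`, in the shape of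
an `S`: turning clockwise, one meets `x`, `v`, `y`, `u` in this order. -/
def FormsS (μ δ ν : Segment n) : Prop :=
  ∃ x u v y : Vertex n, μ = s(x, u) ∧ δ = s(u, v) ∧ ν = s(v, y) ∧ sbtw x v y ∧ sbtw y u x

/-- `μ` and `ν` are the diagonals other than `δ` (boundary edges included) crossed by `ε` in the two
cells of the dissection `D` of `P` that contain the diagonal `δ` of `D`. -/
def AreNeighbours (P : Finset (Vertex n)) (D : Finset (Segment n)) (δ ε μ ν : Segment n) : Prop :=
  ∃ C C' : Finset (Vertex n), IsCell P D C ∧ IsCell P D C' ∧ C ≠ C' ∧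
    (∀ v ∈ δ, v ∈ C ∧ v ∈ C') ∧
    (μ ∈ crossedBy P D ε ∧ μ ≠ δ ∧ ∀ v ∈ μ, v ∈ C) ∧
    (ν ∈ crossedBy P D ε ∧ ν ≠ δ ∧ ∀ v ∈ ν, v ∈ C')

open Classical in
/-- The way in which `ε` slaloms on the diagonal `δ` of the dissection `D` of `P`: it is `1` if `ε`
crosses `δ` and its neighbours form a `Z` with `δ`, it is `-1` if `ε` crosses `δ` and its neighbours
form an `S` with `δ`, and it is `0` otherwise. -/
def slalomSign (P : Finset (Vertex n)) (D : Finset (Segment n)) (δ ε : Segment n) : ℝ :=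
  if Cross δ ε ∧ ∃ μ ν, AreNeighbours P D δ ε μ ν ∧ FormsZ μ δ ν then 1
  else if Cross δ ε ∧ ∃ μ ν, AreNeighbours P D δ ε μ ν ∧ FormsS μ δ ν then -1
  else 0

/-- The sign of the solid diagonal `ε` on the diagonal `δ` of the hollow dissection `D`:
`1` for a `Z`, `-1` for an `S`. -/
def hollowSign (D : Finset (Segment n)) (δ ε : Segment n) : ℝ :=
  slalomSign (hollowPolygon n) D δ ε

/-- The sign of the hollow diagonal `δ` on the diagonal `ε` of the solid dissection `E`:
`1` for an `S`, `-1` for a `Z` (the convention is opposite to the one for hollow dissections). -/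
def solidSign (E : Finset (Segment n)) (δ ε : Segment n) : ℝ :=
  -slalomSign (solidPolygon n) E ε δ

/-- The `g`-vector of the solid diagonal `ε` with respect to the hollow dissection `D`. -/
def gVector (D : Finset (Segment n)) (ε : Segment n) : EuclideanSpace ℝ D :=
  WithLp.toLp 2 fun δ : D => hollowSign D δ ε

/-- The `c`-vector of the diagonal `ε` of the solid dissection `E` with respect to the hollow
dissection `D`. -/
def cVector (D E : Finset (Segment n)) (ε : Segment n) : EuclideanSpace ℝ D :=
  WithLp.toLp 2 fun δ : D => solidSign E δ ε

/-! ## The accordiohedron -/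

/-- The point associated with the maximal `D`-accordion dissection `E`. -/
def point (D E : Finset (Segment n)) : EuclideanSpace ℝ D :=
  ∑ ε ∈ E, (height D ε : ℝ) • cVector D E ε

/-- The half-space associated with the `D`-accordion diagonal `γ`. -/
def halfSpace (D : Finset (Segment n)) (γ : Segment n) : Set (EuclideanSpace ℝ D) :=
  {x | inner ℝ (gVector D γ) x ≤ (height D γ : ℝ)}

/-- The convex hull of the points of all maximal `D`-accordion dissections. -/
def accordiohedron (D : Finset (Segment n)) : Set (EuclideanSpace ℝ D) :=
  convexHull ℝ {p | ∃ E, IsMaximalAccordionDissection D E ∧ p = point D E}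

/-- The `g`-vector fan of `D`: the collection of the cones spanned by the `g`-vectors of all
`D`-accordion dissections (maximal or not). -/
def gVectorFan (D : Finset (Segment n)) : Set (Set (EuclideanSpace ℝ D)) :=
  {K | ∃ E, IsAccordionDissection D E ∧
    K = (PointedCone.hull ℝ (gVector D '' (E : Set (Segment n))) : Set (EuclideanSpace ℝ D))}

end Accordion

/-! ## Polytopes: faces, normal fan, polar dual, boundary complex -/

namespace Polytope

variable {X : Type*} [NormedAddCommGroup X] [InnerProductSpace ℝ X]

/-- A polytope is the convex hull of finitely many points. -/
def IsPolytope (Q : Set X) : Prop :=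
  ∃ S : Set X, S.Finite ∧ Q = convexHull ℝ S

/-- The (outer) normal cone of a subset `F` of `Q`: the directions `y` in which the linear form
`⟪y, ·⟫` is maximal over `Q` at all points of `F`. -/
def normalCone (Q F : Set X) : Set X :=
  {y | ∀ x ∈ F, ∀ z ∈ Q, inner ℝ y z ≤ inner ℝ y x}

/-- The normal fan of a polytope: the collection of the normal cones of its non-empty faces. -/
def normalFan (Q : Set X) : Set (Set X) :=
  {K | ∃ F : Set X, IsExposed ℝ Q F ∧ F.Nonempty ∧ K = normalCone Q F}

/-- The polar dual of a polytope that contains the origin in its interior. -/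
def polarDual (Q : Set X) : Set X :=
  {y | ∀ x ∈ Q, inner ℝ y x ≤ 1}

/-- The proper faces of a polytope, including the empty face. -/
def properFaces (Q : Set X) : Set (Set X) :=
  {F | IsExposed ℝ Q F ∧ F ≠ Q}

/-- The polytope `Q` realizes the simplicial complex `Δ` (given by its set of faces, including the
empty one): there are points `f v` for the vertices `v` of `Δ` such that the faces of `Δ` are sent to
geometric simplices by `E ↦ conv (f '' E)`, and such that this is a bijection from the faces of `Δ`
to the proper faces of `Q`. -/
def IsRealization {V : Type*} (Q : Set X) (Δ : Set (Finset V)) : Prop :=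
  IsPolytope Q ∧ ∃ f : V → X,
    (∀ E ∈ Δ, AffineIndependent ℝ fun v : E => f v) ∧
    Set.BijOn (fun E : Finset V => convexHull ℝ (f '' (E : Set V))) Δ (properFaces Q)

end Polytope

end

/-! The argument separates polyhedral geometry from combinatorics. Let each facet `E` of a
simplicial complex carry rays `g v` with a dual basis `c E v`, and let `p E = ∑ h v • c E v`. Assume
that `⟪g v, p E⟫ ≤ h v`, with equality only for `v ∈ E`, that the heights are positive, and that
each element of a facet can be flipped out of it. A direction `y` then lies in the cone of the facet
that maximizes `⟪y, p E⟫`, since a flip at a negative coordinate would increase this value. So the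
fan is complete, and the facet inequalities, the normal fan and the faces of the polar dual all
follow (`IsFanData`).

The combinatorics verifies these assumptions. The edges of a dissection crossed by an accordion,
recorded by the ranks of their endpoints on its two sides, form a staircase in `ℕ × ℕ`, and the
slalom signs are the turns of this staircase (`slalomSign_eq`). Turns can be summed by rows or by
columns, and both sums telescope. This yields the duality of `g`- and `c`-vectors
(`MutualAccordion.sum_slalomSign`) for any two dissections made of accordions of each other; the
hypothesis is symmetric, so the sign matrices are inverse on both sides. A maximal accordion
dissection is such a partner of `D`: two accordions that cross the same diagonal of `D` can exchange
ends (`IsAccordionDiagonal.recombine`), and maximality then leaves no gap in its cuts by `D`. The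
same recombination produces the flips (`exists_exchange`).

For the inequalities, heights count crossings, so one accordion diagonal `η` can be treated at a
time. The linear function with value `ind (Cross η ε)` at each ray `ε ∈ E` is at most `ind (Cross η
γ)` at the ray of `γ` (`sum_ind_cross_mul_inner_le`); again this is a count of turns. Summing over
`η` bounds `⟪g γ, p E⟫` by the height of `γ`. If `γ ∉ E` is internal, the bound is strict: take for
`η` an element of `E` that crosses `γ`. -/

noncomputable section

namespace Polytope

set_option linter.unusedSectionVars false

/-! ## Polytopes from simplicial fans -/

variable {X V : Type*} [NormedAddCommGroup X] [InnerProductSpace ℝ X] [DecidableEq V]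

/-- The rays `g`, the heights `h` and the dual bases `c` of a simplicial complex `Δ` of finite sets,
when its facets satisfy the inequalities that make a polytope out of the points `p`. -/
structure IsFanData (Δ : Set (Finset V)) (g : V → X) (h : V → ℝ) (c : Finset V → V → X)
    (p : Finset V → X) : Prop where
  finite : Δ.Finite
  empty_mem : ∅ ∈ Δ
  down : ∀ E ∈ Δ, ∀ F ⊆ E, F ∈ Δ
  dual : ∀ E, Maximal (· ∈ Δ) E → ∀ v ∈ E, ∀ w ∈ E, inner ℝ (g v) (c E w) = if v = w then 1 else 0
  expand : ∀ E, Maximal (· ∈ Δ) E → ∀ y, ∑ v ∈ E, (inner ℝ y (c E v) : ℝ) • g v = y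
  point_eq : ∀ E, p E = ∑ v ∈ E, h v • c E v
  inner_le : ∀ E, Maximal (· ∈ Δ) E → ∀ v, {v} ∈ Δ → inner ℝ (g v) (p E) ≤ h v
  mem_of_inner_eq : ∀ E, Maximal (· ∈ Δ) E → ∀ v, {v} ∈ Δ → inner ℝ (g v) (p E) = h v → v ∈ E
  -- Only the loss of `v` matters: `F` need not be unique, nor have a single new element.
  flip : ∀ E, Maximal (· ∈ Δ) E → ∀ v ∈ E, ∃ F, Maximal (· ∈ Δ) F ∧ E.erase v ⊆ F ∧ v ∉ F
  pos : ∀ v, {v} ∈ Δ → 0 < h v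

/-- The convex hull of the points of the facets. -/
def facetHull (Δ : Set (Finset V)) (p : Finset V → X) : Set X :=
  convexHull ℝ {x | ∃ E, Maximal (· ∈ Δ) E ∧ x = p E}

namespace IsFanData

variable {Δ : Set (Finset V)} {g : V → X} {h : V → ℝ} {c : Finset V → V → X} {p : Finset V → X}

lemma singleton_mem (H : IsFanData Δ g h c p) {E : Finset V} (hE : E ∈ Δ) {v : V} (hv : v ∈ E) :
    {v} ∈ Δ := H.down E hE _ (by simpa using hv)

lemma exists_maximal (H : IsFanData Δ g h c p) {E : Finset V} (hE : E ∈ Δ) :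
    ∃ F, E ⊆ F ∧ Maximal (· ∈ Δ) F := H.finite.exists_le_maximal hE

lemma inner_point (H : IsFanData Δ g h c p) {E : Finset V} (hE : Maximal (· ∈ Δ) E) {v : V}
    (hv : v ∈ E) : inner ℝ (g v) (p E) = h v := by
  rw [H.point_eq, inner_sum, Finset.sum_eq_single v]
  · rw [inner_smul_right, H.dual E hE v hv v hv]; simp
  · intro w hw hne
    rw [inner_smul_right, H.dual E hE v hv w hw, if_neg (Ne.symm hne), mul_zero]
  · intro hh; exact absurd hv hh

lemma inner_sum_point (H : IsFanData Δ g h c p) {E : Finset V} (hE : Maximal (· ∈ Δ) E)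
    {E' : Finset V} (hE' : E' ⊆ E) (a : V → ℝ) :
    inner ℝ (∑ v ∈ E', a v • g v) (p E) = ∑ v ∈ E', a v * h v := by
  rw [sum_inner]
  refine Finset.sum_congr rfl fun v hv => ?_
  rw [inner_smul_left, H.inner_point hE (hE' hv)]
  simp

lemma _root_.Polytope.inner_sum_smul (E : Finset V) (a : V → ℝ) (g : V → X) (x : X) :
    inner ℝ (∑ v ∈ E, a v • g v) x = ∑ v ∈ E, a v * inner ℝ (g v) x := by
  rw [sum_inner]
  refine Finset.sum_congr rfl fun v _ => ?_
  rw [inner_smul_left]; simp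

lemma finite_maximal (H : IsFanData Δ g h c p) : {E | Maximal (· ∈ Δ) E}.Finite :=
  H.finite.subset fun _ hE => hE.1

lemma finite_points (H : IsFanData Δ g h c p) :
    {x | ∃ E, Maximal (· ∈ Δ) E ∧ x = p E}.Finite := by
  refine (H.finite_maximal.image p).subset ?_
  rintro x ⟨E, hE, rfl⟩
  exact ⟨E, hE, rfl⟩

lemma finite_vertices (H : IsFanData Δ g h c p) : {v | {v} ∈ Δ}.Finite :=
  H.finite.preimage (f := fun v : V => ({v} : Finset V))
    (Finset.singleton_injective.injOn)

/-- The fan is complete: each vector is a nonnegative combination of the rays of a facet. -/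
lemma exists_facet (H : IsFanData Δ g h c p) (y : X) :
    ∃ E, Maximal (· ∈ Δ) E ∧ ∃ a : V → ℝ, (∀ v ∈ E, 0 ≤ a v) ∧ y = ∑ v ∈ E, a v • g v := by
  obtain ⟨E0, -, hE0⟩ := H.exists_maximal H.empty_mem
  -- The facet whose point is highest in direction `y` works: flipping a ray with a negative
  -- coefficient lowers `⟪g v, ·⟫` strictly below `h v`, keeps the other rays tight, and hence gives
  -- a higher point.
  obtain ⟨E, hE, hmax⟩ := Set.exists_max_image _ (fun E => (inner ℝ y (p E) : ℝ))
    H.finite_maximal ⟨E0, hE0⟩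
  have hE : Maximal (· ∈ Δ) E := hE
  refine ⟨E, hE, fun v => inner ℝ y (c E v), fun v hv => ?_, (H.expand E hE y).symm⟩
  by_contra hneg
  push Not at hneg
  obtain ⟨F, hF, hsub, hvF⟩ := H.flip E hE v hv
  have h1 := hmax F hF
  have hv1 : {v} ∈ Δ := H.singleton_mem hE.1 hv
  have h2 : inner ℝ (g v) (p F) < h v := lt_of_le_of_ne (H.inner_le F hF v hv1)
    fun hh => hvF (H.mem_of_inner_eq F hF v hv1 hh)
  have h3 : (inner ℝ y (p E) : ℝ) < inner ℝ y (p F) := by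
    conv_lhs => rw [← H.expand E hE y, H.inner_sum_point hE le_rfl]
    conv_rhs => rw [← H.expand E hE y, inner_sum_smul]
    refine Finset.sum_lt_sum (fun w hw => ?_) ⟨v, hv, mul_lt_mul_of_neg_left h2 hneg⟩
    by_cases hwv : w = v
    · subst hwv; exact (mul_lt_mul_of_neg_left h2 hneg).le
    · rw [H.inner_point hF (hsub (Finset.mem_erase.2 ⟨hwv, hw⟩))]
  linarith

lemma inner_le_of_mem (H : IsFanData Δ g h c p) {x : X} (hx : x ∈ facetHull Δ p) {v : V}
    (hv : {v} ∈ Δ) : inner ℝ (g v) x ≤ h v := by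
  have hc : Convex ℝ {x : X | inner ℝ (g v) x ≤ h v} := by
    refine convex_halfSpace_le ⟨?_, ?_⟩ _
    · intro a b; exact inner_add_right _ _ _
    · intro a b; simp [inner_smul_right]
  refine convexHull_min ?_ hc hx
  rintro _ ⟨E, hE, rfl⟩
  exact H.inner_le E hE v hv

lemma point_mem {E : Finset V} (hE : Maximal (· ∈ Δ) E) : p E ∈ facetHull Δ p :=
  subset_convexHull ℝ _ ⟨E, hE, rfl⟩

lemma inner_sum_le (H : IsFanData Δ g h c p) {E : Finset V} (hE : E ∈ Δ) {a : V → ℝ}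
    (ha : ∀ v ∈ E, 0 ≤ a v) {x : X} (hx : ∀ v, {v} ∈ Δ → inner ℝ (g v) x ≤ h v) :
    inner ℝ (∑ v ∈ E, a v • g v) x ≤ ∑ v ∈ E, a v * h v := by
  rw [inner_sum_smul]
  exact Finset.sum_le_sum fun v hv =>
    mul_le_mul_of_nonneg_left (hx v (H.singleton_mem hE hv)) (ha v hv)

lemma inner_eq_of_sum_eq (H : IsFanData Δ g h c p) {E : Finset V} (hE : E ∈ Δ) {a : V → ℝ}
    (ha : ∀ v ∈ E, 0 ≤ a v) {x : X} (hx : ∀ v, {v} ∈ Δ → inner ℝ (g v) x ≤ h v)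
    (heq : ∑ v ∈ E, a v * h v ≤ inner ℝ (∑ v ∈ E, a v • g v) x) :
    ∀ v ∈ E, a v ≠ 0 → inner ℝ (g v) x = h v := by
  intro v hv hne
  by_contra hc
  refine absurd heq (not_le.2 ?_)
  rw [inner_sum_smul]
  refine Finset.sum_lt_sum (fun w hw =>
    mul_le_mul_of_nonneg_left (hx w (H.singleton_mem hE hw)) (ha w hw)) ⟨v, hv, ?_⟩
  exact mul_lt_mul_of_pos_left (lt_of_le_of_ne (hx v (H.singleton_mem hE hv)) hc)
    (lt_of_le_of_ne (ha v hv) (Ne.symm hne))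

lemma _root_.Polytope.exists_inner_eq [CompleteSpace X] (l : StrongDual ℝ X) :
    ∃ y : X, ∀ x, l x = inner ℝ y x :=
  ⟨(InnerProductSpace.toDual ℝ X).symm l, fun x => by
    rw [InnerProductSpace.toDual_symm_apply]⟩

/-- A separating direction lies in the cone of some facet `E`, where `p E` attains the upper bound
that the inequalities impose on any `x`. So nothing satisfying the inequalities can be separated
from the hull. -/
lemma facetHull_eq [CompleteSpace X] (H : IsFanData Δ g h c p) :
    facetHull Δ p = {x | ∀ v, {v} ∈ Δ → inner ℝ (g v) x ≤ h v} := by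
  refine Set.Subset.antisymm (fun x hx v hv => H.inner_le_of_mem hx hv) fun x hx => ?_
  by_contra hnot
  obtain ⟨l, u, hl, hu⟩ := geometric_hahn_banach_closed_point (convex_convexHull ℝ _)
    (H.finite_points.isClosed_convexHull ℝ) hnot
  obtain ⟨y, hy⟩ := exists_inner_eq l
  obtain ⟨E, hE, a, ha, rfl⟩ := H.exists_facet y
  have h1 := hl _ (point_mem hE)
  rw [hy, H.inner_sum_point hE le_rfl] at h1
  rw [hy] at hu
  linarith [H.inner_sum_le hE.1 ha hx]

lemma zero_mem_interior [CompleteSpace X] (H : IsFanData Δ g h c p) :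
    (0 : X) ∈ interior (facetHull Δ p) := by
  rw [mem_interior]
  refine ⟨⋂ v ∈ {v | {v} ∈ Δ}, {x | inner ℝ (g v) x < h v}, ?_, ?_, ?_⟩
  · intro x hx
    rw [H.facetHull_eq]
    intro v hv
    exact (Set.mem_iInter₂.1 hx v hv).le
  · exact H.finite_vertices.isOpen_biInter fun v _ =>
      isOpen_lt (by fun_prop) continuous_const
  · refine Set.mem_iInter₂.2 fun v hv => ?_
    simpa using H.pos v hv

/-- The face of the polytope associated with a face of the complex. -/
def _root_.Polytope.tightFace (Δ : Set (Finset V)) (g : V → X) (h : V → ℝ) (p : Finset V → X)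
    (E : Finset V) : Set X :=
  {x ∈ facetHull Δ p | ∀ v ∈ E, inner ℝ (g v) x = h v}

lemma point_mem_tightFace (H : IsFanData Δ g h c p) {E F : Finset V} (hF : Maximal (· ∈ Δ) F)
    (hEF : E ⊆ F) : p F ∈ tightFace Δ g h p E :=
  ⟨point_mem hF, fun _ hv => H.inner_point hF (hEF hv)⟩

/-- The points where a nonnegative combination of rays is maximal. -/
lemma maximizers_eq (H : IsFanData Δ g h c p) {E F : Finset V} (hE : Maximal (· ∈ Δ) E)
    (hFE : F ⊆ E) {a : V → ℝ} (ha : ∀ v ∈ F, 0 < a v) :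
    {x ∈ facetHull Δ p | ∀ z ∈ facetHull Δ p,
      inner ℝ (∑ v ∈ F, a v • g v) z ≤ inner ℝ (∑ v ∈ F, a v • g v) x} =
      tightFace Δ g h p F := by
  have hF : F ∈ Δ := H.down E hE.1 F hFE
  ext x
  constructor
  · rintro ⟨hx, hmax⟩
    refine ⟨hx, fun v hv => ?_⟩
    have h1 := hmax _ (point_mem hE)
    rw [H.inner_sum_point hE hFE] at h1
    exact H.inner_eq_of_sum_eq hF (fun v hv => (ha v hv).le) (fun v hv => H.inner_le_of_mem hx hv)
      h1 v hv (ha v hv).ne'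
  · rintro ⟨hx, heq⟩
    refine ⟨hx, fun z hz => ?_⟩
    refine (H.inner_sum_le hF (fun v hv => (ha v hv).le)
      fun v hv => H.inner_le_of_mem hz hv).trans ?_
    rw [inner_sum_smul]
    exact Finset.sum_le_sum fun v hv => by rw [heq v hv]

lemma _root_.Polytope.sum_filter_pos (E : Finset V) {a : V → ℝ} (ha : ∀ v ∈ E, 0 ≤ a v)
    (g : V → X) : ∑ v ∈ E.filter fun v => 0 < a v, a v • g v = ∑ v ∈ E, a v • g v := by
  refine Finset.sum_filter_of_ne fun v hv hne => ?_
  refine lt_of_le_of_ne (ha v hv) fun h0 => hne ?_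
  rw [← h0, zero_smul]

lemma _root_.Polytope.mem_hull_image (E : Finset V) (g : V → X) (y : X) :
    y ∈ PointedCone.hull ℝ (g '' (E : Set V)) ↔
      ∃ a : V → ℝ, (∀ v ∈ E, 0 ≤ a v) ∧ y = ∑ v ∈ E, a v • g v := by
  classical
  constructor
  · intro hy
    obtain ⟨w, hw⟩ := Submodule.mem_span_image_finset_iff_exists_fun' (R := NNReal) |>.1 hy
    refine ⟨fun v => w v, fun v _ => (w v).2, ?_⟩
    rw [← hw]
    rfl
  · rintro ⟨a, ha, rfl⟩
    refine Submodule.sum_mem _ fun v hv => ?_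
    exact Submodule.smul_mem _ (⟨a v, ha v hv⟩ : NNReal)
      (PointedCone.subset_hull (Set.mem_image_of_mem _ hv))

/-- Flipping `v ∉ E` out of `F` keeps `E` inside the new facet. Hence a face is the intersection of
the facets that contain it. -/
lemma mem_of_forall_maximal (H : IsFanData Δ g h c p) {E F : Finset V}
    (hF : Maximal (· ∈ Δ) F) (hEF : E ⊆ F) {v : V} (hv : v ∈ F)
    (hall : ∀ F', Maximal (· ∈ Δ) F' → E ⊆ F' → v ∈ F') : v ∈ E := by
  by_contra hvE
  obtain ⟨F', hF', hsub, hvF'⟩ := H.flip F hF v hv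
  refine hvF' (hall F' hF' (Finset.Subset.trans (fun w hw => ?_) hsub))
  exact Finset.mem_erase.2 ⟨fun hh => hvE (hh ▸ hw), hEF hw⟩

/-- A normal vector `y`, expanded on the rays of a facet `F`, is maximal at `p F'` for every facet
`F' ⊇ E`. Each ray of `F` with a nonzero coefficient is then tight at all these points, so it
belongs to all these facets, hence to `E`. -/
lemma normalCone_tightFace (H : IsFanData Δ g h c p) {E : Finset V} (hE : E ∈ Δ) :
    normalCone (facetHull Δ p) (tightFace Δ g h p E) =
      (PointedCone.hull ℝ (g '' (E : Set V)) : Set X) := by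
  ext y
  rw [SetLike.mem_coe, mem_hull_image]
  constructor
  · intro hy
    obtain ⟨F, hF, a, ha, rfl⟩ := H.exists_facet y
    have hsupp : ∀ v ∈ F, a v ≠ 0 → v ∈ E := by
      intro v hv hne
      have hall : ∀ F', Maximal (· ∈ Δ) F' → E ⊆ F' → v ∈ F' := by
        intro F' hF' hEF'
        have h1 := hy _ (H.point_mem_tightFace hF' hEF') _ (point_mem hF)
        rw [H.inner_sum_point hF le_rfl] at h1
        exact H.mem_of_inner_eq F' hF' v (H.singleton_mem hF.1 hv)
          (H.inner_eq_of_sum_eq hF.1 ha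
            (fun v hv => H.inner_le_of_mem (point_mem hF') hv) h1 v hv hne)
      obtain ⟨F', hEF', hF'⟩ := H.exists_maximal hE
      exact H.mem_of_forall_maximal hF' hEF' (hall F' hF' hEF') hall
    refine ⟨fun v => if v ∈ F then a v else 0, fun v _ => ?_, ?_⟩
    · by_cases hvF : v ∈ F
      · simpa [hvF] using ha v hvF
      · simp [hvF]
    · have h1 : ∑ v ∈ F, a v • g v = ∑ v ∈ F ∩ E, a v • g v := by
        symm
        refine Finset.sum_subset Finset.inter_subset_left fun v hv hv' => ?_
        have : a v = 0 := by
          by_contra hne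
          exact hv' (Finset.mem_inter.2 ⟨hv, hsupp v hv hne⟩)
        rw [this, zero_smul]
      have h2 : ∑ v ∈ E, (if v ∈ F then a v else 0) • g v = ∑ v ∈ F ∩ E, a v • g v := by
        symm
        rw [← Finset.sum_subset (Finset.inter_subset_right : F ∩ E ⊆ E)]
        · refine Finset.sum_congr rfl fun v hv => ?_
          rw [if_pos (Finset.mem_inter.1 hv).1]
        · intro v hv hv'
          rw [if_neg fun hh => hv' (Finset.mem_inter.2 ⟨hh, hv⟩), zero_smul]
      rw [h1, h2]
  · rintro ⟨a, ha, rfl⟩ x ⟨hx, heq⟩ z hz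
    refine (H.inner_sum_le hE ha fun v hv => H.inner_le_of_mem hz hv).trans ?_
    rw [inner_sum_smul]
    exact Finset.sum_le_sum fun v hv => by rw [heq v hv]

/-- The sum of the rays of `E` exposes the tight face of `E`. Conversely, the face exposed by `y` is
the tight face of the support of `y` in a facet cone that contains it. -/
lemma normalFan_eq [CompleteSpace X] (H : IsFanData Δ g h c p) :
    {K | ∃ E ∈ Δ, K = (PointedCone.hull ℝ (g '' (E : Set V)) : Set X)} =
      normalFan (facetHull Δ p) := by
  ext K
  constructor
  · rintro ⟨E, hE, rfl⟩
    obtain ⟨F, hEF, hF⟩ := H.exists_maximal hE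
    refine ⟨tightFace Δ g h p E, fun _ => ?_, ⟨_, H.point_mem_tightFace hF hEF⟩,
      (H.normalCone_tightFace hE).symm⟩
    refine ⟨innerSL ℝ (∑ v ∈ E, (1 : ℝ) • g v), ?_⟩
    rw [← H.maximizers_eq hF hEF (a := fun _ => 1) (fun _ _ => one_pos)]
    rfl
  · rintro ⟨F, hexp, hne, rfl⟩
    obtain ⟨l, hl⟩ := hexp hne
    obtain ⟨y, hy⟩ := exists_inner_eq l
    obtain ⟨E, hE, a, ha, rfl⟩ := H.exists_facet y
    refine ⟨E.filter fun v => 0 < a v, H.down E hE.1 _ (Finset.filter_subset _ _), ?_⟩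
    rw [← H.normalCone_tightFace (H.down E hE.1 _ (Finset.filter_subset _ _)),
      ← H.maximizers_eq hE (Finset.filter_subset _ _)
        (fun v hv => (Finset.mem_filter.1 hv).2), sum_filter_pos E ha, hl]
    simp only [hy]

/-! ### The polar dual and its faces -/

/-- The point of the polar dual on the ray of `v`. -/
def _root_.Polytope.polarPoint (g : V → X) (h : V → ℝ) (v : V) : X := (h v)⁻¹ • g v

lemma inner_polarPoint_le (H : IsFanData Δ g h c p) {v : V} (hv : {v} ∈ Δ) {x : X}
    (hx : x ∈ facetHull Δ p) : inner ℝ (polarPoint g h v) x ≤ 1 := by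
  rw [polarPoint, inner_smul_left]
  have := H.inner_le_of_mem hx hv
  simpa [(H.pos v hv).ne'] using
    mul_le_mul_of_nonneg_left this (inv_nonneg.2 (H.pos v hv).le)

lemma smul_ray (H : IsFanData Δ g h c p) {v : V} (hv : {v} ∈ Δ) (a : ℝ) :
    a • g v = (a * h v) • polarPoint g h v := by
  rw [polarPoint, smul_smul, mul_assoc, mul_inv_cancel₀ (H.pos v hv).ne', mul_one]

lemma inner_polarPoint (H : IsFanData Δ g h c p) {v : V} (hv : {v} ∈ Δ) (x : X) :
    inner ℝ (g v) x = h v * inner ℝ (polarPoint g h v) x := by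
  rw [polarPoint, inner_smul_left]
  have := (H.pos v hv).ne'
  simp only [conj_trivial]
  field_simp

lemma convex_polarDual (Q : Set X) : Convex ℝ (polarDual Q) := by
  intro x hx y hy a b ha hb hab z hz
  rw [inner_add_left, inner_smul_left, inner_smul_left]
  have h1 := mul_le_mul_of_nonneg_left (hx z hz) ha
  have h2 := mul_le_mul_of_nonneg_left (hy z hz) hb
  simp only [conj_trivial]
  linarith

/-- The origin receives the weight `1 - ∑ a v * h v` that a point of the dual may lack; it is also
the only generator when the complex has no vertex. -/
lemma polarDual_eq (H : IsFanData Δ g h c p) :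
    polarDual (facetHull Δ p) = convexHull ℝ (insert 0 (polarPoint g h '' {v | {v} ∈ Δ})) := by
  apply Set.Subset.antisymm
  · intro y hy
    obtain ⟨E, hE, a, ha, rfl⟩ := H.exists_facet y
    have h1 := hy _ (point_mem hE)
    rw [H.inner_sum_point hE le_rfl] at h1
    have hnn : ∀ v ∈ E, 0 ≤ a v * h v := fun v hv =>
      mul_nonneg (ha v hv) (H.pos v (H.singleton_mem hE.1 hv)).le
    have h2 : ∑ v ∈ E, a v • g v = (1 - ∑ v ∈ E, a v * h v) • (0 : X) +
        ∑ v ∈ E, (a v * h v) • polarPoint g h v := by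
      rw [smul_zero, zero_add]
      exact Finset.sum_congr rfl fun v hv => H.smul_ray (H.singleton_mem hE.1 hv) _
    rw [h2]
    have h3 := (convex_convexHull ℝ (insert 0 (polarPoint g h '' {v | {v} ∈ Δ}))).sum_mem
      (t := E.insertNone) (w := fun o => o.elim (1 - ∑ v ∈ E, a v * h v) fun v => a v * h v)
      (z := fun o => o.elim 0 (polarPoint g h)) ?_ ?_ ?_
    · simpa [Finset.sum_insertNone] using h3
    · intro o ho
      cases o with
      | none => simpa using h1
      | some v => exact hnn v (by simpa using ho)
    · simp [Finset.sum_insertNone]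
    · intro o ho
      cases o with
      | none => exact subset_convexHull ℝ _ (Set.mem_insert _ _)
      | some v =>
        refine subset_convexHull ℝ _ (Set.mem_insert_of_mem _ ⟨v, ?_, rfl⟩)
        exact H.singleton_mem hE.1 (by simpa using ho)
  · refine convexHull_min ?_ (convex_polarDual _)
    rintro y (rfl | ⟨v, hv, rfl⟩)
    · intro x _; simp
    · intro x hx; exact H.inner_polarPoint_le hv hx

lemma isPolytope_polarDual (H : IsFanData Δ g h c p) :
    IsPolytope (polarDual (facetHull Δ p)) :=
  ⟨_, (H.finite_vertices.image _).insert 0, H.polarDual_eq⟩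

/-- Pairing with the dual basis of a facet containing `E` gives even linear independence. -/
lemma affineIndependent_polarPoint (H : IsFanData Δ g h c p) {E : Finset V} (hE : E ∈ Δ) :
    AffineIndependent ℝ fun v : E => polarPoint g h v := by
  obtain ⟨F, hEF, hF⟩ := H.exists_maximal hE
  suffices h0 : LinearIndependent ℝ fun v : E => polarPoint g h v from h0.affineIndependent
  rw [Fintype.linearIndependent_iff]
  intro a ha w
  have h1 : inner ℝ (∑ v : E, a v • polarPoint g h v) (c F w) = a w * (h w)⁻¹ := by
    rw [sum_inner, Finset.sum_eq_single w]
    · rw [inner_smul_left, polarPoint, inner_smul_left, H.dual F hF w (hEF w.2) w (hEF w.2)]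
      simp
    · intro v _ hne
      rw [inner_smul_left, polarPoint, inner_smul_left, H.dual F hF v (hEF v.2) w (hEF w.2),
        if_neg fun hh => hne (Subtype.ext hh)]
      simp
    · intro hh; exact absurd (Finset.mem_univ _) hh
  rw [ha, inner_zero_left] at h1
  have := (H.pos w (H.singleton_mem hE w.2)).ne'
  rcases mul_eq_zero.1 h1.symm with h2 | h2
  · exact h2
  · exact absurd (inv_eq_zero.1 h2) this

/-- A point in the relative interior of the face associated with `E`. -/
lemma exists_tight_point (H : IsFanData Δ g h c p) {E : Finset V} (hE : E ∈ Δ) :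
    ∃ x ∈ facetHull Δ p, ∀ v, {v} ∈ Δ → (inner ℝ (g v) x = h v ↔ v ∈ E) := by
  classical
  -- The point is the barycenter of the `p F` over all facets `F ⊇ E`. An inequality is tight there
  -- only if it is tight at each of them, so the tight rays are those common to all these facets.
  set S : Finset (Finset V) := (H.finite_maximal.toFinset).filter fun F => E ⊆ F with hS
  have mS : ∀ F, F ∈ S ↔ Maximal (· ∈ Δ) F ∧ E ⊆ F := by
    intro F; simp [hS]
  obtain ⟨F0, hEF0, hF0⟩ := H.exists_maximal hE
  have hpos : (0 : ℝ) < S.card := by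
    exact_mod_cast Finset.card_pos.2 ⟨F0, (mS F0).2 ⟨hF0, hEF0⟩⟩
  have hinner : ∀ v, inner ℝ (g v) (∑ F ∈ S, (S.card : ℝ)⁻¹ • p F) =
      ∑ F ∈ S, (S.card : ℝ)⁻¹ * inner ℝ (g v) (p F) := by
    intro v
    rw [inner_sum]
    exact Finset.sum_congr rfl fun F _ => by rw [inner_smul_right]
  have hsum : ∀ r : ℝ, ∑ F ∈ S, (S.card : ℝ)⁻¹ * r = r := by
    intro r
    rw [Finset.sum_const, nsmul_eq_mul]
    field_simp
  refine ⟨∑ F ∈ S, (S.card : ℝ)⁻¹ • p F, ?_, fun v hv => ⟨fun heq => ?_, fun hvE => ?_⟩⟩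
  · refine (convex_convexHull ℝ {x | ∃ E, Maximal (· ∈ Δ) E ∧ x = p E}).sum_mem
      (fun _ _ => by positivity) ?_ fun F hF => ?_
    · rw [Finset.sum_const, nsmul_eq_mul]
      exact mul_inv_cancel₀ hpos.ne'
    · exact point_mem ((mS F).1 hF).1
  · rw [hinner] at heq
    have hall : ∀ F', Maximal (· ∈ Δ) F' → E ⊆ F' → v ∈ F' := by
      intro F' hF' hEF'
      by_contra hvF'
      have hlt : inner ℝ (g v) (p F') < h v := lt_of_le_of_ne (H.inner_le F' hF' v hv)
        fun hh => hvF' (H.mem_of_inner_eq F' hF' v hv hh)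
      have : ∑ F ∈ S, (S.card : ℝ)⁻¹ * inner ℝ (g v) (p F) < ∑ F ∈ S, (S.card : ℝ)⁻¹ * h v := by
        refine Finset.sum_lt_sum (fun F hF => ?_) ⟨F', (mS F').2 ⟨hF', hEF'⟩, ?_⟩
        · exact mul_le_mul_of_nonneg_left (H.inner_le F ((mS F).1 hF).1 v hv) (by positivity)
        · exact mul_lt_mul_of_pos_left hlt (by positivity)
      rw [heq, hsum] at this
      exact lt_irrefl _ this
    exact H.mem_of_forall_maximal hF0 hEF0 (hall F0 hF0 hEF0) hall
  · rw [hinner, ← hsum (h v)]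
    refine Finset.sum_congr rfl fun F hF => ?_
    rw [H.inner_point ((mS F).1 hF).1 (((mS F).1 hF).2 hvE)]

/-- The points of the polar dual that lie on a supporting hyperplane. -/
lemma polarDual_inner_eq_one (H : IsFanData Δ g h c p) {E : Finset V} (hE : E ∈ Δ) {x : X}
    (hx : x ∈ facetHull Δ p) (hxE : ∀ v, {v} ∈ Δ → (inner ℝ (g v) x = h v ↔ v ∈ E)) :
    {y ∈ polarDual (facetHull Δ p) | inner ℝ y x = 1} =
      convexHull ℝ (polarPoint g h '' (E : Set V)) := by
  apply Set.Subset.antisymm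
  · rintro y ⟨hy, hyx⟩
    obtain ⟨F, hF, a, ha, rfl⟩ := H.exists_facet y
    have h1 := hy _ (point_mem hF)
    rw [H.inner_sum_point hF le_rfl] at h1
    have h2 := H.inner_sum_le hF.1 ha fun v hv => H.inner_le_of_mem hx hv
    -- This sum is at most `1` because `y` is in the polar dual, and at least `⟪y, x⟫ = 1` because
    -- `x` satisfies the inequalities. Equality makes `x` tight on the support of `y`.
    have hsum : ∑ v ∈ F, a v * h v = 1 := by linarith
    have h3 := H.inner_eq_of_sum_eq hF.1 ha (fun v hv => H.inner_le_of_mem hx hv)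
      (by rw [hyx, hsum])
    have h4 : ∑ v ∈ F, a v • g v = ∑ v ∈ F.filter (fun v => 0 < a v),
        (a v * h v) • polarPoint g h v := by
      rw [← sum_filter_pos F ha]
      exact Finset.sum_congr rfl fun v hv =>
        H.smul_ray (H.singleton_mem hF.1 (Finset.mem_filter.1 hv).1) _
    rw [h4]
    refine (convex_convexHull ℝ (polarPoint g h '' (E : Set V))).sum_mem
      (fun v hv => ?_) ?_ fun v hv => ?_
    · have hv' := Finset.mem_filter.1 hv
      exact mul_nonneg hv'.2.le (H.pos v (H.singleton_mem hF.1 hv'.1)).le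
    · rw [← hsum]
      refine Finset.sum_filter_of_ne fun v hv hne => ?_
      exact lt_of_le_of_ne (ha v hv) fun h0 => hne (by rw [← h0, zero_mul])
    · have hv' := Finset.mem_filter.1 hv
      refine subset_convexHull ℝ _ ⟨v, ?_, rfl⟩
      exact (hxE v (H.singleton_mem hF.1 hv'.1)).1 (h3 v hv'.1 hv'.2.ne')
  · have hsub : polarPoint g h '' (E : Set V) ⊆
        {y ∈ polarDual (facetHull Δ p) | inner ℝ y x = 1} := by
      rintro _ ⟨v, hv, rfl⟩
      have hv1 := H.singleton_mem hE hv
      refine ⟨fun z hz => H.inner_polarPoint_le hv1 hz, ?_⟩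
      have h1 := (hxE v hv1).2 hv
      rw [H.inner_polarPoint hv1] at h1
      have := (H.pos v hv1).ne'
      field_simp at h1
      linarith
    refine convexHull_min hsub ?_
    have hc : Convex ℝ {y : X | inner ℝ y x = 1} := by
      refine convex_hyperplane ⟨?_, ?_⟩ _
      · intro a b; exact inner_add_left _ _ _
      · intro a b; simp [inner_smul_left]
    exact (convex_polarDual _).inter hc

lemma zero_mem_polarDual (Q : Set X) : (0 : X) ∈ polarDual Q := by
  intro x _; simp

lemma convexHull_mem_properFaces (H : IsFanData Δ g h c p) {E : Finset V} (hE : E ∈ Δ) :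
    convexHull ℝ (polarPoint g h '' (E : Set V)) ∈ properFaces (polarDual (facetHull Δ p)) := by
  obtain ⟨x, hx, hxE⟩ := H.exists_tight_point hE
  rw [← H.polarDual_inner_eq_one hE hx hxE]
  constructor
  · rintro ⟨y0, hy0, hy0x⟩
    refine ⟨innerSL ℝ x, ?_⟩
    ext y
    simp only [Set.mem_ofPred_eq, innerSL_apply_apply, real_inner_comm _ x]
    constructor
    · rintro ⟨hy, hyx⟩
      refine ⟨hy, fun z hz => ?_⟩
      rw [hyx]; exact hz x hx
    · rintro ⟨hy, hmax⟩
      refine ⟨hy, le_antisymm (hy x hx) ?_⟩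
      rw [← hy0x]; exact hmax y0 hy0
  · intro heq
    have h0 := zero_mem_polarDual (facetHull Δ p)
    rw [← heq] at h0
    have := h0.2
    simp at this

lemma subset_of_convexHull_subset (H : IsFanData Δ g h c p) {E F : Finset V} (hE : E ∈ Δ)
    (hF : F ∈ Δ) (hsub : convexHull ℝ (polarPoint g h '' (E : Set V)) ⊆
      convexHull ℝ (polarPoint g h '' (F : Set V))) : E ⊆ F := by
  intro v hv
  obtain ⟨x, hx, hxF⟩ := H.exists_tight_point hF
  rw [← H.polarDual_inner_eq_one hF hx hxF] at hsub
  have h1 := (hsub (subset_convexHull ℝ _ ⟨v, hv, rfl⟩)).2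
  have hv1 := H.singleton_mem hE hv
  refine (hxF v hv1).1 ?_
  rw [H.inner_polarPoint hv1, h1, mul_one]

lemma exists_of_mem_properFaces [CompleteSpace X] (H : IsFanData Δ g h c p) {F : Set X}
    (hF : F ∈ properFaces (polarDual (facetHull Δ p))) :
    ∃ E ∈ Δ, convexHull ℝ (polarPoint g h '' (E : Set V)) = F := by
  classical
  obtain ⟨hexp, hne⟩ := hF
  rcases F.eq_empty_or_nonempty with rfl | hnonempty
  · exact ⟨∅, H.empty_mem, by simp⟩
  obtain ⟨l, hl⟩ := hexp hnonempty
  obtain ⟨x, hx⟩ := exists_inner_eq l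
  obtain ⟨y0, hy0⟩ := hnonempty
  rw [hl] at hy0
  have hM : 0 < l y0 := by
    by_contra hc
    push Not at hc
    apply hne
    -- If the maximum were nonpositive, `x` would pair nonpositively with all rays. As `x` is itself
    -- a nonnegative combination of rays, `⟪x, x⟫ ≤ 0`, so the face would be everything.
    have hx0 : x = 0 := by
      obtain ⟨E, hE, a, ha, hxe⟩ := H.exists_facet x
      have h1 : (inner ℝ x x : ℝ) ≤ 0 := by
        conv_lhs => rw [hxe]
        rw [inner_sum_smul, ← hxe]
        refine Finset.sum_nonpos fun v hv => ?_
        have hv1 := H.singleton_mem hE.1 hv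
        refine mul_nonpos_of_nonneg_of_nonpos (ha v hv) ?_
        rw [H.inner_polarPoint hv1]
        refine mul_nonpos_of_nonneg_of_nonpos (H.pos v hv1).le ?_
        rw [real_inner_comm, ← hx]
        exact (hy0.2 _ fun z hz => H.inner_polarPoint_le hv1 hz).trans hc
      exact inner_self_eq_zero.1 (le_antisymm h1 real_inner_self_nonneg)
    rw [hl]
    ext y
    simp [hx, hx0]
  -- Rescaled so that the maximum over the polar dual is `1`, the exposing vector becomes a point of
  -- the primal polytope.
  set x' : X := (l y0)⁻¹ • x with hx'
  have hyx' : ∀ y, inner ℝ y x' = (l y0)⁻¹ * l y := by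
    intro y
    rw [hx', inner_smul_right, real_inner_comm, hx y]
  have hx'Q : x' ∈ facetHull Δ p := by
    rw [H.facetHull_eq]
    intro v hv
    rw [H.inner_polarPoint hv, hyx']
    have h1 := hy0.2 _ fun z hz => H.inner_polarPoint_le hv hz
    have h2 : (l y0)⁻¹ * l (polarPoint g h v) ≤ 1 := by
      rw [inv_mul_le_iff₀ hM]; linarith
    have := mul_le_mul_of_nonneg_left h2 (H.pos v hv).le
    linarith
  have hFeq : F = {y ∈ polarDual (facetHull Δ p) | inner ℝ y x' = 1} := by
    rw [hl]
    ext y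
    simp only [Set.mem_ofPred_eq, hyx']
    refine and_congr_right fun hy => ?_
    rw [inv_mul_eq_one₀ hM.ne']
    constructor
    · intro hmax
      exact le_antisymm (hmax y0 hy0.1) (hy0.2 y hy)
    · intro heq z hz
      rw [← heq]; exact hy0.2 z hz
  set E : Finset V := H.finite_vertices.toFinset.filter fun v => inner ℝ (g v) x' = h v with hEdef
  have mE : ∀ v, v ∈ E ↔ {v} ∈ Δ ∧ inner ℝ (g v) x' = h v := by
    intro v; simp [hEdef]
  have hE : E ∈ Δ := by
    -- The tight rays at `x'` form a face: their sum lies in the cone of some facet `F'`, so it is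
    -- at least as large at `p F'` as at `x'`. Every ray of `E` is already at its bound at `x'`,
    -- hence also at `p F'`.
    obtain ⟨F', hF', a, ha, hsum⟩ := H.exists_facet (∑ v ∈ E, (1 : ℝ) • g v)
    refine H.down F' hF'.1 _ fun v hv => ?_
    have h1 : inner ℝ (∑ v ∈ E, (1 : ℝ) • g v) x' ≤ inner ℝ (∑ v ∈ E, (1 : ℝ) • g v) (p F') := by
      rw [hsum, H.inner_sum_point hF' le_rfl]
      exact H.inner_sum_le hF'.1 ha fun v hv => H.inner_le_of_mem hx'Q hv
    rw [inner_sum_smul, inner_sum_smul] at h1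
    refine H.mem_of_inner_eq F' hF' v ((mE v).1 hv).1 ?_
    by_contra hne'
    refine absurd h1 (not_le.2 (Finset.sum_lt_sum (fun w hw => ?_) ⟨v, hv, ?_⟩))
    · rw [((mE w).1 hw).2]
      have := H.inner_le F' hF' w ((mE w).1 hw).1
      linarith
    · rw [((mE v).1 hv).2]
      have := lt_of_le_of_ne (H.inner_le F' hF' v ((mE v).1 hv).1) hne'
      linarith
  refine ⟨E, hE, ?_⟩
  rw [hFeq, H.polarDual_inner_eq_one hE hx'Q]
  intro v hv
  rw [mE]
  exact ⟨fun hh => ⟨hv, hh⟩, fun hh => hh.2⟩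

lemma isRealization_polarDual [CompleteSpace X] (H : IsFanData Δ g h c p) :
    IsRealization (polarDual (facetHull Δ p)) Δ := by
  refine ⟨H.isPolytope_polarDual, polarPoint g h, fun E hE => H.affineIndependent_polarPoint hE,
    fun E hE => H.convexHull_mem_properFaces hE, fun E hE F hF heq => ?_,
    fun F hF => H.exists_of_mem_properFaces hF⟩
  exact Finset.Subset.antisymm (H.subset_of_convexHull_subset hE hF heq.le)
    (H.subset_of_convexHull_subset hF hE heq.ge)

end IsFanData

end Polytope

end

noncomputable section

namespace Accordion

/-! ## Staircases -/

open Classical in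
/-- The indicator of a proposition, as a real number. -/
def ind (p : Prop) : ℝ := if p then 1 else 0

lemma ind_true {p : Prop} (h : p) : ind p = 1 := if_pos h

lemma ind_false {p : Prop} (h : ¬ p) : ind p = 0 := if_neg h

lemma ind_nonneg (p : Prop) : 0 ≤ ind p := by unfold ind; split_ifs <;> norm_num

lemma ind_congr {p q : Prop} (h : p ↔ q) : ind p = ind q := by rw [propext h]

lemma ind_not (p : Prop) : ind (¬ p) = 1 - ind p := by
  by_cases h : p <;> simp [ind, h]

/-- A staircase: a finite chain of the plane in which any two successive elements share a
coordinate. It models the sequence of edges crossed by an accordion, an edge being given by the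
ranks of its endpoints on both sides of the accordion. -/
structure Staircase (K : Finset (ℕ × ℕ)) (bot top : ℕ × ℕ) : Prop where
  bot_mem : bot ∈ K
  top_mem : top ∈ K
  bot_le : ∀ e ∈ K, bot ≤ e
  le_top : ∀ e ∈ K, e ≤ top
  mono : ∀ e ∈ K, ∀ f ∈ K, e.1 < f.1 → e.2 ≤ f.2
  -- For a cut, `mono` comes from non-crossing, while `up` and `down` come from connectedness.
  up : ∀ e ∈ K, e ≠ top → (∃ q, e.2 < q ∧ (e.1, q) ∈ K) ∨ ∃ p, e.1 < p ∧ (p, e.2) ∈ K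
  down : ∀ e ∈ K, e ≠ bot → (∃ q, q < e.2 ∧ (e.1, q) ∈ K) ∨ ∃ p, p < e.1 ∧ (p, e.2) ∈ K

/-- The turn of a staircase at `e`, measured along the row of `e`. -/
def rowSign (K : Finset (ℕ × ℕ)) (e : ℕ × ℕ) : ℝ :=
  ind (∃ q, q < e.2 ∧ (e.1, q) ∈ K) - ind (∃ q, e.2 < q ∧ (e.1, q) ∈ K)

/-- The turn of a staircase at `e`, measured along the column of `e`. -/
def colSign (K : Finset (ℕ × ℕ)) (e : ℕ × ℕ) : ℝ :=
  ind (∃ p, e.1 < p ∧ (p, e.2) ∈ K) - ind (∃ p, p < e.1 ∧ (p, e.2) ∈ K)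

/-- The reflection of a set of pairs. -/
def reflect (K : Finset (ℕ × ℕ)) : Finset (ℕ × ℕ) := K.image Prod.swap

@[simp] lemma mem_reflect {K : Finset (ℕ × ℕ)} {e : ℕ × ℕ} : e ∈ reflect K ↔ e.swap ∈ K := by
  simp only [reflect, Finset.mem_image]
  constructor
  · rintro ⟨a, ha, rfl⟩; simpa using ha
  · intro h; exact ⟨_, h, by simp⟩

lemma rowSign_reflect (K : Finset (ℕ × ℕ)) (e : ℕ × ℕ) :
    rowSign (reflect K) e.swap = -colSign K e := by
  simp [rowSign, colSign]

lemma colSign_reflect (K : Finset (ℕ × ℕ)) (e : ℕ × ℕ) :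
    colSign (reflect K) e.swap = -rowSign K e := by
  simp [rowSign, colSign]

lemma sum_reflect (K : Finset (ℕ × ℕ)) (f : ℕ × ℕ → ℝ) :
    ∑ e ∈ reflect K, f e = ∑ e ∈ K, f e.swap := by
  rw [reflect, Finset.sum_image]
  intro a _ b _ h
  exact Prod.swap_injective h

namespace Staircase

variable {K : Finset (ℕ × ℕ)} {bot top : ℕ × ℕ}

lemma mono' (h : Staircase K bot top) {e f : ℕ × ℕ} (he : e ∈ K) (hf : f ∈ K)
    (hlt : e.2 < f.2) : e.1 ≤ f.1 := by
  by_contra hc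
  have := h.mono f hf e he (by omega)
  omega

lemma reflect (h : Staircase K bot top) : Staircase (reflect K) bot.swap top.swap where
  bot_mem := by simpa using h.bot_mem
  top_mem := by simpa using h.top_mem
  bot_le e he := by
    have := h.bot_le _ (mem_reflect.1 he)
    exact ⟨this.2, this.1⟩
  le_top e he := by
    have := h.le_top _ (mem_reflect.1 he)
    exact ⟨this.2, this.1⟩
  mono e he f hf hlt := h.mono' (mem_reflect.1 he) (mem_reflect.1 hf) hlt
  up e he hne := by
    have := h.up _ (mem_reflect.1 he) (by rintro h'; exact hne (by rw [← h']; simp))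
    simpa [or_comm] using this
  down e he hne := by
    have := h.down _ (mem_reflect.1 he) (by rintro h'; exact hne (by rw [← h']; simp))
    simpa [or_comm] using this

lemma up_iff (h : Staircase K bot top) {e : ℕ × ℕ} (he : e ∈ K) (ht : e ≠ top) :
    (∃ q, e.2 < q ∧ (e.1, q) ∈ K) ↔ ¬ ∃ p, e.1 < p ∧ (p, e.2) ∈ K := by
  constructor
  · rintro ⟨q, hq, hqK⟩ ⟨p, hp, hpK⟩
    have := h.mono _ hqK _ hpK hp
    simp only at this
    omega
  · intro hn
    exact (h.up e he ht).resolve_right hn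

lemma down_iff (h : Staircase K bot top) {e : ℕ × ℕ} (he : e ∈ K) (hb : e ≠ bot) :
    (∃ q, q < e.2 ∧ (e.1, q) ∈ K) ↔ ¬ ∃ p, p < e.1 ∧ (p, e.2) ∈ K := by
  constructor
  · rintro ⟨q, hq, hqK⟩ ⟨p, hp, hpK⟩
    have := h.mono _ hpK _ hqK hp
    simp only at this
    omega
  · intro hn
    exact (h.down e he hb).resolve_right hn

/-- Away from the ends, exactly one of the row and column moves is possible upwards, and likewise
downwards, so the row indicators are the complements of the column ones. A sum of turns can thus be
computed by rows or by columns, whichever telescopes. -/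
lemma rowSign_eq_colSign (h : Staircase K bot top) {e : ℕ × ℕ} (he : e ∈ K) (hb : e ≠ bot)
    (ht : e ≠ top) : rowSign K e = colSign K e := by
  rw [rowSign, colSign, ind_congr (h.up_iff he ht), ind_congr (h.down_iff he hb), ind_not, ind_not]
  ring

lemma rowSign_bot (h : Staircase K bot top) :
    rowSign K bot = -ind (∃ q, bot.2 < q ∧ (bot.1, q) ∈ K) := by
  rw [rowSign, ind_false, zero_sub]
  rintro ⟨q, hq, hqK⟩
  have := (h.bot_le _ hqK).2
  simp only at this
  omega

lemma colSign_bot (h : Staircase K bot top) :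
    colSign K bot = ind (∃ p, bot.1 < p ∧ (p, bot.2) ∈ K) := by
  rw [colSign, ind_false (p := ∃ p, p < bot.1 ∧ _), sub_zero]
  rintro ⟨q, hq, hqK⟩
  have := (h.bot_le _ hqK).1
  simp only at this
  omega

/-- At an end only one direction is left, and the two measures of the turn disagree by one. This
defect is the source of the diagonal entries in the duality. -/
lemma colSign_bot_sub_rowSign_bot (h : Staircase K bot top) (hne : bot ≠ top) :
    colSign K bot - rowSign K bot = 1 := by
  rw [h.rowSign_bot, h.colSign_bot, ind_congr (h.up_iff h.bot_mem hne), ind_not]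
  ring

end Staircase

/-- Only the minimum of `J` can have nothing of `S` below it, and only the maximum can have nothing
above it. -/
lemma sum_ind_lt_sub_ind_gt (S J : Finset ℕ) (hJ : J ⊆ S) (hne : J.Nonempty) :
    ∑ y ∈ J, (ind (∃ z, z < y ∧ z ∈ S) - ind (∃ z, y < z ∧ z ∈ S)) =
      ind (∃ z ∈ S, ∀ y ∈ J, z < y) - ind (∃ z ∈ S, ∀ y ∈ J, y < z) := by
  have h1 : ∑ y ∈ J, (1 - ind (∃ z, z < y ∧ z ∈ S)) = 1 - ind (∃ z ∈ S, ∀ y ∈ J, z < y) := by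
    rw [Finset.sum_eq_single (J.min' hne)]
    · congr 1
      refine ind_congr ⟨?_, ?_⟩
      · rintro ⟨z, hz, hzS⟩
        exact ⟨z, hzS, fun y hy => hz.trans_le (J.min'_le y hy)⟩
      · rintro ⟨z, hzS, hz⟩
        exact ⟨z, hz _ (J.min'_mem hne), hzS⟩
    · intro y hy hne'
      rw [ind_true, sub_self]
      exact ⟨J.min' hne, lt_of_le_of_ne (J.min'_le y hy) (Ne.symm hne'), hJ (J.min'_mem hne)⟩
    · intro h; exact absurd (J.min'_mem hne) h
  have h2 : ∑ y ∈ J, (1 - ind (∃ z, y < z ∧ z ∈ S)) = 1 - ind (∃ z ∈ S, ∀ y ∈ J, y < z) := by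
    rw [Finset.sum_eq_single (J.max' hne)]
    · congr 1
      refine ind_congr ⟨?_, ?_⟩
      · rintro ⟨z, hz, hzS⟩
        exact ⟨z, hzS, fun y hy => (J.le_max' y hy).trans_lt hz⟩
      · rintro ⟨z, hzS, hz⟩
        exact ⟨z, hz _ (J.max'_mem hne), hzS⟩
    · intro y hy hne'
      rw [ind_true, sub_self]
      exact ⟨J.max' hne, lt_of_le_of_ne (J.le_max' y hy) hne', hJ (J.max'_mem hne)⟩
    · intro h; exact absurd (J.max'_mem hne) h
  rw [Finset.sum_sub_distrib] at h1 h2 ⊢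
  linarith

/-- A sum of turns, computed row by row. -/
lemma sum_rowSign_mul (K I : Finset (ℕ × ℕ)) (hI : I ⊆ K) (T : ℕ → ℝ) :
    ∑ e ∈ I, rowSign K e * T e.1 = ∑ p ∈ I.image Prod.fst,
      (ind (∃ q, (p, q) ∈ K ∧ ∀ r, (p, r) ∈ I → q < r) -
        ind (∃ q, (p, q) ∈ K ∧ ∀ r, (p, r) ∈ I → r < q)) * T p := by
  rw [← Finset.sum_fiberwise_of_maps_to (t := I.image Prod.fst) (g := Prod.fst)
    (fun e he => Finset.mem_image_of_mem _ he)]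
  refine Finset.sum_congr rfl fun p hp => ?_
  obtain ⟨⟨p', q0⟩, h0, rfl⟩ := Finset.mem_image.1 hp
  set J : Finset ℕ := (I.filter fun e => e.1 = p').image Prod.snd with hJ
  set S : Finset ℕ := (K.filter fun e => e.1 = p').image Prod.snd with hS
  have mJ : ∀ y, y ∈ J ↔ (p', y) ∈ I := by
    intro y; simp [hJ]
  have mS : ∀ y, y ∈ S ↔ (p', y) ∈ K := by
    intro y; simp [hS]
  have key := sum_ind_lt_sub_ind_gt S J (fun y hy => (mS y).2 (hI ((mJ y).1 hy)))
    ⟨q0, (mJ q0).2 h0⟩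
  simp only [mS, mJ] at key
  rw [← key, Finset.sum_mul, hJ, Finset.sum_image]
  · refine Finset.sum_congr rfl fun e he => ?_
    obtain ⟨_, rfl⟩ := Finset.mem_filter.1 he
    rfl
  · rintro ⟨a, b⟩ ha ⟨c, d⟩ hc h
    have h1 := (Finset.mem_filter.1 ha).2
    have h2 := (Finset.mem_filter.1 hc).2
    simp_all

/-- No element of `K` lies beyond a complete row, so each row contributes zero whatever its weight.
This and its column version are the vanishing sums behind the duality. -/
lemma sum_rowSign_mul_fst (K : Finset (ℕ × ℕ)) (T : ℕ → ℝ) :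
    ∑ e ∈ K, rowSign K e * T e.1 = 0 := by
  rw [sum_rowSign_mul K K le_rfl]
  refine Finset.sum_eq_zero fun p _ => ?_
  rw [ind_false, ind_false]
  · simp
  · rintro ⟨q, hq, h⟩; exact lt_irrefl _ (h q hq)
  · rintro ⟨q, hq, h⟩; exact lt_irrefl _ (h q hq)

lemma sum_colSign_mul_snd (K : Finset (ℕ × ℕ)) (T : ℕ → ℝ) :
    ∑ e ∈ K, colSign K e * T e.2 = 0 := by
  have := sum_rowSign_mul_fst (reflect K) T
  rw [sum_reflect] at this
  simp only [rowSign_reflect, Prod.fst_swap, neg_mul, Finset.sum_neg_distrib] at this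
  linarith

/-! ### Turns along quadrants and order-convex parts of a staircase -/

namespace Staircase

variable {K : Finset (ℕ × ℕ)} {bot top : ℕ × ℕ}

/-- The part of the staircase strictly to the right of `a` and below `b` turns once. -/
lemma sum_rowSign_quadrant (h : Staircase K bot top) (a b : ℕ) (hb : b ≤ top.2)
    {X : Finset (ℕ × ℕ)} (hX : ∀ e, e ∈ X ↔ e ∈ K ∧ a < e.1 ∧ e.2 < b) :
    ∑ e ∈ X, rowSign K e = -ind X.Nonempty := by
  rcases X.eq_empty_or_nonempty with rfl | hne
  · simp [ind]
  rw [ind_true hne]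
  obtain ⟨⟨p0, q0⟩, h0, hmax⟩ := X.exists_max_image (fun e => e.1 + e.2) hne
  have h0' := (hX _).1 h0
  simp only at h0' hmax
  -- The last element of `X` is not the top of `K`, and a step along its column would stay in `X`;
  -- so `K` leaves `X` along its row. No other row leaves `X` upwards, and none enters it from
  -- below, so this row alone contributes.
  obtain ⟨q1, hq1, hq1K⟩ : ∃ q, b ≤ q ∧ (p0, q) ∈ K := by
    have ht : (p0, q0) ≠ top := by
      intro hh
      rw [← hh] at hb
      simp only at hb
      omega
    rcases h.up _ h0'.1 ht with ⟨q, hq, hqK⟩ | ⟨p, hp, hpK⟩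
    · refine ⟨q, ?_, hqK⟩
      by_contra hc
      have := hmax (p0, q) ((hX _).2 ⟨hqK, h0'.2.1, by omega⟩)
      simp only at this hq
      omega
    · have := hmax (p, q0) ((hX _).2 ⟨hpK, by simp only at hp ⊢; omega, h0'.2.2⟩)
      simp only at this hp
      omega
  have key := sum_rowSign_mul K X (fun e he => ((hX e).1 he).1) (fun _ => 1)
  simp only [mul_one] at key
  rw [key, Finset.sum_eq_single p0]
  · rw [ind_false, ind_true, zero_sub]
    · exact ⟨q1, hq1K, fun r hr => by have := ((hX _).1 hr).2.2; simp only at this; omega⟩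
    · rintro ⟨q, hqK, hq⟩
      have h1 := hq _ h0
      exact lt_irrefl _ (hq q ((hX _).2 ⟨hqK, h0'.2.1, by simp only; omega⟩))
  · intro p hp hpne
    obtain ⟨⟨p', q⟩, hpq, rfl⟩ := Finset.mem_image.1 hp
    have hpq' := (hX _).1 hpq
    simp only at hpq' hpne ⊢
    rw [ind_false, ind_false, sub_zero]
    · rintro ⟨q2, hq2K, hq2⟩
      have h2 : b ≤ q2 := by
        by_contra hc
        exact lt_irrefl _ (hq2 q2 ((hX _).2 ⟨hq2K, hpq'.2.1, by simp only; omega⟩))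
      rcases lt_or_gt_of_ne hpne with hlt | hgt
      · have := h.mono _ hq2K _ h0'.1 hlt
        simp only at this
        omega
      · have := h.mono _ hq1K _ hpq'.1 hgt
        simp only at this
        omega
    · rintro ⟨q2, hq2K, hq2⟩
      have h1 := hq2 _ hpq
      exact lt_irrefl _ (hq2 q2 ((hX _).2 ⟨hq2K, hpq'.2.1, by simp only; omega⟩))
  · intro hh
    exact absurd (Finset.mem_image_of_mem _ h0) hh

lemma sum_colSign_quadrant (h : Staircase K bot top) (a b : ℕ) (ha : a ≤ top.1)
    {X : Finset (ℕ × ℕ)} (hX : ∀ e, e ∈ X ↔ e ∈ K ∧ e.1 < a ∧ b < e.2) :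
    ∑ e ∈ X, colSign K e = ind X.Nonempty := by
  have := h.reflect.sum_rowSign_quadrant b a ha (X := Accordion.reflect X) (by
    intro e
    rw [mem_reflect, hX, mem_reflect]
    simp only [Prod.fst_swap, Prod.snd_swap]
    tauto)
  rw [sum_reflect] at this
  simp only [rowSign_reflect, Finset.sum_neg_distrib, neg_inj] at this
  rw [this]
  refine ind_congr ?_
  rw [Accordion.reflect, Finset.image_nonempty]

/-- The turns of a staircase `K` along a part `I` of an order-convex part `H`, when `I` is closed
in `H` under moves down along rows and moves up along columns. -/
lemma sum_rowSign_le_one (h : Staircase K bot top) {H I : Finset (ℕ × ℕ)} (hHK : H ⊆ K)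
    (hIH : I ⊆ H) (hconv : ∀ e ∈ H, ∀ f ∈ K, ∀ g ∈ H, e ≤ f → f ≤ g → f ∈ H)
    (hrow : ∀ p q r, (p, q) ∈ I → (p, r) ∈ H → r < q → (p, r) ∈ I) :
    ∑ e ∈ I, rowSign K e ≤ 1 ∧ (0 < ∑ e ∈ I, rowSign K e →
      ∃ p q r, (p, q) ∈ I ∧ (p, r) ∈ K ∧ r < q ∧ (p, r) ∉ H) := by
  have key := sum_rowSign_mul K I (hIH.trans hHK) (fun _ => 1)
  simp only [mul_one] at key
  have hle : ∑ e ∈ I, rowSign K e ≤ ∑ p ∈ I.image Prod.fst,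
      ind (∃ q, (p, q) ∈ K ∧ ∀ r, (p, r) ∈ I → q < r) := by
    rw [key]
    refine Finset.sum_le_sum fun p _ => ?_
    have := ind_nonneg (∃ q, (p, q) ∈ K ∧ ∀ r, (p, r) ∈ I → r < q)
    linarith
  -- A row contributes at most one, and only if `K` continues below `I`, hence below `H`, in this
  -- row. With two such rows, the lower element of the row of larger index would lie between two
  -- elements of `H`, against convexity.
  by_cases hex : ∃ p ∈ I.image Prod.fst, ∃ q, (p, q) ∈ K ∧ ∀ r, (p, r) ∈ I → q < r
  · obtain ⟨p, hp, r, hrK, hr⟩ := hex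
    obtain ⟨⟨p', q⟩, hpq, rfl⟩ := Finset.mem_image.1 hp
    have hrH : (p', r) ∉ H := fun hh => lt_irrefl _ (hr r (hrow p' q r hpq hh (hr q hpq)))
    refine ⟨hle.trans ?_, fun _ => ⟨p', q, r, hpq, hrK, hr q hpq, hrH⟩⟩
    rw [Finset.sum_eq_single p']
    · unfold ind; split_ifs <;> norm_num
    · intro p2 hp2 hne
      rw [ind_false]
      rintro ⟨r2, hr2K, hr2⟩
      obtain ⟨⟨p2', q2⟩, hpq2, rfl⟩ := Finset.mem_image.1 hp2
      simp only at hne hr2 hr2K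
      have hlt := hr q hpq
      have hlt2 := hr2 q2 hpq2
      have hr2H : (p2', r2) ∉ H := fun hh => lt_irrefl _ (hr2 r2 (hrow p2' q2 r2 hpq2 hh hlt2))
      rcases lt_or_gt_of_ne hne with hl | hl
      · refine hrH (hconv _ (hIH hpq2) _ hrK _ (hIH hpq) ⟨hl.le, ?_⟩ ⟨le_rfl, hlt.le⟩)
        exact h.mono _ (hHK (hIH hpq2)) _ hrK hl
      · refine hr2H (hconv _ (hIH hpq) _ hr2K _ (hIH hpq2) ⟨hl.le, ?_⟩ ⟨le_rfl, hlt2.le⟩)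
        exact h.mono _ (hHK (hIH hpq)) _ hr2K hl
    · intro hh; exact absurd hp hh
  · have h0 : ∑ p ∈ I.image Prod.fst,
        ind (∃ q, (p, q) ∈ K ∧ ∀ r, (p, r) ∈ I → q < r) = 0 :=
      Finset.sum_eq_zero fun p hp => ind_false fun hh => hex ⟨p, hp, hh⟩
    rw [h0] at hle
    exact ⟨by linarith, fun hh => by linarith⟩

/-- The column counterpart of `sum_rowSign_le_one`: a positive total forces `K` to continue above
`I` in some column, and closure of `I` inside `H` puts the continuation outside `H`. Applied to the
same sum of turns, the two lemmas locate both places where `K` leaves `H`. -/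
lemma exists_of_sum_colSign_pos {H I : Finset (ℕ × ℕ)} (hHK : H ⊆ K) (hIH : I ⊆ H)
    (hcol : ∀ p q r, (p, q) ∈ I → (r, q) ∈ H → p < r → (r, q) ∈ I)
    (hpos : 0 < ∑ e ∈ I, colSign K e) :
    ∃ p q r, (p, q) ∈ I ∧ (r, q) ∈ K ∧ p < r ∧ (r, q) ∉ H := by
  have key := sum_rowSign_mul (Accordion.reflect K) (Accordion.reflect I)
    (fun e he => mem_reflect.2 (hHK (hIH (mem_reflect.1 he)))) (fun _ => 1)
  rw [sum_reflect] at key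
  simp only [mul_one, rowSign_reflect, Finset.sum_neg_distrib, mem_reflect, Prod.swap_prod_mk]
    at key
  by_contra hc
  have : 0 ≤ -∑ e ∈ I, colSign K e := by
    rw [key]
    refine Finset.sum_nonneg fun q hq => ?_
    have h1 := ind_nonneg (∃ p, (p, q) ∈ K ∧ ∀ r, (r, q) ∈ I → p < r)
    rw [ind_false (p := ∃ p, (p, q) ∈ K ∧ ∀ r, (r, q) ∈ I → r < p)]
    · linarith
    · rintro ⟨p, hpK, hp⟩
      obtain ⟨⟨q', p0⟩, hpq, rfl⟩ := Finset.mem_image.1 hq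
      have hpq' := mem_reflect.1 hpq
      simp only [Prod.swap_prod_mk] at hpq' hp hpK
      refine hc ⟨p0, q', p, hpq', hpK, hp _ hpq', fun hh => ?_⟩
      exact lt_irrefl _ (hp p (hcol p0 q' p hpq' hh (hp _ hpq')))
  linarith

end Staircase

end Accordion

end

noncomputable section

namespace Accordion

variable {n : ℕ}

/-! ## Ranks of vertices around a base point -/

/-- The rank of `v` when turning clockwise from `α`. -/
def rk (α v : Vertex n) : ℕ := if α.val ≤ v.val then v.val - α.val else v.val + 2 * n - α.val

/-- The vertex of rank `k` when turning clockwise from `α`. -/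
def vtx (α : Vertex n) (k : ℕ) : Vertex n := ⟨(α.val + k) % (2 * n), Nat.mod_lt _ α.pos⟩

lemma rk_lt (α v : Vertex n) : rk α v < 2 * n := by
  have := α.2; have := v.2; unfold rk; split_ifs <;> omega

@[simp] lemma rk_self (α : Vertex n) : rk α α = 0 := by simp [rk]

lemma rk_injective (α : Vertex n) : Function.Injective (rk α) := by
  intro v w h
  have := α.2; have := v.2; have := w.2
  unfold rk at h
  ext
  split_ifs at h <;> omega

lemma rk_inj {α v w : Vertex n} : rk α v = rk α w ↔ v = w := (rk_injective α).eq_iff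

lemma rk_vtx (α : Vertex n) {k : ℕ} (hk : k < 2 * n) : rk α (vtx α k) = k := by
  have := α.2
  unfold rk vtx
  simp only
  rcases lt_or_ge (α.val + k) (2 * n) with h | h
  · rw [Nat.mod_eq_of_lt h]; split_ifs <;> omega
  · rw [Nat.mod_eq_sub_mod h, Nat.mod_eq_of_lt (by omega)]; split_ifs <;> omega

lemma vtx_rk (α v : Vertex n) : vtx α (rk α v) = v :=
  rk_injective α (rk_vtx α (rk_lt α v))

lemma eq_vtx_of_rk_eq {α v : Vertex n} {k : ℕ} (h : rk α v = k) : v = vtx α k := by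
  rw [← h, vtx_rk]

lemma rk_ne {α v w : Vertex n} (h : v ≠ w) : rk α v ≠ rk α w := fun hh => h (rk_injective α hh)

lemma rk_swap {α β : Vertex n} (h : α ≠ β) : rk β α = 2 * n - rk α β := by
  have := α.2; have := β.2
  have : α.val ≠ β.val := fun hh => h (Fin.ext hh)
  unfold rk; split_ifs <;> omega

lemma sbtw_iff_rk (α : Vertex n) (x y z : Vertex n) :
    sbtw x y z ↔ (rk α x < rk α y ∧ rk α y < rk α z) ∨ (rk α y < rk α z ∧ rk α z < rk α x) ∨
      (rk α z < rk α x ∧ rk α x < rk α y) := by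
  rw [Fin.sbtw_iff]
  have := α.2; have := x.2; have := y.2; have := z.2
  simp only [Fin.lt_def]
  unfold rk
  split_ifs <;> omega

/-- Crossing of two segments, in terms of the ranks of their endpoints. -/
def RankCross (x y z w : ℕ) : Prop :=
  (x < z ∧ z < y ∧ (w < x ∨ y < w)) ∨ (x < w ∧ w < y ∧ (z < x ∨ y < z)) ∨
    (y < z ∧ z < x ∧ (w < y ∨ x < w)) ∨ (y < w ∧ w < x ∧ (z < y ∨ x < z))

lemma cross_iff_sbtw (x y z w : Vertex n) : Cross s(x, y) s(z, w) ↔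
    (sbtw x z y ∧ sbtw y w x) ∨ (sbtw x w y ∧ sbtw y z x) := by
  constructor
  · rintro ⟨a, b, c, d, h1, h2, h3, h4⟩
    rcases Sym2.eq_iff.1 h1 with ⟨rfl, rfl⟩ | ⟨rfl, rfl⟩ <;>
    rcases Sym2.eq_iff.1 h2 with ⟨rfl, rfl⟩ | ⟨rfl, rfl⟩ <;> tauto
  · rintro (⟨h1, h2⟩ | ⟨h1, h2⟩)
    · exact ⟨x, y, z, w, rfl, rfl, h1, h2⟩
    · exact ⟨x, y, w, z, rfl, Sym2.eq_swap, h1, h2⟩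

/-- The base point is free, so each configuration can be viewed from a point where crossings become
linear inequalities between ranks. -/
lemma cross_iff_rk (α : Vertex n) (x y z w : Vertex n) :
    Cross s(x, y) s(z, w) ↔ RankCross (rk α x) (rk α y) (rk α z) (rk α w) := by
  rw [cross_iff_sbtw]
  simp only [sbtw_iff_rk α]
  unfold RankCross
  omega

lemma Cross.symm {e f : Segment n} (h : Cross e f) : Cross f e := by
  obtain ⟨a, b, c, d, rfl, rfl, h1, h2⟩ := h
  refine ⟨c, d, b, a, rfl, Sym2.eq_swap, ?_, ?_⟩
  · simp only [Fin.sbtw_iff] at *; omega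
  · simp only [Fin.sbtw_iff] at *; omega

/-- The sets of vertices that alternate with their complements: the two polygons. -/
def Alternating (P : Finset (Vertex n)) : Prop := ∃ c < 2, ∀ v, v ∈ P ↔ v.val % 2 = c

lemma alternating_hollow : Alternating (hollowPolygon n) := ⟨1, by simp, fun v => by
  simp [hollowPolygon]⟩

lemma alternating_solid : Alternating (solidPolygon n) := ⟨0, by simp, fun v => by
  simp [solidPolygon]⟩

lemma mem_solid_iff {v : Vertex n} : v ∈ solidPolygon n ↔ v ∉ hollowPolygon n := by
  simp [solidPolygon, hollowPolygon]

lemma Alternating.mem_iff_of_notMem {P : Finset (Vertex n)} (h : Alternating P) {α : Vertex n}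
    (hα : α ∉ P) (v : Vertex n) : v ∈ P ↔ rk α v % 2 = 1 := by
  obtain ⟨c, hc, h⟩ := h
  rw [h] at hα ⊢
  have := α.2; have := v.2
  unfold rk; split_ifs <;> omega

lemma Alternating.mem_iff_of_mem {P : Finset (Vertex n)} (h : Alternating P) {α : Vertex n}
    (hα : α ∈ P) (v : Vertex n) : v ∈ P ↔ rk α v % 2 = 0 := by
  obtain ⟨c, hc, h⟩ := h
  rw [h] at hα ⊢
  have := α.2; have := v.2
  unfold rk; split_ifs <;> omega

/-! ## Diagonals and boundary edges -/

section Dissection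

variable {P : Finset (Vertex n)} {A : Finset (Segment n)}

lemma isDiagonal_mk {x y : Vertex n} : IsDiagonal P s(x, y) ↔ x ≠ y ∧ x ∈ P ∧ y ∈ P := by
  simp [IsDiagonal]

lemma IsDissection.isDiagonal (hA : IsDissection P A) {e : Segment n} (he : e ∈ withBoundary P A) :
    IsDiagonal P e := by
  rcases he with he | he
  · exact (hA.1 e he).1
  · exact he.1

lemma IsDissection.mem_of_mem (hA : IsDissection P A) {x y : Vertex n}
    (he : s(x, y) ∈ withBoundary P A) : x ∈ P ∧ y ∈ P :=
  (isDiagonal_mk.1 (hA.isDiagonal he)).2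

lemma IsBoundaryEdge.not_cross {e f : Segment n} (he : IsBoundaryEdge P e) (hf : IsDiagonal P f) :
    ¬ Cross e f := by
  induction f using Sym2.ind with
  | h v w => exact he.2 v (isDiagonal_mk.1 hf).2.1 w (isDiagonal_mk.1 hf).2.2

lemma IsDissection.not_cross (hA : IsDissection P A) {e f : Segment n}
    (he : e ∈ withBoundary P A) (hf : f ∈ withBoundary P A) : ¬ Cross e f := by
  rcases he with he' | he'
  · rcases hf with hf' | hf'
    · exact hA.2 e he' f hf'
    · exact fun h => hf'.not_cross (hA.1 e he').1 h.symm
  · exact he'.not_cross (hA.isDiagonal hf)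

lemma IsDissection.not_isBoundaryEdge (hA : IsDissection P A) {e : Segment n} (he : e ∈ A) :
    ¬ IsBoundaryEdge P e := (hA.1 e he).2

lemma subset_withBoundary {e : Segment n} (he : e ∈ A) : e ∈ withBoundary P A := Or.inl he

/-- Two vertices at distance two are joined by a boundary edge. -/
lemma isBoundaryEdge_around (hP : Alternating P) (hn : 2 ≤ n) {α : Vertex n} (hα : α ∉ P) :
    IsBoundaryEdge P s(vtx α 1, vtx α (2 * n - 1)) := by
  have h1 : rk α (vtx α 1) = 1 := rk_vtx α (by omega)
  have h2 : rk α (vtx α (2 * n - 1)) = 2 * n - 1 := rk_vtx α (by omega)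
  refine ⟨isDiagonal_mk.2 ⟨fun h => ?_, ?_, ?_⟩, fun v hv w hw hc => ?_⟩
  · have := congrArg (rk α) h; omega
  · rw [hP.mem_iff_of_notMem hα, h1]
  · rw [hP.mem_iff_of_notMem hα, h2]; omega
  · rw [cross_iff_rk α, h1, h2] at hc
    rw [hP.mem_iff_of_notMem hα] at hv hw
    have := rk_lt α v; have := rk_lt α w
    unfold RankCross at hc
    omega

/-! ## Cuts -/

/-- The segment whose endpoints have rank `e.1` clockwise and rank `e.2` counterclockwise. -/
def edge (α : Vertex n) (e : ℕ × ℕ) : Segment n := s(vtx α e.1, vtx α (2 * n - e.2))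

open Classical in
/-- The edges of a dissection that cross the segment `αβ`, given by the ranks of their endpoints
from `α` on both sides of this segment. -/
def cut (P : Finset (Vertex n)) (A : Finset (Segment n)) (α β : Vertex n) : Finset (ℕ × ℕ) :=
  (Finset.range (2 * n) ×ˢ Finset.range (2 * n)).filter fun e =>
    (0 < e.1 ∧ e.1 < rk α β) ∧ (0 < e.2 ∧ e.2 < 2 * n - rk α β) ∧ edge α e ∈ withBoundary P A

lemma mem_cut {α β : Vertex n} {e : ℕ × ℕ} : e ∈ cut P A α β ↔
    (0 < e.1 ∧ e.1 < rk α β) ∧ (0 < e.2 ∧ e.2 < 2 * n - rk α β) ∧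
      edge α e ∈ withBoundary P A := by
  have := rk_lt α β
  simp only [cut, Finset.mem_filter, Finset.mem_product, Finset.mem_range]
  constructor
  · rintro ⟨_, h⟩; exact h
  · intro h; exact ⟨by omega, h⟩

lemma rk_edge_left {α β : Vertex n} {e : ℕ × ℕ} (he : e ∈ cut P A α β) :
    rk α (vtx α e.1) = e.1 := by
  have := (mem_cut.1 he).1; have := rk_lt α β
  exact rk_vtx α (by omega)

lemma rk_edge_right {α β : Vertex n} {e : ℕ × ℕ} (he : e ∈ cut P A α β) :
    rk α (vtx α (2 * n - e.2)) = 2 * n - e.2 := by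
  have := (mem_cut.1 he).2.1; have := rk_lt α β
  exact rk_vtx α (by omega)

lemma cross_of_mem_cut {α β : Vertex n} {e : ℕ × ℕ} (he : e ∈ cut P A α β) :
    Cross (edge α e) s(α, β) := by
  rw [edge, cross_iff_rk α, rk_edge_left he, rk_edge_right he, rk_self]
  have h := mem_cut.1 he
  unfold RankCross
  omega

lemma edge_mem_crossedBy {α β : Vertex n} {e : ℕ × ℕ} (he : e ∈ cut P A α β) :
    edge α e ∈ crossedBy P A s(α, β) := ⟨(mem_cut.1 he).2.2, cross_of_mem_cut he⟩

lemma mem_cut_of_rk {α β x y : Vertex n} (h : s(x, y) ∈ withBoundary P A) (hx : 0 < rk α x)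
    (hx' : rk α x < rk α β) (hy : rk α β < rk α y) :
    (rk α x, 2 * n - rk α y) ∈ cut P A α β ∧ edge α (rk α x, 2 * n - rk α y) = s(x, y) := by
  have := rk_lt α y
  have he : edge α (rk α x, 2 * n - rk α y) = s(x, y) := by
    rw [edge]
    simp only
    rw [vtx_rk, show 2 * n - (2 * n - rk α y) = rk α y by omega, vtx_rk]
  refine ⟨mem_cut.2 ⟨⟨hx, hx'⟩, ⟨by simp only; omega, by simp only; omega⟩, ?_⟩, he⟩
  rw [he]; exact h

lemma exists_mem_cut {α β : Vertex n} {f : Segment n} (hf : f ∈ crossedBy P A s(α, β)) :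
    ∃ e ∈ cut P A α β, edge α e = f := by
  induction f using Sym2.ind with
  | h x y =>
    obtain ⟨h1, h2⟩ := hf
    rw [cross_iff_rk α, rk_self] at h2
    have : (0 < rk α x ∧ rk α x < rk α β ∧ rk α β < rk α y) ∨
        (0 < rk α y ∧ rk α y < rk α β ∧ rk α β < rk α x) := by
      unfold RankCross at h2; omega
    rcases this with ⟨ha, hb, hc⟩ | ⟨ha, hb, hc⟩
    · exact ⟨_, mem_cut_of_rk h1 ha hb hc⟩
    · rw [Sym2.eq_swap] at h1 ⊢
      exact ⟨_, mem_cut_of_rk h1 ha hb hc⟩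

lemma edge_eq_iff {α β : Vertex n} {e f : ℕ × ℕ} (he : e ∈ cut P A α β) (hf : f ∈ cut P A α β) :
    edge α e = edge α f ↔ e = f := by
  refine ⟨fun h => ?_, fun h => by rw [h]⟩
  have h1 := mem_cut.1 he; have h2 := mem_cut.1 hf
  have h3 := rk_edge_left he; have h4 := rk_edge_left hf
  have h5 := rk_edge_right he; have h6 := rk_edge_right hf
  rcases Sym2.eq_iff.1 h with ⟨ha, hb⟩ | ⟨ha, hb⟩
  · rw [ha] at h3; rw [hb] at h5
    ext <;> omega
  · rw [ha] at h3
    omega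

lemma share_iff {α β : Vertex n} {e f : ℕ × ℕ} (he : e ∈ cut P A α β) (hf : f ∈ cut P A α β) :
    (∃ v, v ∈ edge α e ∧ v ∈ edge α f) ↔ e.1 = f.1 ∨ e.2 = f.2 := by
  have h1 := mem_cut.1 he; have h2 := mem_cut.1 hf
  have h3 := rk_edge_left he; have h4 := rk_edge_left hf
  have h5 := rk_edge_right he; have h6 := rk_edge_right hf
  constructor
  · rintro ⟨v, hv, hw⟩
    rw [edge, Sym2.mem_iff] at hv hw
    rcases hv with rfl | rfl <;> rcases hw with hw | hw <;> have := congrArg (rk α) hw <;> omega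
  · rintro (h | h)
    · exact ⟨vtx α e.1, by simp [edge], by simp [edge, h]⟩
    · exact ⟨vtx α (2 * n - e.2), by simp [edge], by simp [edge, h]⟩

lemma exists_step_of_reflTransGen {X : Type*} {r : X → X → Prop} {p : X → Prop} {a b : X}
    (h : Relation.ReflTransGen r a b) (ha : p a) (hb : ¬ p b) : ∃ c d, r c d ∧ p c ∧ ¬ p d := by
  induction h with
  | refl => exact absurd ha hb
  | @tail c d _ hcd ih =>
    by_cases hc : p c
    · exact ⟨c, d, hcd, hc, hb⟩
    · exact ih hc

/-- The last edge of a cut from `α` to `β`. -/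
def cutTop (α β : Vertex n) : ℕ × ℕ := (rk α β - 1, 2 * n - rk α β - 1)

/-- Both ranks grow from `α` towards `β`, so two edges ordered oppositely on the two sides of `αβ`
would cross. -/
lemma cut_mono (hA : IsDissection P A) {α β : Vertex n} {e f : ℕ × ℕ} (he : e ∈ cut P A α β)
    (hf : f ∈ cut P A α β) (h : e.1 < f.1) : e.2 ≤ f.2 := by
  by_contra hc
  have h1 := mem_cut.1 he; have h2 := mem_cut.1 hf
  refine hA.not_cross h1.2.2 h2.2.2 ?_
  rw [edge, edge, cross_iff_rk α, rk_edge_left he, rk_edge_left hf, rk_edge_right he,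
    rk_edge_right hf]
  unfold RankCross
  omega

/-- The segment `αβ` joins two points outside of the polygon `P`, and the set of edges of the
dissection `A` of `P` that it crosses is connected. -/
structure AccordionCut (P : Finset (Vertex n)) (A : Finset (Segment n)) (α β : Vertex n) :
    Prop where
  three_le : 3 ≤ n
  alternating : Alternating P
  dissection : IsDissection P A
  left_notMem : α ∉ P
  right_notMem : β ∉ P
  ne : α ≠ β
  connected : IsConnectedSet (crossedBy P A s(α, β))

namespace AccordionCut

variable {α β : Vertex n}

lemma symm (h : AccordionCut P A α β) : AccordionCut P A β α :=
  ⟨h.1, h.2, h.3, h.5, h.4, h.6.symm, by rw [Sym2.eq_swap]; exact h.7⟩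

lemma rk_even (h : AccordionCut P A α β) :
    rk α β % 2 = 0 ∧ 2 ≤ rk α β ∧ rk α β + 2 ≤ 2 * n := by
  have h1 := (h.alternating.mem_iff_of_notMem h.left_notMem β).not.1 h.right_notMem
  have h2 := rk_ne (α := α) h.ne
  rw [rk_self] at h2
  have := rk_lt α β
  omega

lemma odd (h : AccordionCut P A α β) {e : ℕ × ℕ} (he : e ∈ cut P A α β) :
    e.1 % 2 = 1 ∧ e.2 % 2 = 1 := by
  have h1 := mem_cut.1 he
  have h2 := h.dissection.mem_of_mem h1.2.2
  rw [h.alternating.mem_iff_of_notMem h.left_notMem,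
    h.alternating.mem_iff_of_notMem h.left_notMem, rk_edge_left he, rk_edge_right he] at h2
  have := rk_lt α β
  omega

lemma isBoundaryEdge_bot (h : AccordionCut P A α β) : IsBoundaryEdge P (edge α (1, 1)) :=
  isBoundaryEdge_around h.alternating (by have := h.1; omega) h.left_notMem

lemma isBoundaryEdge_top (h : AccordionCut P A α β) :
    IsBoundaryEdge P (edge α (cutTop α β)) := by
  have hm := h.rk_even
  rw [edge, cutTop]
  simp only
  have h1 : rk α (vtx α (rk α β - 1)) = rk α β - 1 := rk_vtx α (by omega)
  have h2 : rk α (vtx α (2 * n - (2 * n - rk α β - 1))) = rk α β + 1 := by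
    rw [rk_vtx α (by omega)]; omega
  refine ⟨isDiagonal_mk.2 ⟨fun h => ?_, ?_, ?_⟩, fun v hv w hw hc => ?_⟩
  · have := congrArg (rk α) h; omega
  · rw [h.alternating.mem_iff_of_notMem h.left_notMem, h1]; omega
  · rw [h.alternating.mem_iff_of_notMem h.left_notMem, h2]; omega
  · rw [cross_iff_rk α, h1, h2] at hc
    rw [h.alternating.mem_iff_of_notMem h.left_notMem] at hv hw
    have := rk_lt α v; have := rk_lt α w
    unfold RankCross at hc
    omega

lemma bot_mem (h : AccordionCut P A α β) : (1, 1) ∈ cut P A α β := by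
  have := h.rk_even
  exact mem_cut.2 ⟨by simp only; omega, by simp only; omega, Or.inr h.isBoundaryEdge_bot⟩

lemma top_mem (h : AccordionCut P A α β) : cutTop α β ∈ cut P A α β := by
  have := h.rk_even
  exact mem_cut.2 ⟨by simp only [cutTop]; omega, by simp only [cutTop]; omega,
    Or.inr h.isBoundaryEdge_top⟩

lemma bot_le {e : ℕ × ℕ} (he : e ∈ cut P A α β) : (1, 1) ≤ e :=
  ⟨(mem_cut.1 he).1.1, (mem_cut.1 he).2.1.1⟩

lemma le_top {e : ℕ × ℕ} (he : e ∈ cut P A α β) : e ≤ cutTop α β :=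
  ⟨Nat.le_sub_one_of_lt (mem_cut.1 he).1.2, Nat.le_sub_one_of_lt (mem_cut.1 he).2.1.2⟩

lemma bot_ne_top (h : AccordionCut P A α β) : (1, 1) ≠ cutTop α β := by
  have := h.rk_even; have := h.1
  intro hh
  have h1 := congrArg Prod.fst hh; have h2 := congrArg Prod.snd hh
  simp only [cutTop] at h1 h2
  omega

/-- Any property of edges of a cut that changes between two edges changes between two edges that
share an endpoint. -/
lemma exists_step (h : AccordionCut P A α β) {p : ℕ × ℕ → Prop} {e f : ℕ × ℕ}
    (he : e ∈ cut P A α β) (hf : f ∈ cut P A α β) (hpe : p e) (hpf : ¬ p f) :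
    ∃ c ∈ cut P A α β, ∃ d ∈ cut P A α β, p c ∧ ¬ p d ∧ (c.1 = d.1 ∨ c.2 = d.2) := by
  obtain ⟨c, d, ⟨hc, hd, hcd⟩, hpc, hpd⟩ := exists_step_of_reflTransGen
    (p := fun x => ∃ e ∈ cut P A α β, edge α e = x ∧ p e)
    (h.connected _ (edge_mem_crossedBy he) _ (edge_mem_crossedBy hf)) ⟨e, he, rfl, hpe⟩ (by
      rintro ⟨e', he', heq, hp⟩
      rw [edge_eq_iff he' hf] at heq
      exact hpf (heq ▸ hp))
  obtain ⟨c', hc', rfl, hpc'⟩ := hpc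
  obtain ⟨d', hd', rfl⟩ := exists_mem_cut hd
  exact ⟨c', hc', d', hd', hpc', fun hp => hpd ⟨d', hd', rfl, hp⟩, (share_iff hc' hd').1 hcd⟩

/-- For `up`, connectedness applied to the property `x ≤ e` gives adjacent edges `c ≤ e` and `d ≰
e`. Non-crossing of `d` and `e` forces the coordinate shared by `c` and `d` to be that of `e` as
well. The case of `down` is symmetric. -/
lemma staircase (h : AccordionCut P A α β) : Staircase (cut P A α β) (1, 1) (cutTop α β) where
  bot_mem := h.bot_mem
  top_mem := h.top_mem
  bot_le _ := bot_le
  le_top _ := le_top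
  mono _ he _ hf := cut_mono h.dissection he hf
  up e he hne := by
    obtain ⟨⟨c1, c2⟩, hc, ⟨d1, d2⟩, hd, hpc, hpd, hcd⟩ := h.exists_step (p := fun x => x ≤ e) he
      h.top_mem le_rfl (fun hle => hne (le_antisymm (le_top he) hle))
    obtain ⟨e1, e2⟩ := e
    have h1 := cut_mono h.dissection he hd
    have h2 := cut_mono h.dissection hd he
    simp only [Prod.mk_le_mk] at *
    rcases hcd with hcd | hcd
    · left; refine ⟨d2, by omega, ?_⟩
      rwa [show e1 = d1 by omega]
    · right; refine ⟨d1, by omega, ?_⟩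
      rwa [show e2 = d2 by omega]
  down e he hne := by
    obtain ⟨⟨c1, c2⟩, hc, ⟨d1, d2⟩, hd, hpc, hpd, hcd⟩ := h.exists_step (p := fun x => e ≤ x) he
      h.bot_mem le_rfl (fun hle => hne (le_antisymm hle (bot_le he)))
    obtain ⟨e1, e2⟩ := e
    have h1 := cut_mono h.dissection he hd
    have h2 := cut_mono h.dissection hd he
    simp only [Prod.mk_le_mk] at *
    rcases hcd with hcd | hcd
    · left; refine ⟨d2, by omega, ?_⟩
      rwa [show e1 = d1 by omega]
    · right; refine ⟨d1, by omega, ?_⟩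
      rwa [show e2 = d2 by omega]

lemma edge_mem_iff (h : AccordionCut P A α β) {e : ℕ × ℕ} (he : e ∈ cut P A α β) :
    edge α e ∈ A ↔ e ≠ (1, 1) ∧ e ≠ cutTop α β := by
  constructor
  · intro hA
    have hA' := h.dissection.not_isBoundaryEdge hA
    exact ⟨fun hh => hA' (hh ▸ h.isBoundaryEdge_bot), fun hh => hA' (hh ▸ h.isBoundaryEdge_top)⟩
  · rintro ⟨hb, ht⟩
    have h1 := mem_cut.1 he
    refine h1.2.2.resolve_right fun hbd => ?_
    have hm := h.rk_even
    have ho := h.odd he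
    have hP := h.alternating.mem_iff_of_notMem h.left_notMem
    obtain ⟨p, q⟩ := e
    simp only at h1 ho
    -- An edge other than the two extreme ones strictly separates a neighbour of `α` from a
    -- neighbour of `β`, so it is not a boundary edge.
    have hz : ∃ k < 2 * n, k % 2 = 1 ∧ (k < p ∨ 2 * n - q < k) := by
      by_cases hp : p = 1
      · have hq : q ≠ 1 := fun hq => hb (by rw [hp, hq])
        exact ⟨2 * n - 1, by omega, by omega, by omega⟩
      · exact ⟨1, by omega, by omega, by omega⟩
    have hw : ∃ k < 2 * n, k % 2 = 1 ∧ (p < k ∧ k < 2 * n - q) := by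
      by_cases hp : p = rk α β - 1
      · have hq : q ≠ 2 * n - rk α β - 1 := fun hq => ht (by rw [hp, hq, cutTop])
        exact ⟨rk α β + 1, by omega, by omega, by omega⟩
      · exact ⟨rk α β - 1, by omega, by omega, by omega⟩
    obtain ⟨k, hk, hk1, hk2⟩ := hz
    obtain ⟨l, hl, hl1, hl2⟩ := hw
    refine hbd.2 (vtx α k) ?_ (vtx α l) ?_ ?_
    · rw [hP, rk_vtx α hk]; exact hk1
    · rw [hP, rk_vtx α hl]; exact hl1
    · rw [edge, cross_iff_rk α, rk_edge_left he, rk_edge_right he, rk_vtx α hk, rk_vtx α hl]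
      simp only
      unfold RankCross
      omega

end AccordionCut

open Classical in
/-- The diagonals of a dissection that cross a segment, boundary edges excluded. -/
def innerCut (P : Finset (Vertex n)) (A : Finset (Segment n)) (α β : Vertex n) : Finset (ℕ × ℕ) :=
  (cut P A α β).filter fun e => edge α e ∈ A

lemma mem_innerCut {α β : Vertex n} {e : ℕ × ℕ} :
    e ∈ innerCut P A α β ↔ e ∈ cut P A α β ∧ edge α e ∈ A := by
  simp [innerCut]

/-- A sum over the diagonals of a dissection that cross a segment. -/
lemma sum_eq_sum_innerCut (α β : Vertex n) {f : Segment n → ℝ}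
    (hf : ∀ a ∈ A, ¬ Cross a s(α, β) → f a = 0) :
    ∑ a ∈ A, f a = ∑ e ∈ innerCut P A α β, f (edge α e) := by
  symm
  refine Finset.sum_of_injOn (edge α) ?_ ?_ ?_ fun _ _ => rfl
  · intro e he f hf heq
    exact (edge_eq_iff (mem_innerCut.1 he).1 (mem_innerCut.1 hf).1).1 heq
  · intro e he; exact (mem_innerCut.1 he).2
  · intro a ha hna
    refine hf a ha fun hc => hna ?_
    obtain ⟨e, he, rfl⟩ := exists_mem_cut (P := P) (A := A) ⟨Or.inl ha, hc⟩
    exact ⟨e, mem_innerCut.2 ⟨he, ha⟩, rfl⟩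

namespace AccordionCut

variable {α β : Vertex n}

lemma sum_cut (h : AccordionCut P A α β) (f : ℕ × ℕ → ℝ) :
    ∑ e ∈ cut P A α β, f e = f (1, 1) + f (cutTop α β) + ∑ e ∈ innerCut P A α β, f e := by
  have h1 : innerCut P A α β = ((cut P A α β).erase (1, 1)).erase (cutTop α β) := by
    ext e
    rw [mem_innerCut, Finset.mem_erase, Finset.mem_erase]
    constructor
    · rintro ⟨he, hA⟩
      have := (h.edge_mem_iff he).1 hA
      exact ⟨this.2, this.1, he⟩
    · rintro ⟨h2, h3, he⟩
      exact ⟨he, (h.edge_mem_iff he).2 ⟨h3, h2⟩⟩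
  rw [h1, ← Finset.add_sum_erase _ _ h.bot_mem, ← Finset.add_sum_erase _ _
    (Finset.mem_erase.2 ⟨h.bot_ne_top.symm, h.top_mem⟩), add_assoc]

lemma rowSign_eq_colSign (h : AccordionCut P A α β) {e : ℕ × ℕ} (he : e ∈ innerCut P A α β) :
    rowSign (cut P A α β) e = colSign (cut P A α β) e := by
  obtain ⟨he, hA⟩ := mem_innerCut.1 he
  obtain ⟨h1, h2⟩ := (h.edge_mem_iff he).1 hA
  exact h.staircase.rowSign_eq_colSign he h1 h2

end AccordionCut

end Dissection

end Accordion

end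

noncomputable section

namespace Accordion

variable {n : ℕ} {P : Finset (Vertex n)} {A : Finset (Segment n)}

/-! ## Cells and slalom signs -/

lemma exists_isCell {C₀ : Finset (Vertex n)} (h₀ : C₀ ⊆ P)
    (h : ∀ v ∈ C₀, ∀ w ∈ C₀, ∀ d ∈ A, ¬ Cross d s(v, w)) : ∃ C, IsCell P A C ∧ C₀ ⊆ C := by
  obtain ⟨C, hC, hmax⟩ := Finite.exists_le_maximal
    (p := fun C : Finset (Vertex n) => C ⊆ P ∧ ∀ v ∈ C, ∀ w ∈ C, ∀ d ∈ A, ¬ Cross d s(v, w))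
    ⟨h₀, h⟩
  exact ⟨C, hmax, hC⟩

/-- A chord that crosses the side `vz` of the triangle `uvz`, but neither of the other two sides,
must end at `u`. -/
lemma eq_or_eq_of_cross {a b u v z : Vertex n} (h : Cross s(a, b) s(v, z))
    (h1 : ¬ Cross s(a, b) s(u, v)) (h2 : ¬ Cross s(a, b) s(u, z)) : a = u ∨ b = u := by
  rw [cross_iff_rk u, rk_self] at *
  rw [← rk_inj (α := u), ← rk_inj (α := u) (v := b), rk_self]
  unfold RankCross at *
  omega

lemma not_cross_self (d : Segment n) (v : Vertex n) : ¬ Cross d s(v, v) := by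
  induction d using Sym2.ind with
  | h a b =>
    rw [cross_iff_rk v]
    unfold RankCross
    omega

/-- Three vertices lie in a common cell when two of the three sides of the triangle are edges and no
edge emanates from their common vertex inside of the triangle. -/
lemma exists_isCell_triangle (hA : IsDissection P A) {u v z : Vertex n}
    (huv : s(u, v) ∈ withBoundary P A) (huz : s(u, z) ∈ withBoundary P A)
    (hnear : ∀ b, s(u, b) ∈ withBoundary P A → ¬ Cross s(u, b) s(v, z)) :
    ∃ C, IsCell P A C ∧ u ∈ C ∧ v ∈ C ∧ z ∈ C := by
  have key : ∀ d ∈ A, ¬ Cross d s(u, v) ∧ ¬ Cross d s(u, z) ∧ ¬ Cross d s(v, z) := by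
    intro d hd
    have hd' := subset_withBoundary (P := P) hd
    have h1 := hA.not_cross hd' huv
    have h2 := hA.not_cross hd' huz
    refine ⟨h1, h2, fun hc => ?_⟩
    induction d using Sym2.ind with
    | h a b =>
      rcases eq_or_eq_of_cross hc h1 h2 with rfl | rfl
      · exact hnear b hd' hc
      · rw [Sym2.eq_swap] at hd' hc
        exact hnear a hd' hc
  obtain ⟨C, hC, hsub⟩ := exists_isCell (P := P) (A := A) (C₀ := {u, v, z}) (by
    intro x hx
    simp only [Finset.mem_insert, Finset.mem_singleton] at hx
    rcases hx with rfl | rfl | rfl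
    · exact (hA.mem_of_mem huv).1
    · exact (hA.mem_of_mem huv).2
    · exact (hA.mem_of_mem huz).2) (by
    intro x hx y hy d hd
    obtain ⟨h1, h2, h3⟩ := key d hd
    have h1' := h1; have h2' := h2; have h3' := h3
    rw [Sym2.eq_swap] at h1' h2' h3'
    simp only [Finset.mem_insert, Finset.mem_singleton] at hx hy
    rcases hx with rfl | rfl | rfl <;> rcases hy with rfl | rfl | rfl <;>
      first | assumption | exact not_cross_self _ _)
  exact ⟨C, hC, hsub (by simp), hsub (by simp), hsub (by simp)⟩

/-- The triangles `uvz` and `uvw` lie in two cells, which are distinct because `uv` separates `z`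
from `w`. -/
lemma areNeighbours_of_triangles (hA : IsDissection P A) {u v z w : Vertex n} {ε : Segment n}
    (huv : s(u, v) ∈ A) (huz : s(z, u) ∈ crossedBy P A ε) (hvw : s(v, w) ∈ crossedBy P A ε)
    (hz : ∀ b, s(u, b) ∈ withBoundary P A → ¬ Cross s(u, b) s(v, z))
    (hw : ∀ b, s(v, b) ∈ withBoundary P A → ¬ Cross s(v, b) s(u, w))
    (hc : Cross s(u, v) s(z, w)) : AreNeighbours P A s(u, v) ε s(z, u) s(v, w) := by
  have huv' := subset_withBoundary (P := P) huv
  obtain ⟨C, hC, huC, hvC, hzC⟩ := exists_isCell_triangle hA huv'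
    (by rw [Sym2.eq_swap]; exact huz.1) hz
  obtain ⟨C', hC', hvC', huC', hwC'⟩ := exists_isCell_triangle hA
    (by rw [Sym2.eq_swap]; exact huv') hvw.1 hw
  refine ⟨C, C', hC, hC', ?_, ?_, ⟨huz, ?_, ?_⟩, ⟨hvw, ?_, ?_⟩⟩
  · rintro rfl
    exact hC.1.2 z hzC w hwC' _ huv hc
  · intro x hx
    rcases Sym2.mem_iff.1 hx with rfl | rfl
    · exact ⟨huC, huC'⟩
    · exact ⟨hvC, hvC'⟩
  · intro heq
    rw [cross_iff_rk u] at hc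
    have : z = v := by
      rcases Sym2.eq_iff.1 heq with ⟨h1, h2⟩ | ⟨h1, h2⟩
      · rw [h1, h2]
      · exact h1
    rw [this] at hc
    unfold RankCross at hc
    omega
  · intro x hx
    rcases Sym2.mem_iff.1 hx with rfl | rfl
    · exact hzC
    · exact huC
  · intro heq
    rw [cross_iff_rk u] at hc
    have : w = u := by
      rcases Sym2.eq_iff.1 heq with ⟨h1, h2⟩ | ⟨h1, h2⟩
      · rw [h2, h1]
      · exact h2
    rw [this] at hc
    unfold RankCross at hc
    omega
  · intro x hx
    rcases Sym2.mem_iff.1 hx with rfl | rfl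
    · exact hvC'
    · exact hwC'

lemma exists_greatest {p : ℕ → Prop} {b k : ℕ} (hk : p k) (hb : ∀ m, p m → m < b) :
    ∃ m, p m ∧ ∀ l, p l → l ≤ m := by
  classical
  have hne : ((Finset.range b).filter p).Nonempty := ⟨k, by simp [hk, hb k hk]⟩
  refine ⟨_, (Finset.mem_filter.1 (Finset.max'_mem _ hne)).2, fun l hl => ?_⟩
  exact Finset.le_max' _ _ (by simp [hl, hb l hl])

lemma exists_least {p : ℕ → Prop} {k : ℕ} (hk : p k) : ∃ m, p m ∧ ∀ l, p l → m ≤ l := by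
  classical
  exact ⟨Nat.find ⟨k, hk⟩, Nat.find_spec ⟨k, hk⟩, fun l hl => Nat.find_min' _ hl⟩

namespace AccordionCut

variable {α β : Vertex n}

/-- Edges inside of a triangle cross the segment and are thus in the cut. -/
lemma mem_cut_of_left {p q : ℕ} (he : (p, q) ∈ cut P A α β) {b : Vertex n}
    (hb : s(vtx α p, b) ∈ withBoundary P A) (hlt : rk α β < rk α b) :
    (p, 2 * n - rk α b) ∈ cut P A α β := by
  have h1 := rk_edge_left he
  have h2 := mem_cut.1 he
  simp only at h1 h2
  have := (mem_cut_of_rk hb (by omega) (by omega) hlt).1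
  rwa [h1] at this

lemma mem_cut_of_right {p q : ℕ} (he : (p, q) ∈ cut P A α β) {b : Vertex n}
    (hb : s(vtx α (2 * n - q), b) ∈ withBoundary P A) (h0 : 0 < rk α b)
    (hlt : rk α b < rk α β) : (rk α b, q) ∈ cut P A α β := by
  have h1 := rk_edge_right he
  have h2 := mem_cut.1 he
  have := rk_lt α β
  simp only at h1 h2
  rw [Sym2.eq_swap] at hb
  have := (mem_cut_of_rk hb h0 hlt (by omega)).1
  rwa [h1, show 2 * n - (2 * n - q) = q by omega] at this

/-- In a `Z`, one neighbour pivots towards `α` around the left endpoint (a step down the row) and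
the other towards `β` around the right endpoint (a step up the column). An `S` exchanges the two
endpoints. -/
lemma forms_z_iff (h : AccordionCut P A α β) {p q : ℕ} (he : (p, q) ∈ innerCut P A α β) :
    (∃ μ ν, AreNeighbours P A (edge α (p, q)) s(α, β) μ ν ∧ FormsZ μ (edge α (p, q)) ν) ↔
      (∃ r, r < q ∧ (p, r) ∈ cut P A α β) ∧ ∃ r, p < r ∧ (r, q) ∈ cut P A α β := by
  obtain ⟨he, hA⟩ := mem_innerCut.1 he
  have hm := rk_lt α β
  have e1 := rk_edge_left he
  have e2 := rk_edge_right he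
  have e3 := mem_cut.1 he
  simp only at e1 e2 e3
  constructor
  · rintro ⟨μ, ν, ⟨C, C', -, -, -, -, ⟨hμ, -⟩, ⟨hν, -⟩⟩, x, u, v, y, rfl, hδ, rfl, h1, h2⟩
    obtain ⟨hμ, hμc⟩ := hμ
    obtain ⟨hν, hνc⟩ := hν
    rw [cross_iff_rk α, rk_self] at hμc hνc
    rw [sbtw_iff_rk α] at h1 h2
    have hx := rk_lt α x
    have hy := rk_lt α y
    rcases Sym2.eq_iff.1 hδ with ⟨rfl, rfl⟩ | ⟨rfl, rfl⟩
    · rw [e1] at hμc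
      rw [e2] at hνc
      rw [e1] at h1
      rw [e2] at h2
      unfold RankCross at hμc hνc
      rw [Sym2.eq_swap] at hμ
      exact ⟨⟨_, by omega, mem_cut_of_left he hμ (by omega)⟩,
        ⟨_, by omega, mem_cut_of_right he hν (by omega) (by omega)⟩⟩
    · rw [e2] at hμc
      rw [e1] at hνc
      rw [e2] at h1
      rw [e1] at h2
      unfold RankCross at hμc hνc
      rw [Sym2.eq_swap] at hμ
      exact ⟨⟨_, by omega, mem_cut_of_left he hν (by omega)⟩,
        ⟨_, by omega, mem_cut_of_right he hμ (by omega) (by omega)⟩⟩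
  · rintro ⟨⟨r, hr⟩, ⟨r', hr'⟩⟩
    -- The nearest edges of the row and of the column: an edge entering one of the two triangles
    -- from the common endpoint would be nearer still.
    obtain ⟨q0, ⟨hq0, hq0K⟩, hq0max⟩ := exists_greatest
      (p := fun r => r < q ∧ (p, r) ∈ cut P A α β) hr (b := q) (fun _ hm => hm.1)
    obtain ⟨p0, ⟨hp0, hp0K⟩, hp0min⟩ := exists_least
      (p := fun r => p < r ∧ (r, q) ∈ cut P A α β) hr'
    have f1 := rk_edge_right hq0K
    have f2 := rk_edge_left hp0K
    have f3 := mem_cut.1 hq0K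
    have f4 := mem_cut.1 hp0K
    simp only at f1 f2 f3 f4
    refine ⟨s(vtx α (2 * n - q0), vtx α p), s(vtx α (2 * n - q), vtx α p0), ?_,
      ⟨vtx α (2 * n - q0), vtx α p, vtx α (2 * n - q), vtx α p0, rfl, rfl, rfl, ?_, ?_⟩⟩
    · refine areNeighbours_of_triangles h.dissection hA ?_ ?_ ?_ ?_ ?_
      · have hs : s(vtx α (2 * n - q0), vtx α p) = edge α (p, q0) := Sym2.eq_swap
        exact hs ▸ edge_mem_crossedBy hq0K
      · have hs : s(vtx α (2 * n - q), vtx α p0) = edge α (p0, q) := Sym2.eq_swap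
        exact hs ▸ edge_mem_crossedBy hp0K
      · intro b hb hc
        rw [cross_iff_rk α, e1, e2, f1] at hc
        have := rk_lt α b
        unfold RankCross at hc
        have := hq0max _ ⟨by omega, mem_cut_of_left he hb (by omega)⟩
        omega
      · intro b hb hc
        rw [cross_iff_rk α, e1, e2, f2] at hc
        unfold RankCross at hc
        have := hp0min _ ⟨by omega, mem_cut_of_right he hb (by omega) (by omega)⟩
        omega
      · rw [cross_iff_rk α, e1, e2, f1, f2]
        unfold RankCross
        omega
    · rw [sbtw_iff_rk α, e1, f1, f2]; omega
    · rw [sbtw_iff_rk α, e2, f1, f2]; omega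

lemma forms_s_iff (h : AccordionCut P A α β) {p q : ℕ} (he : (p, q) ∈ innerCut P A α β) :
    (∃ μ ν, AreNeighbours P A (edge α (p, q)) s(α, β) μ ν ∧ FormsS μ (edge α (p, q)) ν) ↔
      (∃ r, r < p ∧ (r, q) ∈ cut P A α β) ∧ ∃ r, q < r ∧ (p, r) ∈ cut P A α β := by
  obtain ⟨he, hA⟩ := mem_innerCut.1 he
  have hm := rk_lt α β
  have e1 := rk_edge_left he
  have e2 := rk_edge_right he
  have e3 := mem_cut.1 he
  simp only at e1 e2 e3
  constructor
  · rintro ⟨μ, ν, ⟨C, C', -, -, -, -, ⟨hμ, -⟩, ⟨hν, -⟩⟩, x, u, v, y, rfl, hδ, rfl, h1, h2⟩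
    obtain ⟨hμ, hμc⟩ := hμ
    obtain ⟨hν, hνc⟩ := hν
    rw [cross_iff_rk α, rk_self] at hμc hνc
    rw [sbtw_iff_rk α] at h1 h2
    have hx := rk_lt α x
    have hy := rk_lt α y
    rcases Sym2.eq_iff.1 hδ with ⟨rfl, rfl⟩ | ⟨rfl, rfl⟩
    · rw [e1] at hμc
      rw [e2] at hνc
      rw [e2] at h1
      rw [e1] at h2
      unfold RankCross at hμc hνc
      rw [Sym2.eq_swap] at hμ
      exact ⟨⟨_, by omega, mem_cut_of_right he hν (by omega) (by omega)⟩,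
        ⟨_, by omega, mem_cut_of_left he hμ (by omega)⟩⟩
    · rw [e2] at hμc
      rw [e1] at hνc
      rw [e1] at h1
      rw [e2] at h2
      unfold RankCross at hμc hνc
      rw [Sym2.eq_swap] at hμ
      exact ⟨⟨_, by omega, mem_cut_of_right he hμ (by omega) (by omega)⟩,
        ⟨_, by omega, mem_cut_of_left he hν (by omega)⟩⟩
  · rintro ⟨⟨r, hr⟩, ⟨r', hr'⟩⟩
    obtain ⟨p0, ⟨hp0, hp0K⟩, hp0max⟩ := exists_greatest
      (p := fun r => r < p ∧ (r, q) ∈ cut P A α β) hr (b := p) (fun _ hm => hm.1)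
    obtain ⟨q0, ⟨hq0, hq0K⟩, hq0min⟩ := exists_least
      (p := fun r => q < r ∧ (p, r) ∈ cut P A α β) hr'
    have f1 := rk_edge_right hq0K
    have f2 := rk_edge_left hp0K
    have f3 := mem_cut.1 hq0K
    have f4 := mem_cut.1 hp0K
    simp only at f1 f2 f3 f4
    have hedge : edge α (p, q) = s(vtx α (2 * n - q), vtx α p) := Sym2.eq_swap
    rw [hedge]
    refine ⟨s(vtx α p0, vtx α (2 * n - q)), s(vtx α p, vtx α (2 * n - q0)), ?_,
      ⟨vtx α p0, vtx α (2 * n - q), vtx α p, vtx α (2 * n - q0), rfl, rfl, rfl, ?_, ?_⟩⟩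
    · refine areNeighbours_of_triangles h.dissection (hedge ▸ hA) ?_ ?_ ?_ ?_ ?_
      · exact edge_mem_crossedBy hp0K
      · exact edge_mem_crossedBy hq0K
      · intro b hb hc
        rw [cross_iff_rk α, e1, e2, f2] at hc
        unfold RankCross at hc
        have := hp0max _ ⟨by omega, mem_cut_of_right he hb (by omega) (by omega)⟩
        omega
      · intro b hb hc
        rw [cross_iff_rk α, e1, e2, f1] at hc
        have := rk_lt α b
        unfold RankCross at hc
        have := hq0min _ ⟨by omega, mem_cut_of_left he hb (by omega)⟩
        omega
      · rw [cross_iff_rk α, e1, e2, f1, f2]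
        unfold RankCross
        omega
    · rw [sbtw_iff_rk α, e1, f1, f2]; omega
    · rw [sbtw_iff_rk α, e2, f1, f2]; omega

/-- The slalom sign is the turn of the staircase. -/
lemma slalomSign_eq (h : AccordionCut P A α β) {e : ℕ × ℕ} (he : e ∈ innerCut P A α β) :
    slalomSign P A (edge α e) s(α, β) = rowSign (cut P A α β) e := by
  obtain ⟨p, q⟩ := e
  obtain ⟨heK, hA⟩ := mem_innerCut.1 he
  obtain ⟨h1, h2⟩ := (h.edge_mem_iff heK).1 hA
  have hc := cross_of_mem_cut heK
  have hup := h.staircase.up_iff heK h2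
  have hdown := h.staircase.down_iff heK h1
  simp only at hup hdown
  have hz := (and_iff_right hc).trans (h.forms_z_iff he)
  have hs := (and_iff_right hc).trans (h.forms_s_iff he)
  unfold slalomSign rowSign
  by_cases hd : ∃ r, r < q ∧ (p, r) ∈ cut P A α β
  · have hd' := hdown.1 hd
    by_cases hu : ∃ r, q < r ∧ (p, r) ∈ cut P A α β
    · have hu' := hup.1 hu
      rw [if_neg (hz.not.2 fun hh => hu' hh.2), if_neg (hs.not.2 fun hh => hd' hh.1),
        ind_true hd, ind_true hu, sub_self]
    · have hu' := not_not.1 (hup.not.1 hu)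
      rw [if_pos (hz.2 ⟨hd, hu'⟩), ind_true hd, ind_false hu, sub_zero]
  · have hd' := not_not.1 (hdown.not.1 hd)
    by_cases hu : ∃ r, q < r ∧ (p, r) ∈ cut P A α β
    · rw [if_neg (hz.not.2 fun hh => hd hh.1), if_pos (hs.2 ⟨hd', hu⟩), ind_false hd,
        ind_true hu, zero_sub]
    · rw [if_neg (hz.not.2 fun hh => hd hh.1), if_neg (hs.not.2 fun hh => hu hh.2),
        ind_false hd, ind_false hu, sub_self]

end AccordionCut

lemma slalomSign_eq_zero {δ ε : Segment n} (h : ¬ Cross δ ε) : slalomSign P A δ ε = 0 := by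
  simp [slalomSign, h]

/-- A sum weighted by slalom signs vanishes when the weights only depend on the endpoints on one
side, and vanish at the neighbours of the endpoints of the segment. -/
lemma AccordionCut.sum_slalomSign_mul {α β : Vertex n} (h : AccordionCut P A α β)
    {f : Segment n → ℝ} (T : ℕ → ℝ) (h1 : T 1 = 0) (h2 : T (rk α β - 1) = 0)
    (hf : ∀ e ∈ innerCut P A α β, f (edge α e) = T e.1) :
    ∑ a ∈ A, slalomSign P A a s(α, β) * f a = 0 := by
  rw [sum_eq_sum_innerCut (P := P) α β]
  · have key := sum_rowSign_mul_fst (cut P A α β) T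
    rw [h.sum_cut] at key
    simp only [cutTop, h1, h2, mul_zero, zero_add] at key
    rw [← key]
    exact Finset.sum_congr rfl fun e he => by rw [h.slalomSign_eq he, hf e he]
  · intro a _ hc
    rw [slalomSign_eq_zero hc, zero_mul]

end Accordion

end

noncomputable section

namespace Accordion

variable {n : ℕ} {P Q : Finset (Vertex n)} {A B : Finset (Segment n)}

/-! ## Duality between two dissections made of accordions of each other -/

/-- Some edge at `u` separates `w` from `v`. -/
def Pivots (P : Finset (Vertex n)) (A : Finset (Segment n)) (u v w : Vertex n) : Prop :=
  ∃ z, s(u, z) ∈ withBoundary P A ∧ Cross s(u, z) s(w, v)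

/-- The row of `u` consists of the edges at `u` that cross `xy`; those before `uv` separate `x` from
`v`, those after it separate `y` from `v`. The sign thus splits into one term for each end of the
accordion, which is what lets the products of signs telescope. -/
lemma AccordionCut.slalomSign_eq_pivots {x y u v : Vertex n} (h : AccordionCut P A x y)
    (huv : s(u, v) ∈ A) (hu : sbtw x u y) (hv : sbtw y v x) :
    slalomSign P A s(u, v) s(x, y) = ind (Pivots P A u v x) - ind (Pivots P A u v y) := by
  rw [sbtw_iff_rk x, rk_self] at hu hv
  have hlv := rk_lt x v
  obtain ⟨he, heq⟩ := mem_cut_of_rk (subset_withBoundary (P := P) huv) (α := x) (β := y)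
    (by omega) (by omega) (by omega)
  have hy := h.right_notMem
  rw [← heq, h.slalomSign_eq (mem_innerCut.2 ⟨he, heq ▸ huv⟩), rowSign]
  have key : ∀ q, (rk x u, q) ∈ cut P A x y → s(u, vtx x (2 * n - q)) ∈ withBoundary P A := by
    intro q hq
    have := (mem_cut.1 hq).2.2
    rwa [edge, vtx_rk] at this
  congr 1
  · refine ind_congr ⟨?_, ?_⟩
    · rintro ⟨q, hq, hqK⟩
      have h1 := rk_edge_right hqK
      have h2 := mem_cut.1 hqK
      refine ⟨_, key q hqK, ?_⟩
      rw [cross_iff_rk x, rk_self]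
      simp only at h1 h2 hq
      rw [h1]
      unfold RankCross
      omega
    · rintro ⟨z, hz, hc⟩
      have := rk_lt x z
      rw [cross_iff_rk x, rk_self] at hc
      unfold RankCross at hc
      exact ⟨2 * n - rk x z, by simp only; omega,
        (mem_cut_of_rk hz (by omega) (by omega) (by omega)).1⟩
  · refine ind_congr ⟨?_, ?_⟩
    · rintro ⟨q, hq, hqK⟩
      have h1 := rk_edge_right hqK
      have h2 := mem_cut.1 hqK
      refine ⟨_, key q hqK, ?_⟩
      rw [cross_iff_rk x]
      simp only at h1 h2 hq
      rw [h1]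
      unfold RankCross
      omega
    · rintro ⟨z, hz, hc⟩
      have hzy : z ≠ y := fun hh => hy (hh ▸ (h.dissection.mem_of_mem hz).2)
      have := rk_lt x z
      rw [cross_iff_rk x] at hc
      unfold RankCross at hc
      exact ⟨2 * n - rk x z, by simp only; omega,
        (mem_cut_of_rk hz (by omega) (by omega) (by omega)).1⟩

/-- Two dissections of the two polygons, each made of accordions of the other one. -/
structure MutualAccordion (P : Finset (Vertex n)) (A : Finset (Segment n))
    (Q : Finset (Vertex n)) (B : Finset (Segment n)) : Prop where
  three_le : 3 ≤ n
  left_alternating : Alternating P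
  right_alternating : Alternating Q
  compl : ∀ v, v ∈ Q ↔ v ∉ P
  left_dissection : IsDissection P A
  right_dissection : IsDissection Q B
  left_connected : ∀ a ∈ A, IsConnectedSet (crossedBy Q B a)
  right_connected : ∀ b ∈ B, IsConnectedSet (crossedBy P A b)

lemma isBoundaryEdge_of_rk_eq_two (hP : Alternating P) {x y : Vertex n} (hx : x ∈ P)
    (h : rk x y = 2) : IsBoundaryEdge P s(x, y) := by
  refine ⟨isDiagonal_mk.2 ⟨?_, hx, ?_⟩, fun v hv w hw hc => ?_⟩
  · rintro rfl; simp at h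
  · rw [hP.mem_iff_of_mem hx, h]
  · rw [cross_iff_rk x, rk_self, h] at hc
    rw [hP.mem_iff_of_mem hx] at hv hw
    unfold RankCross at hc
    omega

lemma IsDissection.rk_bounds (hP : Alternating P) (hA : IsDissection P A) {x y : Vertex n}
    (h : s(x, y) ∈ A) : 4 ≤ rk x y ∧ rk x y + 4 ≤ 2 * n ∧ rk x y % 2 = 0 := by
  obtain ⟨hne, hx, hy⟩ := isDiagonal_mk.1 (hA.1 _ h).1
  have h1 := (hP.mem_iff_of_mem hx y).1 hy
  have h2 := rk_lt x y
  have h3 := rk_ne (α := x) hne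
  rw [rk_self] at h3
  have h4 : rk x y ≠ 2 := fun hh => (hA.1 _ h).2 (isBoundaryEdge_of_rk_eq_two hP hx hh)
  have h5 : rk y x ≠ 2 := fun hh => (hA.1 _ h).2 (by
    rw [Sym2.eq_swap]; exact isBoundaryEdge_of_rk_eq_two hP hy hh)
  rw [rk_swap hne] at h5
  omega

namespace MutualAccordion

lemma symm (h : MutualAccordion P A Q B) : MutualAccordion Q B P A :=
  ⟨h.1, h.3, h.2, fun v => by rw [h.compl, not_not], h.6, h.5, h.8, h.7⟩

lemma accordionCut (h : MutualAccordion P A Q B) {α β : Vertex n} (hb : s(α, β) ∈ B) :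
    AccordionCut P A α β := by
  obtain ⟨h1, h2, h3⟩ := isDiagonal_mk.1 (h.right_dissection.1 _ hb).1
  exact ⟨h.1, h.2, h.5, (h.compl _).1 h2, (h.compl _).1 h3, h1, h.right_connected _ hb⟩

/-- The second sign is `θ` at the right endpoint minus `θ` at the left one. Measuring the first sign
by columns against the former and by rows against the latter, both sums over the whole staircase
vanish. Only the boundary terms remain: `θ` is `1` next to `α` and `0` next to `β`, so the defect at
the bottom gives `-1`. -/
lemma sum_slalomSign_self (h : MutualAccordion P A Q B) {α β : Vertex n} (hb : s(α, β) ∈ B) :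
    ∑ a ∈ A, slalomSign P A a s(α, β) * slalomSign Q B s(α, β) a = -1 := by
  have hcut := h.accordionCut hb
  have hbounds := h.right_dissection.rk_bounds h.right_alternating hb
  have hαQ : α ∈ Q := (h.compl _).2 hcut.left_notMem
  set θ : Vertex n → ℝ := fun w => ind (Pivots Q B α β w) with hθ
  have hstep : ∀ e ∈ innerCut P A α β,
      slalomSign P A (edge α e) s(α, β) * slalomSign Q B s(α, β) (edge α e) =
      colSign (cut P A α β) e * θ (vtx α (2 * n - e.2)) -
        rowSign (cut P A α β) e * θ (vtx α e.1) := by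
    intro e he
    rw [hcut.slalomSign_eq he, ← hcut.rowSign_eq_colSign he, ← mul_sub]
    congr 1
    obtain ⟨heK, hA⟩ := mem_innerCut.1 he
    have h1 := rk_edge_left heK
    have h2 := rk_edge_right heK
    have h3 := mem_cut.1 heK
    have hc := (h.symm.accordionCut hA).symm
    have := hc.slalomSign_eq_pivots hb (by rw [sbtw_iff_rk α, rk_self, h1, h2]; omega)
      (by rw [sbtw_iff_rk α, h1, h2]; omega)
    rw [← this, edge, Sym2.eq_swap (a := vtx α e.1)]
  have hθ1 : θ (vtx α 1) = 1 := by
    refine ind_true ⟨vtx α 2, Or.inr ?_, ?_⟩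
    · exact isBoundaryEdge_of_rk_eq_two h.right_alternating hαQ (rk_vtx α (by omega))
    · rw [cross_iff_rk α, rk_self, rk_vtx α (by omega), rk_vtx α (by omega)]
      unfold RankCross
      omega
  have hθ2 : θ (vtx α (2 * n - 1)) = 1 := by
    have h2 : rk α (vtx α (2 * n - 2)) = 2 * n - 2 := rk_vtx α (by omega)
    refine ind_true ⟨vtx α (2 * n - 2), Or.inr ?_, ?_⟩
    · rw [Sym2.eq_swap]
      refine isBoundaryEdge_of_rk_eq_two h.right_alternating ?_ ?_
      · rw [h.right_alternating.mem_iff_of_mem hαQ, h2]; omega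
      · rw [rk_swap, h2]
        · omega
        · intro hh
          rw [← hh, rk_self] at h2
          omega
    · rw [cross_iff_rk α, rk_self, h2, rk_vtx α (by omega)]
      unfold RankCross
      omega
  -- No point of the circle lies strictly between `β` and its neighbours, so no edge at `α` can
  -- separate them.
  have hθ3 : ∀ k, k = rk α β - 1 ∨ k = rk α β + 1 → θ (vtx α k) = 0 := by
    intro k hk
    refine ind_false ?_
    rintro ⟨z, hz, hc⟩
    rw [cross_iff_rk α, rk_self, rk_vtx α (by omega)] at hc
    unfold RankCross at hc
    omega
  rw [sum_eq_sum_innerCut (P := P) α β, Finset.sum_congr rfl hstep, Finset.sum_sub_distrib]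
  · have k1 := sum_rowSign_mul_fst (cut P A α β) fun p => θ (vtx α p)
    have k2 := sum_colSign_mul_snd (cut P A α β) fun q => θ (vtx α (2 * n - q))
    rw [hcut.sum_cut] at k1 k2
    simp only [cutTop] at k1 k2
    rw [hθ1, hθ3 _ (Or.inl rfl)] at k1
    rw [hθ2, hθ3 _ (Or.inr (by omega))] at k2
    have k3 := hcut.staircase.colSign_bot_sub_rowSign_bot hcut.bot_ne_top
    linarith
  · intro a _ hc
    rw [slalomSign_eq_zero hc, zero_mul]

/-- Since `uv` stays on one side of `αβ`, the sign of a diagonal crossing `αβ` on `uv` depends only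
on its endpoint on that side, so the turns cancel row by row. -/
lemma sum_slalomSign_of_left (h : MutualAccordion P A Q B) {α β u v : Vertex n}
    (hb : s(α, β) ∈ B) (hb' : s(u, v) ∈ B) (hne : s(u, v) ≠ s(α, β)) (huv : rk α u < rk α v)
    (hv : rk α v ≤ rk α β) :
    ∑ a ∈ A, slalomSign P A a s(α, β) * slalomSign Q B s(u, v) a = 0 := by
  have hcut := h.accordionCut hb
  have hbounds := h.right_dissection.rk_bounds h.right_alternating hb
  have hbounds' := h.right_dissection.rk_bounds h.right_alternating hb'
  have huv' : rk α u + 4 ≤ rk α v ∧ rk α v - rk α u + 4 ≤ 2 * n := by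
    have h1 := hbounds'.1; have h2 := hbounds'.2.1
    have := rk_lt α v
    have h3 : rk u v = rk α v - rk α u := by
      have := α.2; have := u.2; have := v.2
      unfold rk at huv ⊢
      split_ifs at huv ⊢ <;> omega
    omega
  -- The contribution of the far endpoint `y`. It is constant, because an edge at `v` cannot cross
  -- `αβ`; if `v = β`, the diagonal `αβ` itself is the separating edge.
  set κ : ℝ := ind (∃ z, s(v, z) ∈ withBoundary Q B ∧ rk α z < rk α u) with hκ
  have hκ' : ∀ y, rk α β < rk α y → ind (Pivots Q B v u y) = κ := by
    intro y hy
    refine ind_congr ⟨?_, ?_⟩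
    · rintro ⟨z, hz, hc⟩
      have hnc := h.right_dissection.not_cross hz (subset_withBoundary hb)
      by_cases hzu : rk α z < rk α u
      · exact ⟨z, hz, hzu⟩
      · rw [cross_iff_rk α] at hc hnc
        rw [rk_self] at hnc
        have hvβ : rk α v = rk α β := by
          unfold RankCross at hc hnc
          omega
        have hvβ' : v = β := rk_inj.1 hvβ
        refine ⟨α, ?_, ?_⟩
        · rw [hvβ', Sym2.eq_swap]; exact subset_withBoundary hb
        · rw [rk_self]
          refine Nat.pos_of_ne_zero fun h0 => hne ?_
          have : u = α := rk_inj.1 (h0.trans (rk_self α).symm)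
          rw [this, hvβ']
    · rintro ⟨z, hz, hzu⟩
      refine ⟨z, hz, ?_⟩
      rw [cross_iff_rk α]
      unfold RankCross
      omega
  refine hcut.sum_slalomSign_mul (f := fun a => slalomSign Q B s(u, v) a)
    (fun p => if rk α u < p ∧ p < rk α v then ind (Pivots Q B v u (vtx α p)) - κ else 0) ?_ ?_ ?_
  -- Rank `1` can lie between `u` and `v` only if `u = α`, where both terms are `0`. At the other
  -- end, the condition forces `v = β`, where both terms are `1`.
  · split_ifs with hc
    · have hu0 : rk α u = 0 := by omega
      rw [hκ, ind_false, ind_false, sub_zero]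
      · rintro ⟨z, _, hz⟩; omega
      · rintro ⟨z, hz, hc'⟩
        rw [cross_iff_rk α, rk_vtx α (by omega), hu0] at hc'
        unfold RankCross at hc'
        omega
    · rfl
  · split_ifs with hc
    · have hvβ : rk α v = rk α β := by omega
      have hvβ' : v = β := rk_inj.1 hvβ
      have hβQ : β ∈ Q := (h.compl _).2 hcut.right_notMem
      rw [hκ, ind_true, ind_true, sub_self]
      · refine ⟨α, ?_, ?_⟩
        · rw [hvβ', Sym2.eq_swap]; exact subset_withBoundary hb
        · rw [rk_self]
          refine Nat.pos_of_ne_zero fun h0 => hne ?_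
          have : u = α := rk_inj.1 (h0.trans (rk_self α).symm)
          rw [this, hvβ']
      · have h2 : rk α (vtx α (rk α β - 2)) = rk α β - 2 := rk_vtx α (by omega)
        have hαQ : α ∈ Q := (h.compl _).2 hcut.left_notMem
        refine ⟨vtx α (rk α β - 2), Or.inr ?_, ?_⟩
        · rw [Sym2.eq_swap]
          refine isBoundaryEdge_of_rk_eq_two h.right_alternating ?_ ?_
          · rw [h.right_alternating.mem_iff_of_mem hαQ, h2]; omega
          · rw [hvβ']
            have := α.2; have := β.2; have := (vtx α (rk α β - 2)).2
            generalize vtx α (rk α β - 2) = t at *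
            unfold rk at h2 hbounds ⊢
            split_ifs at h2 hbounds ⊢ <;> omega
        · rw [cross_iff_rk α, h2, rk_vtx α (by omega), hvβ]
          unfold RankCross
          omega
    · rfl
  · intro e he
    obtain ⟨heK, hA⟩ := mem_innerCut.1 he
    have h1 := rk_edge_left heK
    have h2 := rk_edge_right heK
    have h3 := mem_cut.1 heK
    split_ifs with hc
    · have hc' := h.symm.accordionCut hA
      have hb'' := hb'
      rw [Sym2.eq_swap] at hb''
      have := hc'.slalomSign_eq_pivots hb'' (by rw [sbtw_iff_rk α, h1, h2]; omega)
        (by rw [sbtw_iff_rk α, h1, h2]; omega)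
      rw [edge, Sym2.eq_swap (a := u), this, hκ' (vtx α (2 * n - e.2)) (by rw [h2]; omega)]
    · refine slalomSign_eq_zero ?_
      rw [edge, cross_iff_rk α, h1, h2]
      unfold RankCross
      omega

/-- Non-crossing puts `b'` on one closed side of `b`, and exchanging the endpoints of `b` exchanges
its sides. -/
lemma sum_slalomSign_of_ne (h : MutualAccordion P A Q B) {b b' : Segment n}
    (hb : b ∈ B) (hb' : b' ∈ B) (hne : b' ≠ b) :
    ∑ a ∈ A, slalomSign P A a b * slalomSign Q B b' a = 0 := by
  induction b using Sym2.ind with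
  | h α β =>
  induction b' using Sym2.ind with
  | h u v =>
    have hnc := h.right_dissection.2 _ hb' _ hb
    have huv := (isDiagonal_mk.1 (h.right_dissection.1 _ hb').1).1
    have huv' := rk_ne (α := α) huv
    have hαβ := (isDiagonal_mk.1 (h.right_dissection.1 _ hb).1).1
    rw [cross_iff_rk α, rk_self] at hnc
    have hm := h.right_dissection.rk_bounds h.right_alternating hb
    have hu := rk_lt α u; have hv := rk_lt α v
    by_cases hl : rk α u ≤ rk α β ∧ rk α v ≤ rk α β
    · rcases lt_or_gt_of_ne huv' with hlt | hlt
      · exact h.sum_slalomSign_of_left hb hb' hne hlt hl.2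
      · rw [Sym2.eq_swap (a := u)] at hb' hne ⊢
        exact h.sum_slalomSign_of_left hb hb' hne hlt hl.1
    · have hl' : (rk α u = 0 ∨ rk α β ≤ rk α u) ∧ (rk α v = 0 ∨ rk α β ≤ rk α v) := by
        unfold RankCross at hnc
        omega
      have hrk : ∀ w, rk α w = 0 ∨ rk α β ≤ rk α w → rk β w ≤ rk β α := by
        intro w hw
        have := α.2; have := β.2; have := w.2
        have : α.val ≠ β.val := fun hh => hαβ (Fin.ext hh)
        unfold rk at hw ⊢
        split_ifs at hw ⊢ <;> omega
      have h1 := hrk u hl'.1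
      have h2 := hrk v hl'.2
      rw [Sym2.eq_swap (a := α)] at hb hne ⊢
      rcases lt_or_gt_of_ne (rk_ne (α := β) huv) with hlt | hlt
      · exact h.sum_slalomSign_of_left hb hb' hne hlt h2
      · rw [Sym2.eq_swap (a := u)] at hb' hne ⊢
        exact h.sum_slalomSign_of_left hb hb' hne hlt h1

open Classical in
/-- The duality between the slalom signs of two dissections that are accordions of each other. -/
theorem sum_slalomSign (h : MutualAccordion P A Q B) {b b' : Segment n} (hb : b ∈ B)
    (hb' : b' ∈ B) : ∑ a ∈ A, slalomSign P A a b * -slalomSign Q B b' a =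
      if b = b' then 1 else 0 := by
  simp only [mul_neg, Finset.sum_neg_distrib]
  split_ifs with heq
  · subst heq
    induction b using Sym2.ind with
    | h α β => rw [h.sum_slalomSign_self hb, neg_neg]
  · rw [h.sum_slalomSign_of_ne hb hb' (Ne.symm heq), neg_zero]

end MutualAccordion

end Accordion

end

noncomputable section

namespace Accordion

variable {n : ℕ} {P Q : Finset (Vertex n)} {A B : Finset (Segment n)}

/-! ## Convexity of crossing numbers -/

/-- Three pairwise crossing segments, whose endpoints are met in this order when turning
clockwise. -/
def ClockwiseTriple (δ η ε : Segment n) : Prop :=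
  ∃ x a l y b r : Vertex n, δ = s(x, y) ∧ η = s(a, b) ∧ ε = s(l, r) ∧
    sbtw x a l ∧ sbtw x l y ∧ sbtw x y b ∧ sbtw x b r

lemma clockwiseTriple_mk {x y : Vertex n} {η ε : Segment n} : ClockwiseTriple s(x, y) η ε ↔
    ∃ a l b r : Vertex n, η = s(a, b) ∧ ε = s(l, r) ∧
      sbtw x a l ∧ sbtw x l y ∧ sbtw x y b ∧ sbtw x b r := by
  constructor
  · rintro ⟨x', a, l, y', b, r, h, rfl, rfl, h1, h2, h3, h4⟩
    rcases Sym2.eq_iff.1 h with ⟨rfl, rfl⟩ | ⟨rfl, rfl⟩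
    · exact ⟨a, l, b, r, rfl, rfl, h1, h2, h3, h4⟩
    · refine ⟨b, r, a, l, Sym2.eq_swap, Sym2.eq_swap, ?_⟩
      simp only [sbtw_iff_rk y, rk_self] at *
      omega
  · rintro ⟨a, l, b, r, rfl, rfl, h⟩
    exact ⟨x, a, l, y, b, r, rfl, rfl, rfl, h⟩

lemma ClockwiseTriple.cross_left {δ η ε : Segment n} (h : ClockwiseTriple δ η ε) : Cross δ η := by
  obtain ⟨x, a, l, y, b, r, rfl, rfl, rfl, h1, h2, h3, h4⟩ := h
  rw [cross_iff_rk x, rk_self]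
  rw [sbtw_iff_rk x, rk_self] at *
  unfold RankCross
  omega

lemma ClockwiseTriple.cross_right {δ η ε : Segment n} (h : ClockwiseTriple δ η ε) :
    Cross δ ε := by
  obtain ⟨x, a, l, y, b, r, rfl, rfl, rfl, h1, h2, h3, h4⟩ := h
  rw [cross_iff_rk x, rk_self]
  rw [sbtw_iff_rk x, rk_self] at *
  unfold RankCross
  omega

lemma sum_mul_ind (s : Finset (ℕ × ℕ)) (f : ℕ × ℕ → ℝ) (p : ℕ × ℕ → Prop) [DecidablePred p] :
    ∑ e ∈ s, f e * ind (p e) = ∑ e ∈ s.filter p, f e := by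
  rw [Finset.sum_filter]
  refine Finset.sum_congr rfl fun e _ => ?_
  by_cases h : p e <;> simp [ind, h]

lemma ind_or {p q : Prop} (h : p → ¬ q) : ind (p ∨ q) = ind p + ind q := by
  by_cases hp : p
  · rw [ind_true (Or.inl hp), ind_true hp, ind_false (h hp), add_zero]
  · rw [ind_false hp, zero_add]
    exact ind_congr (or_iff_right hp)

namespace AccordionCut

variable {α β : Vertex n}

lemma sum_cross_mul_of_left (h : AccordionCut P A α β) {u v : Vertex n} (hu : u ∈ P)
    (huv : rk α u < rk α v) (hlt : rk α v < rk α β) :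
    ∑ ε ∈ A, slalomSign P A ε s(α, β) * ind (Cross s(u, v) ε) = 0 := by
  have hu' := (h.alternating.mem_iff_of_notMem h.left_notMem u).1 hu
  refine h.sum_slalomSign_mul (f := fun ε => ind (Cross s(u, v) ε))
    (fun p => ind (rk α u < p ∧ p < rk α v)) ?_ ?_ ?_
  · exact ind_false (by omega)
  · exact ind_false (by omega)
  · intro e he
    have heK := (mem_innerCut.1 he).1
    have h3 := mem_cut.1 heK
    refine ind_congr ?_
    rw [edge, cross_iff_rk α, rk_edge_left heK, rk_edge_right heK]
    unfold RankCross
    omega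

/-- The edges of the cut that cross `ab` form two opposite quadrants of the staircase. Each nonempty
quadrant turns exactly once: `-1` when summed by rows on one, `+1` when summed by columns on the
other. -/
lemma sum_cross_mul_of_cross (h : AccordionCut P A α β) {a b : Vertex n}
    (ha : 0 < rk α a) (ha' : rk α a < rk α β) (hb : rk α β < rk α b) :
    ∑ ε ∈ A, slalomSign P A ε s(α, β) * ind (Cross s(a, b) ε) =
      ind (∃ ε ∈ A, ClockwiseTriple s(α, β) ε s(a, b)) -
        ind (∃ ε ∈ A, ClockwiseTriple s(α, β) s(a, b) ε) := by
  classical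
  have hbn := rk_lt α b
  set p1 : ℕ × ℕ → Prop := fun e => rk α a < e.1 ∧ e.2 < 2 * n - rk α b with hp1
  set p2 : ℕ × ℕ → Prop := fun e => e.1 < rk α a ∧ 2 * n - rk α b < e.2 with hp2
  have hstep : ∀ e ∈ innerCut P A α β,
      slalomSign P A (edge α e) s(α, β) * ind (Cross s(a, b) (edge α e)) =
      rowSign (cut P A α β) e * ind (p1 e) + colSign (cut P A α β) e * ind (p2 e) := by
    intro e he
    have heK := (mem_innerCut.1 he).1
    have h3 := mem_cut.1 heK
    rw [h.slalomSign_eq he, ← h.rowSign_eq_colSign he, ← mul_add]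
    congr 1
    rw [← ind_or]
    · refine ind_congr ?_
      rw [edge, cross_iff_rk α, rk_edge_left heK, rk_edge_right heK, hp1, hp2]
      unfold RankCross
      simp only
      omega
    · simp only [hp1, hp2]; omega
  rw [sum_eq_sum_innerCut (P := P) α β, Finset.sum_congr rfl hstep, Finset.sum_add_distrib,
    sum_mul_ind, sum_mul_ind]
  · have key1 := h.staircase.sum_rowSign_quadrant (rk α a) (2 * n - rk α b)
      (by simp only [cutTop]; omega) (X := (innerCut P A α β).filter p1) (by
        intro e
        rw [Finset.mem_filter, mem_innerCut]
        constructor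
        · rintro ⟨⟨h1, _⟩, h2⟩; exact ⟨h1, h2⟩
        · rintro ⟨h1, h2, h3⟩
          refine ⟨⟨h1, (h.edge_mem_iff h1).2 ⟨?_, ?_⟩⟩, h2, h3⟩
          · rintro rfl; simp only at h2; omega
          · rintro rfl; simp only [cutTop] at h3; omega)
    have key2 := h.staircase.sum_colSign_quadrant (rk α a) (2 * n - rk α b)
      (by simp only [cutTop]; omega) (X := (innerCut P A α β).filter p2) (by
        intro e
        rw [Finset.mem_filter, mem_innerCut]
        constructor
        · rintro ⟨⟨h1, _⟩, h2⟩; exact ⟨h1, h2⟩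
        · rintro ⟨h1, h2, h3⟩
          refine ⟨⟨h1, (h.edge_mem_iff h1).2 ⟨?_, ?_⟩⟩, h2, h3⟩
          · rintro rfl; simp only at h3; omega
          · rintro rfl; simp only [cutTop] at h2; omega)
    rw [key1, key2, neg_add_eq_sub]
    congr 1
    · refine ind_congr ⟨?_, ?_⟩
      · rintro ⟨e, he⟩
        obtain ⟨he, hp⟩ := Finset.mem_filter.1 he
        obtain ⟨heK, heA⟩ := mem_innerCut.1 he
        have h3 := mem_cut.1 heK
        have h4 := rk_edge_left heK
        have h5 := rk_edge_right heK
        refine ⟨_, heA, clockwiseTriple_mk.2 ⟨_, a, _, b, rfl, rfl, ?_⟩⟩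
        simp only [hp2] at hp
        simp only [sbtw_iff_rk α, rk_self]
        rw [h4, h5]
        omega
      · rintro ⟨ε, hε, ht⟩
        obtain ⟨l, a', r, b', rfl, h2, h3⟩ := clockwiseTriple_mk.1 ht
        simp only [sbtw_iff_rk α, rk_self] at h3
        have hab : rk α a' = rk α a ∧ rk α b' = rk α b := by
          rcases Sym2.eq_iff.1 h2 with ⟨rfl, rfl⟩ | ⟨rfl, rfl⟩
          · exact ⟨rfl, rfl⟩
          · omega
        obtain ⟨hK, heq⟩ := mem_cut_of_rk (P := P) (subset_withBoundary hε) (α := α) (β := β)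
          (by omega) (by omega) (by omega)
        exact ⟨_, Finset.mem_filter.2 ⟨mem_innerCut.2 ⟨hK, heq ▸ hε⟩, by
          simp only [hp2]; omega⟩⟩
    · refine ind_congr ⟨?_, ?_⟩
      · rintro ⟨e, he⟩
        obtain ⟨he, hp⟩ := Finset.mem_filter.1 he
        obtain ⟨heK, heA⟩ := mem_innerCut.1 he
        have h3 := mem_cut.1 heK
        have h4 := rk_edge_left heK
        have h5 := rk_edge_right heK
        refine ⟨_, heA, clockwiseTriple_mk.2 ⟨a, _, b, _, rfl, rfl, ?_⟩⟩
        simp only [hp1] at hp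
        simp only [sbtw_iff_rk α, rk_self]
        rw [h4, h5]
        omega
      · rintro ⟨ε, hε, ht⟩
        obtain ⟨a', l, b', r, h2, rfl, h3⟩ := clockwiseTriple_mk.1 ht
        simp only [sbtw_iff_rk α, rk_self] at h3
        have hr := rk_lt α r
        have hab : rk α a' = rk α a ∧ rk α b' = rk α b := by
          rcases Sym2.eq_iff.1 h2 with ⟨rfl, rfl⟩ | ⟨rfl, rfl⟩
          · exact ⟨rfl, rfl⟩
          · omega
        obtain ⟨hK, heq⟩ := mem_cut_of_rk (P := P) (subset_withBoundary hε) (α := α) (β := β)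
          (by omega) (by omega) (by omega)
        exact ⟨_, Finset.mem_filter.2 ⟨mem_innerCut.2 ⟨hK, heq ▸ hε⟩, by
          simp only [hp1]; omega⟩⟩
  · intro ε _ hc
    rw [slalomSign_eq_zero hc, zero_mul]

/-- The sum of the slalom signs over the diagonals of a dissection that cross a given diagonal. -/
lemma sum_cross_mul (h : AccordionCut P A α β) {η : Segment n} (hη : IsDiagonal P η) :
    ∑ ε ∈ A, slalomSign P A ε s(α, β) * ind (Cross η ε) =
      ind (∃ ε ∈ A, ClockwiseTriple s(α, β) ε η) -
        ind (∃ ε ∈ A, ClockwiseTriple s(α, β) η ε) := by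
  induction η using Sym2.ind with
  | h a b =>
    obtain ⟨hab, ha, hb⟩ := isDiagonal_mk.1 hη
    have ha1 := (h.alternating.mem_iff_of_notMem h.left_notMem a).1 ha
    have hb1 := (h.alternating.mem_iff_of_notMem h.left_notMem b).1 hb
    have hm := h.rk_even
    by_cases hc : Cross s(α, β) s(a, b)
    · have hc' := hc
      rw [cross_iff_rk α, rk_self] at hc'
      by_cases hlt : rk α a < rk α β
      · refine h.sum_cross_mul_of_cross (by omega) hlt ?_
        unfold RankCross at hc'; omega
      · rw [Sym2.eq_swap (a := a)]
        refine h.sum_cross_mul_of_cross (by omega) ?_ ?_ <;>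
        · unfold RankCross at hc'; omega
    · rw [ind_false (p := ∃ ε ∈ A, ClockwiseTriple s(α, β) ε s(a, b)),
        ind_false (p := ∃ ε ∈ A, ClockwiseTriple s(α, β) s(a, b) ε), sub_zero]
      · have key : ∀ {α β : Vertex n}, AccordionCut P A α β → rk α a < rk α β →
            rk α b < rk α β → ∑ ε ∈ A, slalomSign P A ε s(α, β) * ind (Cross s(a, b) ε) = 0 := by
          intro α β h h1 h2
          rcases lt_or_gt_of_ne (rk_ne (α := α) hab) with hlt | hlt
          · exact h.sum_cross_mul_of_left ha hlt h2
          · rw [Sym2.eq_swap (a := a)]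
            exact h.sum_cross_mul_of_left hb hlt h1
        by_cases hl : rk α a < rk α β ∧ rk α b < rk α β
        · exact key h hl.1 hl.2
        · rw [cross_iff_rk α, rk_self] at hc
          have hl' : rk α β < rk α a ∧ rk α β < rk α b := by
            unfold RankCross at hc; omega
          have hrk : ∀ w, rk α β < rk α w → rk β w < rk β α := by
            intro w hw
            have := α.2; have := β.2; have := w.2
            have : α.val ≠ β.val := fun hh => h.ne (Fin.ext hh)
            unfold rk at hw ⊢
            split_ifs at hw ⊢ <;> omega
          rw [Sym2.eq_swap (a := α)]
          exact key h.symm (hrk a hl'.1) (hrk b hl'.2)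
      · rintro ⟨ε, _, ht⟩; exact hc ht.cross_left
      · rintro ⟨ε, _, ht⟩; exact hc ht.cross_right

/-! ### Clockwise triples along a cut -/

lemma clockwiseTriple_edge {p q : ℕ} (he : (p, q) ∈ cut P A α β) {η ε : Segment n} :
    ClockwiseTriple (edge α (p, q)) η ε ↔ ∃ a l b r : Vertex n, η = s(a, b) ∧ ε = s(l, r) ∧
      (p < rk α a ∧ rk α a < rk α l ∧ rk α l < 2 * n - q) ∧
      ((2 * n - q < rk α b ∧ (rk α b < rk α r ∨ rk α r < p)) ∨
        (rk α b < rk α r ∧ rk α r < p)) := by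
  have h1 := rk_edge_left he
  have h2 := rk_edge_right he
  have h3 := mem_cut.1 he
  simp only at h1 h2 h3
  rw [edge, clockwiseTriple_mk]
  simp only [sbtw_iff_rk α, h1, h2]
  refine exists_congr fun a => exists_congr fun l => exists_congr fun b => exists_congr fun r => ?_
  refine and_congr_right fun _ => and_congr_right fun _ => ?_
  omega

lemma cross_edge {p q : ℕ} (he : (p, q) ∈ cut P A α β) {a b : Vertex n} :
    Cross (edge α (p, q)) s(a, b) ↔
      (p < rk α a ∧ rk α a < 2 * n - q ∧ (rk α b < p ∨ 2 * n - q < rk α b)) ∨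
        (p < rk α b ∧ rk α b < 2 * n - q ∧ (rk α a < p ∨ 2 * n - q < rk α a)) := by
  have h1 := rk_edge_left he
  have h2 := rk_edge_right he
  have h3 := mem_cut.1 he
  simp only at h1 h2 h3
  rw [edge, cross_iff_rk α, h1, h2]
  unfold RankCross
  omega

/-- When the edge rotates about its fixed endpoint, the moving endpoint meets `η` before `ε`; as
long as `η` is crossed, the triple survives. The next three lemmas hold for the same reason. -/
lemma clockwiseTriple_row_left {p q r : ℕ} (he : (p, q) ∈ cut P A α β)
    (hf : (p, r) ∈ cut P A α β) (hlt : r < q) {η ε : Segment n}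
    (hc : Cross (edge α (p, r)) η) (ht : ClockwiseTriple (edge α (p, q)) η ε) :
    ClockwiseTriple (edge α (p, r)) η ε := by
  rw [clockwiseTriple_edge he] at ht
  rw [clockwiseTriple_edge hf]
  obtain ⟨a, l, b, s, rfl, rfl, h3⟩ := ht
  rw [cross_edge hf] at hc
  have := mem_cut.1 he; have := mem_cut.1 hf
  exact ⟨a, l, b, s, rfl, rfl, by omega⟩

lemma clockwiseTriple_col_left {p q r : ℕ} (he : (p, q) ∈ cut P A α β)
    (hf : (r, q) ∈ cut P A α β) (hlt : p < r) {η ε : Segment n}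
    (hc : Cross (edge α (r, q)) η) (ht : ClockwiseTriple (edge α (p, q)) η ε) :
    ClockwiseTriple (edge α (r, q)) η ε := by
  rw [clockwiseTriple_edge he] at ht
  rw [clockwiseTriple_edge hf]
  obtain ⟨a, l, b, s, rfl, rfl, h3⟩ := ht
  rw [cross_edge hf] at hc
  have := mem_cut.1 he; have := mem_cut.1 hf
  exact ⟨a, l, b, s, rfl, rfl, by omega⟩

lemma clockwiseTriple_row_right {p q r : ℕ} (he : (p, q) ∈ cut P A α β)
    (hf : (p, r) ∈ cut P A α β) (hlt : q < r) {η ε : Segment n}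
    (hc : Cross (edge α (p, r)) η) (ht : ClockwiseTriple (edge α (p, q)) ε η) :
    ClockwiseTriple (edge α (p, r)) ε η := by
  rw [clockwiseTriple_edge he] at ht
  rw [clockwiseTriple_edge hf]
  obtain ⟨a, l, b, s, rfl, rfl, h3⟩ := ht
  rw [cross_edge hf] at hc
  have := mem_cut.1 he; have := mem_cut.1 hf
  exact ⟨a, l, b, s, rfl, rfl, by omega⟩

lemma clockwiseTriple_col_right {p q r : ℕ} (he : (p, q) ∈ cut P A α β)
    (hf : (r, q) ∈ cut P A α β) (hlt : r < p) {η ε : Segment n}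
    (hc : Cross (edge α (r, q)) η) (ht : ClockwiseTriple (edge α (p, q)) ε η) :
    ClockwiseTriple (edge α (r, q)) ε η := by
  rw [clockwiseTriple_edge he] at ht
  rw [clockwiseTriple_edge hf]
  obtain ⟨a, l, b, s, rfl, rfl, h3⟩ := ht
  rw [cross_edge hf] at hc
  have := mem_cut.1 he; have := mem_cut.1 hf
  exact ⟨a, l, b, s, rfl, rfl, by omega⟩

/-- The extreme edges cut off only `α` or only `β`, whereas a triple needs two endpoints strictly on
each side. -/
lemma mem_innerCut_of_clockwiseTriple (h : AccordionCut P A α β) {e : ℕ × ℕ}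
    (he : e ∈ cut P A α β) {η ε : Segment n} (ht : ClockwiseTriple (edge α e) η ε) :
    e ∈ innerCut P A α β := by
  have hm := h.rk_even
  obtain ⟨p, q⟩ := e
  refine mem_innerCut.2 ⟨he, (h.edge_mem_iff he).2 ⟨fun heq => ?_, fun heq => ?_⟩⟩
  · obtain ⟨a, l, b, r, _, _, h3⟩ := (clockwiseTriple_edge he).1 ht
    have e1 : p = 1 := congrArg Prod.fst heq
    have e2 : q = 1 := congrArg Prod.snd heq
    have := rk_lt α b; have := rk_lt α r
    omega
  · obtain ⟨a, l, b, r, _, _, h3⟩ := (clockwiseTriple_edge he).1 ht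
    have e1 : p = rk α β - 1 := congrArg Prod.fst heq
    have e2 : q = 2 * n - rk α β - 1 := congrArg Prod.snd heq
    omega

/-- One endpoint of `ab` lies on the `α` side of `e` and the other on the `β` side of `g`, so `f`
separates them. This is the order-convexity of the set of crossed edges. -/
lemma cross_of_between (h : AccordionCut P A α β) {a b : Vertex n} {e f g : ℕ × ℕ}
    (hf : f ∈ cut P A α β) (ha : a ∉ P) (hb : b ∉ P) (he : e ∈ cut P A α β)
    (hg : g ∈ cut P A α β) (hef : e ≤ f) (hfg : f ≤ g) (hce : Cross (edge α e) s(a, b))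
    (hcg : Cross (edge α g) s(a, b)) : Cross (edge α f) s(a, b) := by
  have hP := h.alternating.mem_iff_of_notMem h.left_notMem
  have ha2 := (hP a).not.1 ha
  have hb2 := (hP b).not.1 hb
  have ho := h.odd hf
  have := mem_cut.1 he; have := mem_cut.1 hf; have := mem_cut.1 hg
  obtain ⟨p1, q1⟩ := e
  obtain ⟨p2, q2⟩ := f
  obtain ⟨p3, q3⟩ := g
  rw [cross_edge he] at hce
  rw [cross_edge hg] at hcg
  rw [cross_edge hf]
  simp only [Prod.mk_le_mk] at *
  omega

/-- A segment that stops crossing the edges of a cut along a row has an endpoint on the right. -/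
lemma right_of_row (h : AccordionCut P A α β) {a b : Vertex n} (ha : a ∉ P) (hb : b ∉ P)
    {p q r : ℕ} (he : (p, q) ∈ cut P A α β) (hf : (p, r) ∈ cut P A α β)
    (hc : Cross (edge α (p, q)) s(a, b)) (hnc : ¬ Cross (edge α (p, r)) s(a, b)) :
    ∃ c ∈ s(a, b), rk α β < rk α c ∧ ((2 * n - q < rk α c ∧ rk α c < 2 * n - r) ∨
      (2 * n - r < rk α c ∧ rk α c < 2 * n - q)) := by
  have hP := h.alternating.mem_iff_of_notMem h.left_notMem
  have ha2 := (hP a).not.1 ha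
  have hb2 := (hP b).not.1 hb
  have ho := h.odd he
  have ho' := h.odd hf
  have := mem_cut.1 he; have := mem_cut.1 hf
  rw [cross_edge he] at hc
  rw [cross_edge hf] at hnc
  by_cases hca : rk α β < rk α a ∧ ((2 * n - q < rk α a ∧ rk α a < 2 * n - r) ∨
      (2 * n - r < rk α a ∧ rk α a < 2 * n - q))
  · exact ⟨a, by simp, hca⟩
  · refine ⟨b, by simp, ?_⟩
    simp only at *
    omega

lemma left_of_col (h : AccordionCut P A α β) {a b : Vertex n} (ha : a ∉ P) (hb : b ∉ P)
    {p q r : ℕ} (he : (p, q) ∈ cut P A α β) (hf : (r, q) ∈ cut P A α β)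
    (hc : Cross (edge α (p, q)) s(a, b)) (hnc : ¬ Cross (edge α (r, q)) s(a, b)) :
    ∃ c ∈ s(a, b), 0 < rk α c ∧ rk α c < rk α β ∧ ((p < rk α c ∧ rk α c < r) ∨
      (r < rk α c ∧ rk α c < p)) := by
  have hP := h.alternating.mem_iff_of_notMem h.left_notMem
  have ha2 := (hP a).not.1 ha
  have hb2 := (hP b).not.1 hb
  have ho := h.odd he
  have ho' := h.odd hf
  have := mem_cut.1 he; have := mem_cut.1 hf
  rw [cross_edge he] at hc
  rw [cross_edge hf] at hnc
  by_cases hca : 0 < rk α a ∧ rk α a < rk α β ∧ ((p < rk α a ∧ rk α a < r) ∨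
      (r < rk α a ∧ rk α a < p))
  · exact ⟨a, by simp, hca⟩
  · refine ⟨b, by simp, ?_⟩
    simp only at *
    omega

lemma cross_of_sides {a b c d : Vertex n} (hc : c ∈ s(a, b)) (hd : d ∈ s(a, b))
    (h0 : 0 < rk α c) (h1 : rk α c < rk α β) (h2 : rk α β < rk α d) :
    Cross s(a, b) s(α, β) := by
  rw [cross_iff_rk α, rk_self]
  rw [Sym2.mem_iff] at hc hd
  unfold RankCross
  rcases hc with rfl | rfl <;> rcases hd with rfl | rfl <;> omega

/-- The slalom signs of an accordion, summed over the diagonals that form clockwise triples with a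
given diagonal. -/
lemma sum_triple_le (h : AccordionCut P A α β) {a b : Vertex n} (ha : a ∉ P) (hb : b ∉ P)
    (E : Finset (Segment n)) :
    ∑ δ ∈ A, slalomSign P A δ s(α, β) * (ind (∃ ε ∈ E, ClockwiseTriple δ s(a, b) ε) -
      ind (∃ ε ∈ E, ClockwiseTriple δ ε s(a, b))) ≤ ind (Cross s(a, b) s(α, β)) := by
  classical
  set K := cut P A α β with hK
  -- Inside the order-convex part `H` crossed by `ab`, the set `I` is closed under moves down rows
  -- and up columns, and `J` under the opposite moves; reflecting the staircase treats `J` like `I`.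
  set H := K.filter fun e => Cross (edge α e) s(a, b) with hH
  set I := (innerCut P A α β).filter fun e =>
    ∃ ε ∈ E, ClockwiseTriple (edge α e) s(a, b) ε with hI
  set J := (innerCut P A α β).filter fun e =>
    ∃ ε ∈ E, ClockwiseTriple (edge α e) ε s(a, b) with hJ
  have mH : ∀ e, e ∈ H ↔ e ∈ K ∧ Cross (edge α e) s(a, b) := fun _ => Finset.mem_filter
  have mI : ∀ e, e ∈ I ↔ e ∈ K ∧ ∃ ε ∈ E, ClockwiseTriple (edge α e) s(a, b) ε := by
    intro e
    rw [hI, Finset.mem_filter]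
    refine ⟨fun ⟨h1, h2⟩ => ⟨(mem_innerCut.1 h1).1, h2⟩, fun ⟨h1, h2⟩ => ⟨?_, h2⟩⟩
    obtain ⟨ε, _, ht⟩ := h2
    exact h.mem_innerCut_of_clockwiseTriple h1 ht
  have mJ : ∀ e, e ∈ J ↔ e ∈ K ∧ ∃ ε ∈ E, ClockwiseTriple (edge α e) ε s(a, b) := by
    intro e
    rw [hJ, Finset.mem_filter]
    refine ⟨fun ⟨h1, h2⟩ => ⟨(mem_innerCut.1 h1).1, h2⟩, fun ⟨h1, h2⟩ => ⟨?_, h2⟩⟩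
    obtain ⟨ε, _, ht⟩ := h2
    exact h.mem_innerCut_of_clockwiseTriple h1 ht
  have hIH : I ⊆ H := fun e he => by
    obtain ⟨h1, ε, _, h2⟩ := (mI e).1 he
    exact (mH e).2 ⟨h1, h2.cross_left⟩
  have hJH : J ⊆ H := fun e he => by
    obtain ⟨h1, ε, _, h2⟩ := (mJ e).1 he
    exact (mH e).2 ⟨h1, h2.cross_right⟩
  have hHK : H ⊆ K := Finset.filter_subset _ _
  have hconv : ∀ e ∈ H, ∀ f ∈ K, ∀ g ∈ H, e ≤ f → f ≤ g → f ∈ H := fun e he f hf g hg h1 h2 =>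
    (mH f).2 ⟨hf, h.cross_of_between hf ha hb ((mH e).1 he).1 ((mH g).1 hg).1 h1 h2
      ((mH e).1 he).2 ((mH g).1 hg).2⟩
  have keyI := h.staircase.sum_rowSign_le_one hHK hIH hconv (fun p q r hpq hpr hlt => by
    obtain ⟨h1, ε, hε, h2⟩ := (mI _).1 hpq
    obtain ⟨h3, h4⟩ := (mH _).1 hpr
    exact (mI _).2 ⟨h3, ε, hε, clockwiseTriple_row_left h1 h3 hlt h4 h2⟩)
  have keyI' := Staircase.exists_of_sum_colSign_pos hHK hIH (fun p q r hpq hpr hlt => by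
    obtain ⟨h1, ε, hε, h2⟩ := (mI _).1 hpq
    obtain ⟨h3, h4⟩ := (mH _).1 hpr
    exact (mI _).2 ⟨h3, ε, hε, clockwiseTriple_col_left h1 h3 hlt h4 h2⟩)
  have keyJ := h.staircase.reflect.sum_rowSign_le_one (H := reflect H) (I := reflect J)
    (fun e he => mem_reflect.2 (hHK (mem_reflect.1 he)))
    (fun e he => mem_reflect.2 (hJH (mem_reflect.1 he)))
    (fun e he f hf g hg h1 h2 => mem_reflect.2 (hconv _ (mem_reflect.1 he) _ (mem_reflect.1 hf) _
      (mem_reflect.1 hg) ⟨h1.2, h1.1⟩ ⟨h2.2, h2.1⟩))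
    (fun p q r hpq hpr hlt => by
      rw [mem_reflect, Prod.swap_prod_mk] at hpq hpr ⊢
      obtain ⟨h1, ε, hε, h2⟩ := (mJ _).1 hpq
      obtain ⟨h3, h4⟩ := (mH _).1 hpr
      exact (mJ _).2 ⟨h3, ε, hε, clockwiseTriple_col_right h1 h3 hlt h4 h2⟩)
  have keyJ' := Staircase.exists_of_sum_colSign_pos (K := reflect K) (H := reflect H) (I := reflect J)
    (fun e he => mem_reflect.2 (hHK (mem_reflect.1 he)))
    (fun e he => mem_reflect.2 (hJH (mem_reflect.1 he))) (fun p q r hpq hpr hlt => by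
      rw [mem_reflect, Prod.swap_prod_mk] at hpq hpr ⊢
      obtain ⟨h1, ε, hε, h2⟩ := (mJ _).1 hpq
      obtain ⟨h3, h4⟩ := (mH _).1 hpr
      exact (mJ _).2 ⟨h3, ε, hε, clockwiseTriple_row_right h1 h3 hlt h4 h2⟩)
  simp only [sum_reflect, rowSign_reflect, colSign_reflect, mem_reflect, Prod.swap_prod_mk]
    at keyJ keyJ'
  rw [Finset.sum_congr rfl fun e he => by
    rw [← h.rowSign_eq_colSign (Finset.mem_filter.1 he).1]] at keyJ
  rw [Finset.sum_congr (s₁ := I) rfl fun e he => by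
    rw [← h.rowSign_eq_colSign (Finset.mem_filter.1 he).1]] at keyI'
  have hsum : ∑ δ ∈ A, slalomSign P A δ s(α, β) *
      (ind (∃ ε ∈ E, ClockwiseTriple δ s(a, b) ε) - ind (∃ ε ∈ E, ClockwiseTriple δ ε s(a, b))) =
      ∑ e ∈ I, rowSign K e + ∑ e ∈ J, -rowSign K e := by
    rw [sum_eq_sum_innerCut (P := P) α β]
    · rw [Finset.sum_neg_distrib, ← sub_eq_add_neg, hI, hJ, ← sum_mul_ind, ← sum_mul_ind,
        ← Finset.sum_sub_distrib]
      exact Finset.sum_congr rfl fun e he => by rw [h.slalomSign_eq he, mul_sub]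
    · intro δ _ hc
      rw [slalomSign_eq_zero hc, zero_mul]
  rw [hsum]
  -- Read by rows, a positive sum makes `K` leave `H` along a row, so `ab` has an end on the right
  -- of `αβ`. Read by columns, it gives an end on the left.
  have crossI : 0 < ∑ e ∈ I, rowSign K e → Cross s(a, b) s(α, β) := by
    intro hpos
    obtain ⟨p, q, r, h1, h2, h3, h4⟩ := keyI.2 hpos
    obtain ⟨p', q', r', h1', h2', h3', h4'⟩ := keyI' hpos
    obtain ⟨d, hd, hd1, -⟩ := h.right_of_row ha hb (hHK (hIH h1)) h2 ((mH _).1 (hIH h1)).2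
      fun hh => h4 ((mH _).2 ⟨h2, hh⟩)
    obtain ⟨c, hc, hc1, hc2, -⟩ := h.left_of_col ha hb (hHK (hIH h1')) h2'
      ((mH _).1 (hIH h1')).2 fun hh => h4' ((mH _).2 ⟨h2', hh⟩)
    exact cross_of_sides hc hd hc1 hc2 hd1
  have crossJ : 0 < ∑ e ∈ J, -rowSign K e → Cross s(a, b) s(α, β) := by
    intro hpos
    obtain ⟨q, p, r, h1, h2, h3, h4⟩ := keyJ.2 hpos
    obtain ⟨q', p', r', h1', h2', h3', h4'⟩ := keyJ' hpos
    obtain ⟨c, hc, hc1, hc2, -⟩ := h.left_of_col ha hb (hHK (hJH h1)) h2 ((mH _).1 (hJH h1)).2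
      fun hh => h4 ((mH _).2 ⟨h2, hh⟩)
    obtain ⟨d, hd, hd1, -⟩ := h.right_of_row ha hb (hHK (hJH h1')) h2'
      ((mH _).1 (hJH h1')).2 fun hh => h4' ((mH _).2 ⟨h2', hh⟩)
    exact cross_of_sides hc hd hc1 hc2 hd1
  by_cases hcross : Cross s(a, b) s(α, β)
  · rw [ind_true hcross]
    by_cases hpI : 0 < ∑ e ∈ I, rowSign K e
    · by_cases hpJ : 0 < ∑ e ∈ J, -rowSign K e
      -- `I` gives an edge `(p, q)` with `d` on its `α` side and `c` beyond it; `J` gives `(p', q')`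
      -- with `c` on its `α` side and `d` beyond it. These two edges would be ordered oppositely on
      -- the two sides of `αβ`.
      · exfalso
        obtain ⟨p, q, r, h1, h2, h3, h4⟩ := keyI.2 hpI
        obtain ⟨q', p', r', h1', h2', h3', h4'⟩ := keyJ.2 hpJ
        obtain ⟨d, hd, hd1, hd2⟩ := h.right_of_row ha hb (hHK (hIH h1)) h2
          ((mH _).1 (hIH h1)).2 fun hh => h4 ((mH _).2 ⟨h2, hh⟩)
        obtain ⟨c, hc, hc1, hc2, hc3⟩ := h.left_of_col ha hb (hHK (hJH h1')) h2'
          ((mH _).1 (hJH h1')).2 fun hh => h4' ((mH _).2 ⟨h2', hh⟩)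
        have x1 := ((mH _).1 (hIH h1)).2
        have x2 := ((mH _).1 (hJH h1')).2
        have hcd : s(a, b) = s(c, d) := by
          have hne : c ≠ d := by rintro rfl; omega
          rw [Sym2.mem_iff] at hc hd
          rcases hc with rfl | rfl <;> rcases hd with rfl | rfl
          · exact absurd rfl hne
          · rfl
          · exact Sym2.eq_swap
          · exact absurd rfl hne
        rw [hcd] at x1 x2
        have y1 := hHK (hIH h1)
        have y2 := hHK (hJH h1')
        rw [cross_edge y1] at x1
        rw [cross_edge y2] at x2
        have z1 := mem_cut.1 y1
        have z2 := mem_cut.1 y2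
        have z3 := mem_cut.1 h2
        have hmono := cut_mono h.dissection y1 y2
        simp only at z1 z2 z3 hmono
        omega
      · linarith [keyI.1]
    · linarith [keyJ.1]
  · have hI0 := not_lt.1 (mt crossI hcross)
    have hJ0 := not_lt.1 (mt crossJ hcross)
    rw [ind_false hcross]
    linarith

end AccordionCut

end Accordion

end

noncomputable section

namespace Accordion

variable {n : ℕ} {D E : Finset (Segment n)}

/-! ## Accordion diagonals and their recombination -/

lemma not_cross_refl (e : Segment n) : ¬ Cross e e := by
  induction e using Sym2.ind with
  | h x y =>
    rw [cross_iff_rk x]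
    unfold RankCross
    omega

lemma rk_change_base (α β w : Vertex n) :
    rk β w = if rk α β ≤ rk α w then rk α w - rk α β else rk α w + 2 * n - rk α β := by
  have := α.2; have := β.2; have := w.2
  unfold rk
  split_ifs <;> omega

/-- A solid boundary edge cuts off a single hollow vertex, and all the edges it crosses meet there.
-/
lemma isAccordionDiagonal_of_isBoundaryEdge (D : Finset (Segment n)) {γ : Segment n}
    (h : IsBoundaryEdge (solidPolygon n) γ) : IsAccordionDiagonal D γ := by
  refine ⟨h.1, ?_⟩
  have key : ∃ x y : Vertex n, γ = s(x, y) ∧ rk x y = 2 := by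
    induction γ using Sym2.ind with
    | h x y =>
      by_contra hc
      push Not at hc
      obtain ⟨hne, hx, hy⟩ := isDiagonal_mk.1 h.1
      have h1 := hc x y rfl
      have h2 := hc y x Sym2.eq_swap
      rw [rk_swap hne] at h2
      have hP := alternating_solid.mem_iff_of_mem hx
      have h3 := (hP y).1 hy
      have h4 := rk_ne (α := x) hne
      have h5 := rk_lt x y
      rw [rk_self] at h4
      refine h.2 (vtx x 2) ?_ (vtx x (rk x y + 2)) ?_ ?_
      · rw [hP, rk_vtx x (by omega)]
      · rw [hP, rk_vtx x (by omega)]; omega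
      · rw [cross_iff_rk x, rk_self, rk_vtx x (by omega), rk_vtx x (by omega)]
        unfold RankCross
        omega
  obtain ⟨x, y, rfl, hxy⟩ := key
  have hmem : ∀ e ∈ crossedBy (hollowPolygon n) D s(x, y), vtx x 1 ∈ e := by
    rintro e ⟨-, hc⟩
    induction e using Sym2.ind with
    | h a b =>
      rw [cross_iff_rk x, rk_self, hxy] at hc
      have : rk x a = 1 ∨ rk x b = 1 := by unfold RankCross at hc; omega
      rcases this with h1 | h1
      · rw [← eq_vtx_of_rk_eq h1]; simp
      · rw [← eq_vtx_of_rk_eq h1]; simp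
  intro e he f hf
  exact Relation.ReflTransGen.single ⟨he, hf, _, hmem e he, hmem f hf⟩

/-- Adjacency in a set of segments. -/
def SharesEndpoint (Z : Set (Segment n)) (e f : Segment n) : Prop :=
  e ∈ Z ∧ f ∈ Z ∧ ∃ v, v ∈ e ∧ v ∈ f

lemma SharesEndpoint.symm {Z : Set (Segment n)} {e f : Segment n} (h : SharesEndpoint Z e f) :
    SharesEndpoint Z f e :=
  let ⟨he, hf, v, hve, hvf⟩ := h
  ⟨hf, he, v, hvf, hve⟩

lemma reflTransGen_sharesEndpoint_symm {Z : Set (Segment n)} {e f : Segment n}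
    (h : Relation.ReflTransGen (SharesEndpoint Z) e f) :
    Relation.ReflTransGen (SharesEndpoint Z) f e := by
  induction h with
  | refl => exact .refl
  | tail _ h ih => exact ih.head h.symm

lemma isConnectedSet_of_forall {Z : Set (Segment n)} (δ : Segment n)
    (h : ∀ e ∈ Z, Relation.ReflTransGen (SharesEndpoint Z) e δ) : IsConnectedSet Z :=
  fun e he f hf => (h e he).trans (reflTransGen_sharesEndpoint_symm (h f hf))

lemma IsAccordionDiagonal.accordionCut (hn : 3 ≤ n) (hD : IsDissection (hollowPolygon n) D)
    {l r : Vertex n} (h : IsAccordionDiagonal D s(l, r)) :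
    AccordionCut (hollowPolygon n) D l r := by
  obtain ⟨h1, h2, h3⟩ := isDiagonal_mk.1 h.1
  exact ⟨hn, alternating_hollow, hD, mem_solid_iff.1 h2, mem_solid_iff.1 h3, h1, h.2⟩

/-- The part of an accordion before a diagonal `ab` connects all of its edges to `ab`. -/
lemma AccordionCut.reflTransGen {P : Finset (Vertex n)} {l r r' a b : Vertex n}
    (h : AccordionCut P D l r) (hδ : s(a, b) ∈ withBoundary P D) (ha : 0 < rk l a)
    (har : rk l a < rk l r) (har' : rk l a < rk l r') (hrb : rk l r < rk l b)
    (hrb' : rk l r' < rk l b) {x y : Vertex n} (hd : s(x, y) ∈ withBoundary P D)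
    (hx : 0 < rk l x) (hxa : rk l x ≤ rk l a) (hby : rk l b ≤ rk l y) :
    Relation.ReflTransGen (SharesEndpoint (crossedBy P D s(l, r'))) s(x, y) s(a, b) := by
  have hbn := rk_lt l b; have hyn := rk_lt l y
  obtain ⟨hδK, hδe⟩ := mem_cut_of_rk hδ ha har hrb
  obtain ⟨hdK, hde⟩ := mem_cut_of_rk hd hx (by omega) (by omega) (α := l) (β := r)
  rw [← hδe, ← hde]
  set f : ℕ × ℕ := (rk l a, 2 * n - rk l b) with hf
  -- Up to `ab`, every edge of the cut separates `l` from both `r` and `r'`.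
  have hcross : ∀ e ∈ cut P D l r, e ≤ f → edge l e ∈ crossedBy P D s(l, r') := by
    intro e he hef
    have h1 := mem_cut.1 he
    refine ⟨h1.2.2, ?_⟩
    obtain ⟨h2, h3⟩ := hef
    simp only [hf] at h2 h3
    rw [edge, cross_iff_rk l, rk_edge_left he, rk_edge_right he, rk_self]
    unfold RankCross
    omega
  have key : ∀ k, ∀ e ∈ cut P D l r, e ≤ f → f.1 + f.2 - (e.1 + e.2) = k →
      Relation.ReflTransGen (SharesEndpoint (crossedBy P D s(l, r'))) (edge l e) (edge l f) := by
    intro k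
    induction k using Nat.strong_induction_on with
    | _ k ih =>
      intro e he hef hk
      by_cases heq : e = f
      · rw [heq]
      · have hlt : e.1 < f.1 ∨ e.2 < f.2 := by
          by_contra hc
          push Not at hc
          exact heq (le_antisymm hef ⟨hc.1, hc.2⟩)
        have hef1 : e.1 ≤ f.1 := hef.1
        have hef2 : e.2 ≤ f.2 := hef.2
        have hnt : e ≠ cutTop l r := by
          rintro rfl
          exact heq (le_antisymm hef (AccordionCut.le_top hδK))
        have hnext : ∃ e' ∈ cut P D l r, e' ≤ f ∧ e.1 + e.2 < e'.1 + e'.2 ∧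
            (e.1 = e'.1 ∨ e.2 = e'.2) := by
          -- A step that overshoots `f` forces `e` and `f` to share a coordinate, so one can jump to
          -- `f` directly.
          rcases h.staircase.up e he hnt with ⟨q, hq, hqK⟩ | ⟨p, hp, hpK⟩
          · by_cases hqf : q ≤ f.2
            · exact ⟨(e.1, q), hqK, ⟨hef1, hqf⟩, by simp only; omega, Or.inl rfl⟩
            · have := h.staircase.mono' hδK hqK (by simp only; omega)
              simp only at this
              have h1 : (rk l a, 2 * n - rk l b).1 = f.1 := rfl
              exact ⟨f, hδK, le_rfl, by omega, Or.inl (by omega)⟩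
          · by_cases hpf : p ≤ f.1
            · exact ⟨(p, e.2), hpK, ⟨hpf, hef2⟩, by simp only; omega, Or.inr rfl⟩
            · have := h.staircase.mono _ hδK _ hpK (by simp only; omega)
              simp only at this
              have h1 : (rk l a, 2 * n - rk l b).2 = f.2 := rfl
              exact ⟨f, hδK, le_rfl, by omega, Or.inr (by omega)⟩
        obtain ⟨e', he', hef', hsum, hshare⟩ := hnext
        have h1 : e'.1 ≤ f.1 := hef'.1
        have h2 : e'.2 ≤ f.2 := hef'.2
        exact Relation.ReflTransGen.head
          ⟨hcross e he hef, hcross e' he' hef', (share_iff he he').2 hshare⟩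
          (ih _ (by omega) e' he' hef' rfl)
  exact key _ _ hdK ⟨hxa, by simp only [hf]; omega⟩ rfl

lemma rk_change_base_of_le {α β w : Vertex n} (h : rk α β ≤ rk α w) :
    rk β w = rk α w - rk α β := by
  rw [rk_change_base α, if_pos h]

lemma rk_change_base_of_lt {α β w : Vertex n} (h : rk α w < rk α β) :
    rk β w = rk α w + 2 * n - rk α β := by
  rw [rk_change_base α, if_neg (by omega)]

/-- Two accordions that cross a common diagonal can be recombined. -/
lemma IsAccordionDiagonal.recombine (hn : 3 ≤ n) (hD : IsDissection (hollowPolygon n) D)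
    {a b l₁ r₁ l₂ r₂ : Vertex n} (hδ : s(a, b) ∈ D) (h₁ : IsAccordionDiagonal D s(l₁, r₁))
    (h₂ : IsAccordionDiagonal D s(l₂, r₂)) (hl₁ : 0 < rk a l₁) (hl₁' : rk a l₁ < rk a b)
    (hr₁ : rk a b < rk a r₁) (hl₂ : 0 < rk a l₂) (hl₂' : rk a l₂ < rk a b)
    (hr₂ : rk a b < rk a r₂) : IsAccordionDiagonal D s(l₁, r₂) := by
  obtain ⟨-, hl₁S, -⟩ := isDiagonal_mk.1 h₁.1
  obtain ⟨-, -, hr₂S⟩ := isDiagonal_mk.1 h₂.1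
  refine ⟨isDiagonal_mk.2 ⟨?_, hl₁S, hr₂S⟩, isConnectedSet_of_forall s(a, b) ?_⟩
  · rintro rfl; omega
  have hδ' := subset_withBoundary (P := hollowPolygon n) hδ
  have hb := rk_lt a b; have hr₁n := rk_lt a r₁; have hr₂n := rk_lt a r₂
  have ha := rk_self a
  have key : ∀ x y, s(x, y) ∈ crossedBy (hollowPolygon n) D s(l₁, r₂) →
      rk a l₁ < rk a x → rk a x < rk a r₂ → (rk a r₂ < rk a y ∨ rk a y < rk a l₁) →
      Relation.ReflTransGen (SharesEndpoint (crossedBy (hollowPolygon n) D s(l₁, r₂)))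
        s(x, y) s(a, b) := by
    rintro x y ⟨hd, -⟩ hlx hxr hy
    have hnc := hD.not_cross hd hδ'
    have hyn := rk_lt a y
    rw [cross_iff_rk a] at hnc
    -- An edge crossed by `l₁r₂` does not cross `ab`. On the side of `l₁` the accordion `l₁r₁`
    -- connects it to `ab`, on the side of `r₂` the accordion `l₂r₂` does.
    by_cases hnear : rk a x ≤ rk a b ∧ rk a y < rk a l₁
    · rw [Sym2.eq_swap (a := a)] at hδ' ⊢
      have hxl := rk_change_base_of_le hlx.le
      have hbl := rk_change_base_of_le hl₁'.le
      have har := rk_change_base_of_le (hl₁'.trans hr₁).le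
      have har' := rk_change_base_of_le (hl₁'.trans hr₂).le
      have hal := rk_change_base_of_lt (ha.trans_lt hl₁)
      have hyl : rk l₁ a ≤ rk l₁ y := by
        rw [rk_change_base_of_lt hnear.2]
        omega
      exact (h₁.accordionCut hn hD).reflTransGen hδ' (by omega) (by omega) (by omega) (by omega)
        (by omega) hd (by omega) (by omega) hyl
    · have hy' : rk a b ≤ rk a x ∧ (rk a r₂ < rk a y ∨ rk a y = 0) := by
        unfold RankCross at hnc
        omega
      rw [Sym2.eq_swap (a := l₁), Sym2.eq_swap (a := x)]
      rw [Sym2.eq_swap (a := x)] at hd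
      have h₂' := h₂
      rw [Sym2.eq_swap] at h₂'
      have hxl := rk_change_base_of_lt hxr
      have hbl := rk_change_base_of_lt hr₂
      have har := rk_change_base_of_lt (hl₁'.trans hr₂)
      have har' := rk_change_base_of_lt (hl₂'.trans hr₂)
      have hal := rk_change_base_of_lt (ha.trans_lt ((Nat.zero_le _).trans_lt hr₂))
      have hyl : 0 < rk r₂ y ∧ rk r₂ y ≤ rk r₂ a := by
        rw [rk_change_base a r₂ y]
        split_ifs <;> omega
      exact (h₂'.accordionCut hn hD).reflTransGen hδ' (by omega) (by omega) (by omega) (by omega)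
        (by omega) hd hyl.1 hyl.2 (by omega)
  intro d hd
  induction d using Sym2.ind with
  | h x y =>
    have hc := hd.2
    rw [cross_iff_rk a] at hc
    by_cases hxy : rk a l₁ < rk a x ∧ rk a x < rk a r₂
    · exact key x y hd hxy.1 hxy.2 (by unfold RankCross at hc; omega)
    · rw [Sym2.eq_swap (a := x)] at hd ⊢
      unfold RankCross at hc
      exact key y x hd (by omega) (by omega) (by omega)

end Accordion

end

noncomputable section

namespace Accordion

variable {n : ℕ} {D E : Finset (Segment n)}

/-! ## Maximal accordion dissections and flips -/

lemma IsAccordionDissection.isAccordionDiagonal (hE : IsAccordionDissection D E) {ε : Segment n}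
    (h : ε ∈ withBoundary (solidPolygon n) E) : IsAccordionDiagonal D ε :=
  h.elim (hE.2 ε) (isAccordionDiagonal_of_isBoundaryEdge D)

lemma IsAccordionDissection.insert {F : Finset (Segment n)} (hF : IsAccordionDissection D F)
    {γ : Segment n} (hγ : IsAccordionDiagonal D γ) (hb : ¬ IsBoundaryEdge (solidPolygon n) γ)
    (hc : ∀ ε ∈ F, ¬ Cross ε γ) : IsAccordionDissection D (insert γ F) := by
  refine ⟨⟨fun e he => ?_, fun e he f hf => ?_⟩, fun e he => ?_⟩
  · rcases Finset.mem_insert.1 he with rfl | he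
    · exact ⟨hγ.1, hb⟩
    · exact hF.1.1 e he
  · rcases Finset.mem_insert.1 he with rfl | he' <;>
      rcases Finset.mem_insert.1 hf with rfl | hf'
    · exact not_cross_refl _
    · exact fun h => hc f hf' h.symm
    · exact hc e he'
    · exact hF.1.2 e he' f hf'
  · rcases Finset.mem_insert.1 he with rfl | he
    · exact hγ
    · exact hF.2 e he

lemma IsAccordionDissection.subset {F : Finset (Segment n)} (hE : IsAccordionDissection D E)
    (h : F ⊆ E) : IsAccordionDissection D F :=
  ⟨⟨fun e he => hE.1.1 e (h he), fun e he f hf => hE.1.2 e (h he) f (h hf)⟩,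
    fun e he => hE.2 e (h he)⟩

lemma isAccordionDissection_empty (D : Finset (Segment n)) : IsAccordionDissection D ∅ :=
  ⟨⟨by simp, by simp⟩, by simp⟩

lemma IsMaximalAccordionDissection.mem (hE : IsMaximalAccordionDissection D E)
    {γ : Segment n} (hγ : IsAccordionDiagonal D γ) (hb : ¬ IsBoundaryEdge (solidPolygon n) γ)
    (hc : ∀ ε ∈ E, ¬ Cross ε γ) : γ ∈ E :=
  hE.2 (hE.1.insert hγ hb hc) (Finset.subset_insert _ _) (Finset.mem_insert_self _ _)

/-- Used to show that a diagonal of `E` crossing the recombination of two successive edges of a cut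
would itself lie between these edges. -/
lemma between_of_rankCross {p p' r r' x y : ℕ} (h1 : p < p') (h2 : p' < r') (h3 : r' < r)
    (hc : RankCross x y p r') (hce : ¬ RankCross x y p r) (hcf : ¬ RankCross x y p' r') :
    (p < x ∧ x ≤ p' ∧ r' < y ∧ y ≤ r) ∨ (p < y ∧ y ≤ p' ∧ r' < x ∧ x ≤ r) := by
  have key : (p < x ∧ x < r' ∧ (y < p ∨ r' < y)) ∨ (p < y ∧ y < r' ∧ (x < p ∨ r' < x)) := by
    unfold RankCross at hc
    omega
  have h4 : ¬ (p < x ∧ x < r ∧ (y < p ∨ r < y)) := fun h => hce (by unfold RankCross; omega)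
  have h5 : ¬ (p < y ∧ y < r ∧ (x < p ∨ r < x)) := fun h => hce (by unfold RankCross; omega)
  have h6 : ¬ (p' < x ∧ x < r' ∧ (y < p' ∨ r' < y)) := fun h => hcf (by unfold RankCross; omega)
  have h7 : ¬ (p' < y ∧ y < r' ∧ (x < p' ∨ r' < x)) := fun h => hcf (by unfold RankCross; omega)
  omega

/-- Two successive edges of a cut of a maximal accordion dissection share an endpoint. -/
lemma IsMaximalAccordionDissection.share_of_covby (hn : 3 ≤ n)
    (hD : IsDissection (hollowPolygon n) D) (hE : IsMaximalAccordionDissection D E)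
    {α β : Vertex n} (hδ : s(α, β) ∈ D) {e f : ℕ × ℕ} (he : e ∈ cut (solidPolygon n) E α β)
    (hf : f ∈ cut (solidPolygon n) E α β) (hlt : e.1 + e.2 < f.1 + f.2)
    (hmin : ∀ g ∈ cut (solidPolygon n) E α β, e.1 + e.2 < g.1 + g.2 →
      f.1 + f.2 ≤ g.1 + g.2) : e.1 = f.1 ∨ e.2 = f.2 := by
  by_contra hne
  push Not at hne
  have hmn := rk_lt α β
  have hm1 := cut_mono hE.1.1 he hf
  have hm2 := cut_mono hE.1.1 hf he
  have he' := mem_cut.1 he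
  have hf' := mem_cut.1 hf
  have e1 := rk_edge_left he; have e2 := rk_edge_right he
  have f1 := rk_edge_left hf; have f2 := rk_edge_right hf
  have hacc := (hE.1.isAccordionDiagonal he'.2.2).recombine hn hD hδ
    (hE.1.isAccordionDiagonal hf'.2.2) (by omega) (by omega) (by omega) (by omega) (by omega)
    (by omega)
  -- If `e` and `f` shared no endpoint, the left end of `e` and the right end of `f` would span an
  -- accordion diagonal. Anything in `E` crossing it would lie strictly between `e` and `f`, so by
  -- maximality it is in `E`; but then it is itself strictly between them.
  have hmem : s(vtx α e.1, vtx α (2 * n - f.2)) ∈ E := by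
    refine hE.mem hacc (fun hb => ?_) fun ε hε hc => ?_
    · refine hb.2 _ (hE.1.1.mem_of_mem hf'.2.2).1 _ (hE.1.1.mem_of_mem he'.2.2).2 ?_
      rw [cross_iff_rk α, e1, e2, f1, f2]
      unfold RankCross
      omega
    · have hεb := subset_withBoundary (P := solidPolygon n) hε
      have hce := hE.1.1.not_cross hεb he'.2.2
      have hcf := hE.1.1.not_cross hεb hf'.2.2
      have key : ∀ x y : Vertex n, s(x, y) ∈ withBoundary (solidPolygon n) E → e.1 < rk α x →
          rk α x ≤ f.1 → 2 * n - f.2 < rk α y → rk α y ≤ 2 * n - e.2 → False := by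
        intro x y hxy h1 h2 h3 h4
        have := hmin _ (mem_cut_of_rk hxy (by omega) (by omega) (by omega)).1
          (by simp only; omega)
        simp only at this
        omega
      induction ε using Sym2.ind with
      | h x y =>
        rw [edge, cross_iff_rk α, e1, e2] at hce
        rw [edge, cross_iff_rk α, f1, f2] at hcf
        rw [cross_iff_rk α, e1, f2] at hc
        have k1 := key x y hεb
        rw [Sym2.eq_swap] at hεb
        have k2 := key y x hεb
        rcases between_of_rankCross (by omega) (by omega) (by omega) hc hce hcf with h | h
        · exact k1 h.1 h.2.1 h.2.2.1 h.2.2.2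
        · exact k2 h.1 h.2.1 h.2.2.1 h.2.2.2
  have := hmin _ (mem_cut_of_rk (subset_withBoundary hmem) (by omega) (by omega) (by omega)).1
    (by simp only; omega)
  simp only at this
  omega

/-- A diagonal of the hollow dissection is an accordion diagonal of each maximal accordion
dissection. -/
lemma IsMaximalAccordionDissection.isConnectedSet (hn : 3 ≤ n)
    (hD : IsDissection (hollowPolygon n) D) (hE : IsMaximalAccordionDissection D E)
    {δ : Segment n} (hδ : δ ∈ D) : IsConnectedSet (crossedBy (solidPolygon n) E δ) := by
  induction δ using Sym2.ind with
  | h α β =>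
    rcases (cut (solidPolygon n) E α β).eq_empty_or_nonempty with h0 | h0
    · intro e he
      obtain ⟨e', he', -⟩ := exists_mem_cut he
      simp [h0] at he'
    obtain ⟨t, ht, hmax⟩ := Finset.exists_max_image _ (fun e : ℕ × ℕ => e.1 + e.2) h0
    refine isConnectedSet_of_forall (edge α t) fun d hd => ?_
    obtain ⟨e, he, rfl⟩ := exists_mem_cut hd
    have key : ∀ k, ∀ e ∈ cut (solidPolygon n) E α β, t.1 + t.2 - (e.1 + e.2) = k →
        Relation.ReflTransGen (SharesEndpoint (crossedBy (solidPolygon n) E s(α, β)))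
          (edge α e) (edge α t) := by
      intro k
      induction k using Nat.strong_induction_on with
      | _ k ih =>
        intro e he hk
        by_cases hlt : e.1 + e.2 < t.1 + t.2
        · obtain ⟨f, hf, hmin⟩ := Finset.exists_min_image
            ((cut (solidPolygon n) E α β).filter fun f => e.1 + e.2 < f.1 + f.2)
            (fun f : ℕ × ℕ => f.1 + f.2) ⟨t, Finset.mem_filter.2 ⟨ht, hlt⟩⟩
          obtain ⟨hf, hef⟩ := Finset.mem_filter.1 hf
          have hsh := hE.share_of_covby hn hD hδ he hf hef
            fun g hg hlg => hmin g (Finset.mem_filter.2 ⟨hg, hlg⟩)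
          have := hmax f hf
          exact Relation.ReflTransGen.head
            ⟨edge_mem_crossedBy he, edge_mem_crossedBy hf, (share_iff he hf).2 hsh⟩
            (ih _ (by omega) f hf rfl)
        · have h1 := cut_mono hE.1.1 he ht
          have h2 := cut_mono hE.1.1 ht he
          have h3 := hmax e he
          have : e = t := by ext <;> omega
          rw [this]
    exact key _ e he rfl

lemma IsMaximalAccordionDissection.mutualAccordion (hn : 3 ≤ n)
    (hD : IsDissection (hollowPolygon n) D) (hE : IsMaximalAccordionDissection D E) :
    MutualAccordion (hollowPolygon n) D (solidPolygon n) E where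
  three_le := hn
  left_alternating := alternating_hollow
  right_alternating := alternating_solid
  compl _ := mem_solid_iff
  left_dissection := hD
  right_dissection := hE.1.1
  left_connected _ ha := hE.isConnectedSet hn hD ha
  right_connected b hb := (hE.1.2 b hb).2

lemma exists_path_of_slalomSign_ne_zero {P : Finset (Vertex n)} {ε δ : Segment n}
    (h : slalomSign P E ε δ ≠ 0) : Cross ε δ ∧ ∃ x u v y : Vertex n, ε = s(u, v) ∧
      Cross s(x, y) s(u, v) ∧ AreNeighbours P E ε δ s(x, u) s(v, y) := by
  unfold slalomSign at h
  split_ifs at h with h1 h2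
  · obtain ⟨hc, μ, ν, hN, x, u, v, y, rfl, rfl, rfl, h3, h4⟩ := h1
    exact ⟨hc, x, u, v, y, rfl, ⟨x, y, u, v, rfl, rfl, h3, h4⟩, hN⟩
  · obtain ⟨hc, μ, ν, hN, x, u, v, y, rfl, rfl, rfl, h3, h4⟩ := h2
    exact ⟨hc, x, u, v, y, rfl, ⟨x, y, v, u, rfl, Sym2.eq_swap, h3, h4⟩, hN⟩
  · exact absurd rfl h

/-- Each diagonal of a maximal accordion dissection can be exchanged for another accordion
diagonal. -/
lemma IsMaximalAccordionDissection.exists_exchange (hn : 3 ≤ n)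
    (hD : IsDissection (hollowPolygon n) D) (hE : IsMaximalAccordionDissection D E)
    {ε : Segment n} (hε : ε ∈ E) : ∃ γ, IsAccordionDiagonal D γ ∧ Cross γ ε ∧
      ∀ d ∈ E, Cross d γ → d = ε := by
  -- By duality the signs at `ε` have a weighted sum equal to `1`, so they do not all vanish.
  obtain ⟨δ, hδ, hne⟩ : ∃ δ ∈ D, slalomSign (solidPolygon n) E ε δ ≠ 0 := by
    by_contra! hc
    have h1 := (hE.mutualAccordion hn hD).sum_slalomSign hε hε
    rw [if_pos rfl, Finset.sum_eq_zero fun a ha => by rw [hc a ha]; simp] at h1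
    exact zero_ne_one h1
  obtain ⟨hεδ, x, u, v, y, rfl, hxy, C, C', hC, hC', -, huv, ⟨⟨hμ, hμδ⟩, -, hμC⟩, ⟨hν, hνδ⟩, -,
    hνC⟩ := exists_path_of_slalomSign_ne_zero hne
  -- The new diagonal joins the far ends of the two neighbours of `ε` along `δ`. Both neighbours
  -- cross `δ`, so recombining them across `δ` gives an accordion.
  refine ⟨s(x, y), ?_, hxy, fun d hd hc => ?_⟩
  · have hμ' := hE.1.isAccordionDiagonal hμ
    have hν' := hE.1.isAccordionDiagonal hν
    rw [Sym2.eq_swap (a := x)] at hμ'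
    have main : ∀ a b : Vertex n, s(a, b) ∈ D → rk a u < rk a b →
        Cross s(u, v) s(a, b) → Cross s(x, u) s(a, b) → Cross s(v, y) s(a, b) →
        IsAccordionDiagonal D s(x, y) := by
      intro a b hab hu h1 h2 h3
      rw [cross_iff_rk a, rk_self] at h1 h2 h3
      rw [Sym2.eq_swap]
      rw [Sym2.eq_swap] at hν'
      unfold RankCross at h1 h2 h3
      exact hν'.recombine hn hD hab hμ' (by omega) (by omega) (by omega) (by omega) (by omega)
        (by omega)
    induction δ using Sym2.ind with
    | h a b =>
      by_cases hu : rk a u < rk a b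
      · exact main a b hδ hu hεδ hμδ hνδ
      · have h1 := hεδ
        rw [cross_iff_rk a, rk_self] at h1
        have hu' : rk a b < rk a u := by unfold RankCross at h1; omega
        have hab : a ≠ b := by
          rintro rfl
          unfold RankCross at h1
          rw [rk_self] at h1
          omega
        have h2 := rk_change_base_of_le hu'.le
        have h3 := rk_swap hab
        have h4 := rk_lt a u
        rw [Sym2.eq_swap (a := a)] at hδ hεδ hμδ hνδ
        exact main b a hδ (by omega) hεδ hμδ hνδ
  -- In the triangles `uxy` and `vxy`, `d` crosses `xy` but none of the other sides, which lie in
  -- cells. So `d` ends at both `u` and `v`.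
  · have hu := huv u (by simp)
    have hv := huv v (by simp)
    have hx := hμC x (by simp)
    have hy := hνC y (by simp)
    have hne : u ≠ v := (isDiagonal_mk.1 (hE.1.1.1 _ hε).1).1
    have hCd := fun z hz w hw => hC.1.2 z hz w hw d hd
    have hCd' := fun z hz w hw => hC'.1.2 z hz w hw d hd
    induction d using Sym2.ind with
    | h p q =>
      have h1 := eq_or_eq_of_cross hc (hCd u hu.1 x hx) (hCd' u hu.2 y hy)
      have h2 := eq_or_eq_of_cross hc (hCd v hv.1 x hx) (hCd' v hv.2 y hy)
      rw [Sym2.eq_iff]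
      rcases h1 with rfl | rfl <;> rcases h2 with h2 | h2
      · exact absurd h2 hne
      · exact Or.inl ⟨rfl, h2⟩
      · exact Or.inr ⟨h2, rfl⟩
      · exact absurd h2 hne

/-- Any maximal extension of the exchanged dissection misses `ε`, because it contains a diagonal
crossing `ε`; no count of its elements is needed. -/
lemma IsMaximalAccordionDissection.exists_flip (hn : 3 ≤ n)
    (hD : IsDissection (hollowPolygon n) D) (hE : IsMaximalAccordionDissection D E)
    {ε : Segment n} (hε : ε ∈ E) :
    ∃ F, IsMaximalAccordionDissection D F ∧ E.erase ε ⊆ F ∧ ε ∉ F := by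
  obtain ⟨γ, hγ, hγε, hex⟩ := hE.exists_exchange hn hD hε
  have hF : IsAccordionDissection D (insert γ (E.erase ε)) := by
    refine (hE.1.subset (Finset.erase_subset _ _)).insert hγ (fun hb => ?_) fun d hd hc => ?_
    · exact hb.not_cross (hE.1.1.1 ε hε).1 hγε
    · obtain ⟨h1, h2⟩ := Finset.mem_erase.1 hd
      exact h1 (hex d h2 hc)
  obtain ⟨F, hle, hFm⟩ := (Set.toFinite {F | IsAccordionDissection D F}).exists_le_maximal hF
  refine ⟨F, hFm, (Finset.subset_insert _ _).trans hle, fun hεF => ?_⟩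
  exact hFm.1.1.2 γ (hle (Finset.mem_insert_self _ _)) ε hεF hγε

end Accordion

end

noncomputable section

namespace Accordion

variable {n : ℕ} {D E : Finset (Segment n)}

/-! ## The fan of the `g`-vectors -/

lemma inner_gVector_cVector (D E : Finset (Segment n)) (γ ε : Segment n) :
    inner ℝ (gVector D γ) (cVector D E ε) =
      ∑ δ ∈ D, slalomSign (hollowPolygon n) D δ γ * -slalomSign (solidPolygon n) E ε δ := by
  rw [PiLp.inner_apply, ← Finset.sum_coe_sort D]
  refine Finset.sum_congr rfl fun δ _ => ?_
  simp [gVector, cVector, hollowSign, solidSign, mul_comm]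

/-- After exchanging the sums, the inner sum over `E` follows the cut of `E` by `δ` and reduces to
clockwise triples (`sum_cross_mul`). The outer sum over `D` then follows the cut of `D` by `γ`
(`sum_triple_le`). -/
lemma sum_ind_cross_mul_inner_le (hn : 3 ≤ n) (hD : IsDissection (hollowPolygon n) D)
    (hE : IsMaximalAccordionDissection D E) {γ η : Segment n} (hγ : IsAccordionDiagonal D γ)
    (hη : IsAccordionDiagonal D η) :
    ∑ ε ∈ E, ind (Cross η ε) * inner ℝ (gVector D γ) (cVector D E ε) ≤ ind (Cross η γ) := by
  have hM := (hE.mutualAccordion hn hD).symm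
  have h1 : ∑ ε ∈ E, ind (Cross η ε) * inner ℝ (gVector D γ) (cVector D E ε) =
      ∑ δ ∈ D, slalomSign (hollowPolygon n) D δ γ * (ind (∃ ε ∈ E, ClockwiseTriple δ η ε) -
        ind (∃ ε ∈ E, ClockwiseTriple δ ε η)) := by
    simp_rw [inner_gVector_cVector, Finset.mul_sum]
    rw [Finset.sum_comm]
    refine Finset.sum_congr rfl fun δ hδ => ?_
    induction δ using Sym2.ind with
    | h α β =>
      rw [← neg_sub, ← (hM.accordionCut hδ).sum_cross_mul hη.1, ← Finset.sum_neg_distrib,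
        Finset.mul_sum]
      exact Finset.sum_congr rfl fun ε _ => by ring
  rw [h1]
  induction γ using Sym2.ind with
  | h l r =>
    induction η using Sym2.ind with
    | h a b =>
      obtain ⟨-, ha, hb⟩ := isDiagonal_mk.1 hη.1
      exact (hγ.accordionCut hn hD).sum_triple_le (mem_solid_iff.1 ha) (mem_solid_iff.1 hb) E

open Classical in
lemma height_eq_sum (D : Finset (Segment n)) (γ : Segment n) : (height D γ : ℝ) =
    ∑ η ∈ Finset.univ.filter (IsAccordionDiagonal D), ind (Cross η γ) := by
  have h : {δ : Segment n | IsAccordionDiagonal D δ ∧ Cross δ γ} =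
      ((Finset.univ.filter (IsAccordionDiagonal D)).filter fun η => Cross η γ :
        Finset (Segment n)) := by
    ext; simp
  rw [height, h, Set.ncard_coe_finset]
  simp [ind]

open Classical in
lemma inner_gVector_point (D E : Finset (Segment n)) (γ : Segment n) :
    inner ℝ (gVector D γ) (point D E) = ∑ η ∈ Finset.univ.filter (IsAccordionDiagonal D),
      ∑ ε ∈ E, ind (Cross η ε) * inner ℝ (gVector D γ) (cVector D E ε) := by
  rw [point, inner_sum, Finset.sum_comm]
  refine Finset.sum_congr rfl fun ε _ => ?_
  rw [inner_smul_right, height_eq_sum, Finset.sum_mul]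

lemma inner_gVector_point_le (hn : 3 ≤ n) (hD : IsDissection (hollowPolygon n) D)
    (hE : IsMaximalAccordionDissection D E) {γ : Segment n} (hγ : IsAccordionDiagonal D γ) :
    inner ℝ (gVector D γ) (point D E) ≤ height D γ := by
  classical
  rw [inner_gVector_point, height_eq_sum]
  exact Finset.sum_le_sum fun η hη =>
    sum_ind_cross_mul_inner_le hn hD hE hγ (Finset.mem_filter.1 hη).2

lemma inner_gVector_point_lt (hn : 3 ≤ n) (hD : IsDissection (hollowPolygon n) D)
    (hE : IsMaximalAccordionDissection D E) {γ : Segment n} (hγ : IsAccordionDiagonal D γ)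
    (hb : ¬ IsBoundaryEdge (solidPolygon n) γ) (hγE : γ ∉ E) :
    inner ℝ (gVector D γ) (point D E) < height D γ := by
  classical
  obtain ⟨ε, hε, hc⟩ : ∃ ε ∈ E, Cross ε γ := by
    by_contra! hc
    exact hγE (hE.mem hγ hb hc)
  rw [inner_gVector_point, height_eq_sum]
  -- The strict term is `η = ε`: it crosses nothing in `E`, so its left side is `0`, but it crosses
  -- `γ`, so its right side is `1`.
  refine Finset.sum_lt_sum (fun η hη => sum_ind_cross_mul_inner_le hn hD hE hγ
    (Finset.mem_filter.1 hη).2) ⟨ε, by simpa using hE.1.2 ε hε, ?_⟩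
  rw [ind_true hc, Finset.sum_eq_zero fun ε' hε' => by
    rw [ind_false (hE.1.1.2 ε hε ε' hε'), zero_mul]]
  exact one_pos

lemma singleton_mem_accordionComplex {γ : Segment n} :
    {γ} ∈ accordionComplex D ↔
      IsAccordionDiagonal D γ ∧ ¬ IsBoundaryEdge (solidPolygon n) γ := by
  constructor
  · intro h
    exact ⟨h.2 γ (by simp), (h.1.1 γ (by simp)).2⟩
  · rintro ⟨h, hb⟩
    have := (isAccordionDissection_empty D).insert h hb (by simp)
    rwa [insert_empty_eq] at this

lemma isFanData (hn : 3 ≤ n) (hD : IsDissection (hollowPolygon n) D) :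
    Polytope.IsFanData (accordionComplex D) (gVector D) (fun γ => (height D γ : ℝ)) (cVector D)
      (point D) where
  finite := Set.toFinite _
  empty_mem := isAccordionDissection_empty D
  down E hE F hF := IsAccordionDissection.subset hE hF
  dual E hE v hv w hw := by
    classical
    have hE : IsMaximalAccordionDissection D E := hE
    rw [inner_gVector_cVector, (hE.mutualAccordion hn hD).sum_slalomSign hv hw]
  expand E hE y := by
    classical
    have hE : IsMaximalAccordionDissection D E := hE
    -- The duality with the two dissections exchanged gives the other product of the sign matrices,
    -- without comparing the sizes of `D` and `E`.
    have hM := (hE.mutualAccordion hn hD).symm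
    ext δ
    have h1 : ∀ ε, (inner ℝ y (cVector D E ε) : ℝ) =
        ∑ d : D, y d * -slalomSign (solidPolygon n) E ε d := by
      intro ε
      rw [PiLp.inner_apply]
      exact Finset.sum_congr rfl fun d _ => by simp [cVector, solidSign, mul_comm]
    rw [WithLp.ofLp_sum, Finset.sum_apply]
    simp_rw [h1, PiLp.smul_apply, smul_eq_mul, Finset.sum_mul]
    rw [Finset.sum_comm]
    have h2 : ∀ d : D, ∑ ε ∈ E, y d * -slalomSign (solidPolygon n) E ε d * gVector D ε δ =
        if d = δ then y d else 0 := by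
      intro d
      have h3 := hM.sum_slalomSign d.2 δ.2
      have h4 : ((d : Segment n) = δ) ↔ d = δ := Subtype.coe_inj
      simp only [h4] at h3
      rw [← mul_boole, ← h3, Finset.mul_sum]
      exact Finset.sum_congr rfl fun ε _ => by
        simp only [gVector, hollowSign]; ring
    rw [Finset.sum_congr rfl fun d _ => h2 d]
    simp
  point_eq _ := rfl
  inner_le E hE v hv := inner_gVector_point_le hn hD hE (singleton_mem_accordionComplex.1 hv).1
  mem_of_inner_eq E hE v hv h := by
    obtain ⟨h1, h2⟩ := singleton_mem_accordionComplex.1 hv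
    by_contra hne
    exact (inner_gVector_point_lt hn hD hE h1 h2 hne).ne h
  flip E hE v hv := IsMaximalAccordionDissection.exists_flip hn hD hE hv
  pos v hv := by
    obtain ⟨E, hle, hE⟩ := (Set.toFinite (accordionComplex D)).exists_le_maximal hv
    have hE : IsMaximalAccordionDissection D E := hE
    -- The exchange partner of `v` is an accordion diagonal that crosses `v`, so the height is
    -- nonzero.
    obtain ⟨γ, hγ, hc, -⟩ := hE.exists_exchange hn hD (hle (Finset.mem_singleton_self v))
    have hpos : 0 < height D v := (Set.ncard_pos (Set.toFinite _)).2 ⟨γ, hγ, hc⟩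
    exact_mod_cast hpos

end Accordion

end

theorem mainTheorem2 (n : ℕ) (hn : 3 ≤ n) (D : Finset (Accordion.Segment n))
    (hD : Accordion.IsDissection (Accordion.hollowPolygon n) D) :
    Accordion.accordiohedron D =
        (⋂ γ ∈ {γ : Accordion.Segment n | Accordion.IsAccordionDiagonal D γ},
          Accordion.halfSpace D γ) ∧
      Accordion.gVectorFan D = Polytope.normalFan (Accordion.accordiohedron D) ∧
      (0 : EuclideanSpace ℝ D) ∈ interior (Accordion.accordiohedron D) ∧
      Polytope.IsRealization (Polytope.polarDual (Accordion.accordiohedron D))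
        (Accordion.accordionComplex D) := by
  have H := Accordion.isFanData hn hD
  refine ⟨Set.Subset.antisymm ?_ ?_, H.normalFan_eq, H.zero_mem_interior,
    H.isRealization_polarDual⟩
  -- External accordion diagonals also index half-spaces, though they are not vertices of the
  -- complex. `inner_gVector_point_le` covers them; the reverse inclusion needs only the internal
  -- ones.
  · refine Set.subset_iInter₂ fun γ hγ => convexHull_min ?_ ?_
    · rintro _ ⟨E, hE, rfl⟩
      exact Accordion.inner_gVector_point_le hn hD hE hγ
    · exact convex_halfSpace_le (innerₛₗ ℝ (Accordion.gVector D γ)).isLinear _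
  · intro x hx
    have hx' : x ∈ {x | ∀ v, {v} ∈ Accordion.accordionComplex D →
        inner ℝ (Accordion.gVector D v) x ≤ (Accordion.height D v : ℝ)} := fun v hv =>
      Set.mem_iInter₂.1 hx v (Accordion.singleton_mem_accordionComplex.1 hv).1
    rw [← H.facetHull_eq] at hx'
    exact hx'
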